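/- Let $d\in\mathbb{N}$ and let $a:\mathbb{R}^d\times\mathbb{R}^d\to\mathbb{R}$ be a real symbol of Hörmander class $S^0_{0,0}(\mathbb{R}^d\times\mathbb{R}^d)$, i.e. $a$ is smooth and all its partial derivatives (including $a$ itself) are bounded. Let $F:\mathbb{R}^d\to\mathbb{R}^d$ be a smooth map whose derivatives of all strictly positive orders are bounded. For a symbol $b\in S^0_{0,0}(\mathbb{R}^d\times\mathbb{R}^d)$ let $\mathrm{Op}^w(b)$ denote its Weyl quantization, that is, the (unique) bounded operator on $L^2(\mathbb{R}^d)$ which acts on Schwartz functions $\varphi$ by the oscillatory integral $$\big(\mathrm{Op}^w(b)\varphi\big)(x)=(2\pi)^{-d}\int_{\mathbb{R}^d}\int_{\mathbb{R}^d} e^{i\langle\eta,x-y\rangle}\,b\big(\tfrac{x+y}{2},\eta\big)\,\varphi(y)\,dy\,d\eta .$$ For $\delta\in\mathbb{R}$, $|\delta|\le 1$, put $a[F]_\delta(x,\xi):=a(x+\delta F(x),\xi)$ and $K_\delta:=\mathrm{Op}^w(a[F]_\delta)$, a bounded self-adjoint operator on $L^2(\mathbb{R}^d)$, and let $\mathcal{E}_+(\delta):=\sup\sigma(K_\delta)$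 and $\mathcal{E}_-(\delta):=\inf\sigma(K_\delta)$ be its spectral edges. Suppose that for some $\mu>0$ and some $C>0$, $$\big|(\partial_{x_j}\partial_{x_k}F)(x)\big|\le C\,(1+|x|^2)^{-(1+\mu)/2}\qquad\text{for all }x\in\mathbb{R}^d\text{ and all }j,k\in\{1,\dots,d\}.$$ Then there exist $C(a,F)>0$ and $\delta_0>0$ such that for all $\delta\in\mathbb{R}$ with $|\delta|\le\delta_0$, $$\big|\mathcal{E}_+(\delta)-\mathcal{E}_+(0)\big|\le C(a,F)\,|\delta|^{(1+\mu)/(2+\mu)}\quad\text{and}\quad\big|\mathcal{E}_-(\delta)-\mathcal{E}_-(0)\big|\le C(a,F)\,|\delta|^{(1+\mu)/(2+\mu)} .$$ -/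

import Mathlib

open MeasureTheory
open scoped SchwartzMap ContDiff

/-- The configuration space `ℝ^d` with its Euclidean structure. -/
abbrev Rd (d : ℕ) : Type := EuclideanSpace ℝ (Fin d)

/-- The complex Hilbert space `L²(ℝ^d)` (Lebesgue measure). -/
abbrev L2Rd (d : ℕ) : Type := Lp ℂ 2 (volume : Measure (Rd d))

/-- Real symbols of the Hörmander class `S^0_{0,0}(ℝ^d × ℝ^d)`: smooth functions, all of whose
derivatives (including those of order zero) are bounded. -/
def IsSymbolS000 {d : ℕ} (a : Rd d × Rd d → ℝ) : Prop :=
  ContDiff ℝ ∞ a ∧ ∀ n : ℕ, ∃ C : ℝ, ∀ p, ‖iteratedFDeriv ℝ n a p‖ ≤ C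

/-- The space `C^∞_1(ℝ^d; ℝ^d)`: smooth maps whose derivatives of all strictly positive orders are
bounded (the map itself may grow linearly). -/
def IsC1infty {d : ℕ} (F : Rd d → Rd d) : Prop :=
  ContDiff ℝ ∞ F ∧ ∀ n : ℕ, 1 ≤ n → ∃ C : ℝ, ∀ x, ‖iteratedFDeriv ℝ n F x‖ ≤ C

/-- The second order partial derivative `∂_j ∂_k F` at `x`. -/
noncomputable def secondPartial {d : ℕ} (F : Rd d → Rd d) (j k : Fin d) (x : Rd d) : Rd d :=
  iteratedFDeriv ℝ 2 F x ![EuclideanSpace.single j 1, EuclideanSpace.single k 1]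

/-- The weight `⟨x⟩ = (1 + |x|^2)^{1/2}`. -/
noncomputable def japaneseBracket {d : ℕ} (x : Rd d) : ℝ := Real.sqrt (1 + ‖x‖ ^ 2)

/-- The perturbed symbol `a[F]_δ (x, ξ) = a (x + δ F(x), ξ)`. -/
def perturbedSymbol {d : ℕ} (a : Rd d × Rd d → ℝ) (F : Rd d → Rd d) (δ : ℝ) :
    Rd d × Rd d → ℝ :=
  fun p => a (p.1 + δ • F p.1, p.2)

/-- The Weyl quantization of the symbol `a`, applied to a Schwartz function:
`(2π)^{-d} ∬ e^{i⟨η, x - y⟩} a((x + y)/2, η) φ(y) dy dη`.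
The oscillatory integral is written as the iterated integral in which `y` is integrated first: for
a symbol of class `S^0_{0,0}` the inner integral converges absolutely and, by integration by
parts in `y`, decays faster than any power of `η`, so that the outer one converges absolutely. -/
noncomputable def weylAction {d : ℕ} (a : Rd d × Rd d → ℝ) (φ : 𝓢(Rd d, ℂ)) (x : Rd d) : ℂ :=
  (((2 * Real.pi) ^ d)⁻¹ : ℝ) *
    ∫ η : Rd d, ∫ y : Rd d,
      Complex.exp (Complex.I * (inner ℝ η (x - y) : ℝ)) *
        (a ((1 / 2 : ℝ) • (x + y), η) : ℂ) * φ y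

/-- `T` is the bounded extension to `L²(ℝ^d)` of the Weyl quantization of `a`. -/
def IsWeylExtension {d : ℕ} (a : Rd d × Rd d → ℝ) (T : L2Rd d →L[ℂ] L2Rd d) : Prop :=
  ∀ φ : 𝓢(Rd d, ℂ), (T (φ.toLp 2 volume) : Rd d → ℂ) =ᵐ[volume] weylAction a φ

/-- The bounded extension is unique. -/
theorem IsWeylExtension.unique {d : ℕ} {a : Rd d × Rd d → ℝ} {S T : L2Rd d →L[ℂ] L2Rd d}
    (hS : IsWeylExtension a S) (hT : IsWeylExtension a T) : S = T := by
  have hd : DenseRange (SchwartzMap.toLpCLM ℝ (E := Rd d) ℂ 2 volume) :=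
    SchwartzMap.denseRange_toLpCLM (by norm_num)
  have h : (S : L2Rd d → L2Rd d) = T := by
    refine hd.equalizer S.continuous T.continuous ?_
    funext φ
    exact Lp.ext ((hS φ).trans (hT φ).symm)
  exact DFunLike.coe_injective h

open Classical in
/-- The operator `Op^w(a)` on `L²(ℝ^d)`: the bounded extension of the Weyl quantization from the
Schwartz space (and `0` if there is none, which does not happen for symbols in `S^0_{0,0}`). -/
noncomputable def weylOp {d : ℕ} (a : Rd d × Rd d → ℝ) : L2Rd d →L[ℂ] L2Rd d :=
  if h : ∃ T : L2Rd d →L[ℂ] L2Rd d, IsWeylExtension a T then h.choose else 0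

/-- The upper spectral edge `sup σ(T)`; the spectrum is always non-empty and compact, and it is
real for the self-adjoint operators considered here. -/
noncomputable def upperEdge {d : ℕ} (T : L2Rd d →L[ℂ] L2Rd d) : ℝ :=
  sSup (Complex.re '' spectrum ℂ T)

/-- The lower spectral edge `inf σ(T)`. -/
noncomputable def lowerEdge {d : ℕ} (T : L2Rd d →L[ℂ] L2Rd d) : ℝ :=
  sInf (Complex.re '' spectrum ℂ T)

/-! The edges are in fact Lipschitz in `δ` at `0`; since `|δ| ≤ 1` and `(1 + μ) / (2 + μ) ≤ 1`, this
implies the stated Hölder bound.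

Let `δ > 0`, let `h` be an even bump and let `f` be smooth with compact support. Cut `f` with the
window `h(δ^(-1/2) (s - δ F(x)))` and translate the result by `s`; call it `g_s`. The window forces
`s` to lie within `O(√δ)` of `δ F(x)`, and the translation moves the position argument of the symbol
by `s`, so testing `Op(a)` on `g_s` resembles testing `Op(a[F]_δ)` on `f`. In the integral of `⟨g_s,
Op(a) g_s⟩` over `s`, substitute `s ↦ √δ s + (δ/2)(F(x) + F(y))` in the kernel. The windows become
`h(s - u) h(s + u)` with `u = √δ (F(x) - F(y))/2`. By evenness of `h` the terms linear in `√δ s` and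
in `u` cancel, and replacing the average of `F(x)` and `F(y)` by `F((x + y)/2)` costs `O(δ |x -
y|)`. So the integral equals `δ^(d/2) ∫ h²` times `⟨f, Op(a[F]_δ) f⟩`, up to `δ^(d/2)` times a form
whose amplitude is `O(δ (1 + |x - y|²))` with all its derivatives (`symbolClass_errorAmplitude`,
`integral_oscForm_coherentState`).

A Calderón–Vaillancourt theorem for amplitudes that may grow like `1 + |x - y|²`
(`exists_norm_oscForm_le`) bounds that form by `C δ ‖f‖²`. Since `∫ ‖g_s‖² ds = δ^(d/2) (∫ h²)
‖f‖²`, an upper bound `M` for `Op(a)` becomes the upper bound `M + C δ` for `Op(a[F]_δ)`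
(`exists_weylForm_perturbed_le`).

For the reverse inequality, the inverse of `id + δ F` is `id + δ G_δ` with `G_δ` of the same class
uniformly in `δ` (`exists_inverse_perturbation`), so the same transfer leads back from `a[F]_δ` to
`a`. Negative `δ` is reduced to `-F`, the lower edge to `-a`. -/

set_option linter.unusedSectionVars false

/-! ### Uniform symbol estimates for families of functions, with weights. -/

section SymbolBounds

variable {ι κ : Type*} {E F G H : Type*}
  [NormedAddCommGroup E] [NormedSpace ℝ E] [NormedAddCommGroup F] [NormedSpace ℝ F]
  [NormedAddCommGroup G] [NormedSpace ℝ G] [NormedAddCommGroup H] [NormedSpace ℝ H]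

/-- A family of smooth functions whose derivatives up to order `n` are bounded by the weights `w`,
uniformly in the index. -/
def SymbolBound (n : ℕ) (w : ι → E → ℝ) (p : ι → E → F) : Prop :=
  (∀ i, ContDiff ℝ ∞ (p i)) ∧
    ∀ k ≤ n, ∃ C : ℝ, 0 < C ∧ ∀ i x, ‖iteratedFDeriv ℝ k (p i) x‖ ≤ C * w i x

/-- A family of smooth functions all of whose derivatives are bounded by the weights `w`,
uniformly in the index. -/
def SymbolClass (w : ι → E → ℝ) (p : ι → E → F) : Prop := ∀ n, SymbolBound n w p

namespace SymbolBound

variable {n m : ℕ} {w w' : ι → E → ℝ} {p q : ι → E → F}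

theorem of_le (h : SymbolBound n w p) (hm : m ≤ n) : SymbolBound m w p :=
  ⟨h.1, fun k hk => h.2 k (hk.trans hm)⟩

theorem exists_bound (h : SymbolBound n w p) :
    ∃ C : ℝ, 0 < C ∧ ∀ k ≤ n, ∀ i x, ‖iteratedFDeriv ℝ k (p i) x‖ ≤ C * w i x := by
  have h' : ∀ k, ∃ C : ℝ, 0 < C ∧ (k ≤ n → ∀ i x, ‖iteratedFDeriv ℝ k (p i) x‖ ≤ C * w i x) := by
    intro k
    by_cases hk : k ≤ n
    · obtain ⟨C, hC, h⟩ := h.2 k hk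
      exact ⟨C, hC, fun _ => h⟩
    · exact ⟨1, one_pos, fun h => absurd h hk⟩
  choose C hC hb using h'
  refine ⟨∑ k ∈ Finset.range (n + 1), C k,
    Finset.sum_pos (fun k _ => hC k) ⟨0, by simp⟩, fun k hk i x => ?_⟩
  have h0 : 0 ≤ w i x :=
    nonneg_of_mul_nonneg_right ((norm_nonneg _).trans (hb k hk i x)) (hC k)
  refine (hb k hk i x).trans (mul_le_mul_of_nonneg_right ?_ h0)
  exact Finset.single_le_sum (f := C) (fun k _ => (hC k).le) (by simp; omega)

theorem exists_bound_zero (h : SymbolBound n w p) : ∃ C : ℝ, 0 < C ∧ ∀ i x, ‖p i x‖ ≤ C * w i x := by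
  obtain ⟨C, hC, hb⟩ := h.2 0 (Nat.zero_le n)
  exact ⟨C, hC, fun i x => by simpa using hb i x⟩

/-- The constants in `SymbolBound` are strictly positive, so the sign of the weight never has to be
assumed separately. -/
theorem weight_nonneg (h : SymbolBound n w p) (i : ι) (x : E) : 0 ≤ w i x := by
  obtain ⟨C, hC, hb⟩ := h.exists_bound_zero
  exact nonneg_of_mul_nonneg_right ((norm_nonneg _).trans (hb i x)) hC

theorem mono (h : SymbolBound n w p) {B : ℝ} (hB : 0 < B) (hw : ∀ i x, w i x ≤ B * w' i x) :
    SymbolBound n w' p := by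
  refine ⟨h.1, fun k hk => ?_⟩
  obtain ⟨C, hC, hb⟩ := h.2 k hk
  refine ⟨C * B, by positivity, fun i x => (hb i x).trans ?_⟩
  rw [mul_assoc]
  exact mul_le_mul_of_nonneg_left (hw i x) hC.le

theorem reindex (h : SymbolBound n w p) (σ : κ → ι) :
    SymbolBound n (fun j => w (σ j)) (fun j => p (σ j)) :=
  ⟨fun j => h.1 (σ j), fun k hk => by
    obtain ⟨C, hC, hb⟩ := h.2 k hk
    exact ⟨C, hC, fun j x => hb (σ j) x⟩⟩

theorem zero_iff : SymbolBound 0 w p ↔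
    (∀ i, ContDiff ℝ ∞ (p i)) ∧ ∃ C : ℝ, 0 < C ∧ ∀ i x, ‖p i x‖ ≤ C * w i x := by
  refine ⟨fun h => ⟨h.1, h.exists_bound_zero⟩, fun h => ⟨h.1, fun k hk => ?_⟩⟩
  obtain rfl : k = 0 := by omega
  simpa using h.2

/-- This is why orders are counted one at a time: estimates defined by a recursion for the
derivative are proved by induction on `n`. -/
theorem succ_iff : SymbolBound (n + 1) w p ↔
    SymbolBound 0 w p ∧ SymbolBound n w (fun i => fderiv ℝ (p i)) := by
  constructor
  · intro h
    refine ⟨h.of_le (by omega), fun i => (h.1 i).fderiv_right (m := ∞) (by simp), fun k hk => ?_⟩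
    obtain ⟨C, hC, hb⟩ := h.2 (k + 1) (by omega)
    exact ⟨C, hC, fun i x => by simpa only [norm_iteratedFDeriv_fderiv] using hb i x⟩
  · rintro ⟨h0, h1⟩
    refine ⟨h0.1, fun k hk => ?_⟩
    cases k with
    | zero => exact h0.2 0 le_rfl
    | succ k =>
      obtain ⟨C, hC, hb⟩ := h1.2 k (by omega)
      exact ⟨C, hC, fun i x => by simpa only [norm_iteratedFDeriv_fderiv] using hb i x⟩

theorem fderiv (h : SymbolBound (n + 1) w p) : SymbolBound n w (fun i => fderiv ℝ (p i)) :=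
  (succ_iff.1 h).2

theorem add (hp : SymbolBound n w p) (hq : SymbolBound n w q) :
    SymbolBound n w (fun i x => p i x + q i x) := by
  refine ⟨fun i => (hp.1 i).add (hq.1 i), fun k hk => ?_⟩
  obtain ⟨C, hC, hb⟩ := hp.2 k hk
  obtain ⟨D, hD, hd⟩ := hq.2 k hk
  refine ⟨C + D, by positivity, fun i x => ?_⟩
  have : iteratedFDeriv ℝ k (fun x => p i x + q i x) x
      = iteratedFDeriv ℝ k (p i) x + iteratedFDeriv ℝ k (q i) x :=
    iteratedFDeriv_add_apply ((hp.1 i).of_le (by exact_mod_cast le_top)).contDiffAt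
      ((hq.1 i).of_le (by exact_mod_cast le_top)).contDiffAt
  rw [this, add_mul]
  exact (norm_add_le _ _).trans (add_le_add (hb i x) (hd i x))

theorem bilin (B : F →L[ℝ] G →L[ℝ] H) {q : ι → E → G} (hp : SymbolBound n w p)
    (hq : SymbolBound n w' q) :
    SymbolBound n (fun i x => w i x * w' i x) (fun i x => B (p i x) (q i x)) := by
  refine ⟨fun i => (B.isBoundedBilinearMap.contDiff).comp₂ (hp.1 i) (hq.1 i), fun k hk => ?_⟩
  obtain ⟨C, hC, hb⟩ := hp.exists_bound
  obtain ⟨D, hD, hd⟩ := hq.exists_bound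
  refine ⟨(‖B‖ + 1) * (∑ j ∈ Finset.range (k + 1), (k.choose j : ℝ)) * (C * D), ?_, fun i x => ?_⟩
  · have : (0 : ℝ) < ∑ j ∈ Finset.range (k + 1), (k.choose j : ℝ) := by
      have := Nat.sum_range_choose k
      rw [← Nat.cast_sum, this]; positivity
    positivity
  · refine (B.norm_iteratedFDeriv_le_of_bilinear (hp.1 i) (hq.1 i) x
      (n := k) (by exact_mod_cast le_top)).trans ?_
    have hw := hp.weight_nonneg i x
    have hw' := hq.weight_nonneg i x
    have : ∑ j ∈ Finset.range (k + 1), (k.choose j : ℝ) * ‖iteratedFDeriv ℝ j (p i) x‖ *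
        ‖iteratedFDeriv ℝ (k - j) (q i) x‖ ≤
        ∑ j ∈ Finset.range (k + 1), (k.choose j : ℝ) * (C * w i x) * (D * w' i x) := by
      refine Finset.sum_le_sum fun j hj => ?_
      have hj' : j ≤ k := by simpa [Nat.lt_succ_iff] using hj
      have h1 := hb j (hj'.trans hk) i x
      have h2 := hd (k - j) (by omega) i x
      gcongr
    calc _ ≤ (‖B‖ + 1) * ∑ j ∈ Finset.range (k + 1), (k.choose j : ℝ) * (C * w i x) * (D * w' i x) := by
          gcongr
          linarith
      _ = _ := by
          rw [← Finset.sum_mul, ← Finset.sum_mul]; ring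

theorem clm (L : F →L[ℝ] G) (hp : SymbolBound n w p) : SymbolBound n w (fun i x => L (p i x)) := by
  refine ⟨fun i => L.contDiff.comp (hp.1 i), fun k hk => ?_⟩
  obtain ⟨C, hC, hb⟩ := hp.2 k hk
  refine ⟨(‖L‖ + 1) * C, by positivity, fun i x => ?_⟩
  refine (L.norm_iteratedFDeriv_comp_left (hp.1 i).contDiffAt
    (n := k) (by exact_mod_cast le_top)).trans ?_
  rw [mul_assoc]
  exact mul_le_mul (by linarith) (hb i x) (norm_nonneg _) (by positivity)

theorem neg (hp : SymbolBound n w p) : SymbolBound n w (fun i x => -p i x) := by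
  simpa using hp.clm (-ContinuousLinearMap.id ℝ F)

theorem sub (hp : SymbolBound n w p) (hq : SymbolBound n w q) :
    SymbolBound n w (fun i x => p i x - q i x) := by
  simpa [sub_eq_add_neg] using hp.add hq.neg

theorem const_smul (c : ι → ℝ) (hp : SymbolBound n w p) :
    SymbolBound n (fun i x => |c i| * w i x) (fun i x => c i • p i x) := by
  refine ⟨fun i => (hp.1 i).const_smul (c i), fun k hk => ?_⟩
  obtain ⟨C, hC, hb⟩ := hp.2 k hk
  refine ⟨C, hC, fun i x => ?_⟩
  have : iteratedFDeriv ℝ k (fun x => c i • p i x) x = c i • iteratedFDeriv ℝ k (p i) x :=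
    iteratedFDeriv_const_smul_apply' ((hp.1 i).of_le (by exact_mod_cast le_top)).contDiffAt
  rw [this, norm_smul, Real.norm_eq_abs]
  calc |c i| * _ ≤ |c i| * (C * w i x) := mul_le_mul_of_nonneg_left (hb i x) (abs_nonneg _)
    _ = _ := by ring

theorem const (c : ι → F) {B : ℝ} (hc : ∀ i, ‖c i‖ ≤ B) :
    SymbolBound n (fun _ _ => 1) (fun i (_ : E) => c i) := by
  refine ⟨fun i => contDiff_const, fun k _ => ⟨|B| + 1, by positivity, fun i x => ?_⟩⟩
  cases k with
  | zero => simpa using (hc i).trans ((le_abs_self B).trans (by linarith))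
  | succ k => simp [iteratedFDeriv_succ_const]; positivity

/-- Faà di Bruno involves only derivatives of `g` of positive order, so `g` itself may grow, as `id
+ δ F` does. Asking for `fderiv g` only up to order `n - 1` is what later permits a bootstrap for
inverse maps. -/
theorem comp {f : ι → F → G} {w : ι → F → ℝ} {g : ι → E → F} (hf : SymbolBound n w f)
    (hg : ∀ i, ContDiff ℝ ∞ (g i))
    (hg' : ∀ m, m + 1 ≤ n → SymbolBound m (fun _ _ => 1) (fun i => _root_.fderiv ℝ (g i))) :
    SymbolBound n (fun i x => w i (g i x)) (fun i x => f i (g i x)) := by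
  refine ⟨fun i => (hf.1 i).comp (hg i), fun k hk => ?_⟩
  obtain ⟨C, hC, hb⟩ := hf.exists_bound
  -- The composition estimate wants the bound `D ^ j` on the derivative of order `j`; with `1 ≤ D` a
  -- single bound `D` is enough.
  obtain ⟨D, hD, hd⟩ : ∃ D : ℝ, 1 ≤ D ∧ ∀ j, 1 ≤ j → j ≤ n → ∀ i x,
      ‖iteratedFDeriv ℝ j (g i) x‖ ≤ D := by
    cases n with
    | zero => exact ⟨1, le_rfl, fun j h1 h2 => by omega⟩
    | succ n =>
      obtain ⟨D, hD, hd⟩ := (hg' n le_rfl).exists_bound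
      refine ⟨D + 1, by linarith, fun j h1 h2 i x => ?_⟩
      obtain ⟨j, rfl⟩ : ∃ l, j = l + 1 := ⟨j - 1, by omega⟩
      have := hd j (by omega) i x
      rw [norm_iteratedFDeriv_fderiv] at this
      linarith
  refine ⟨k.factorial * C * D ^ k, by positivity, fun i x => ?_⟩
  have := norm_iteratedFDeriv_comp_le (hf.1 i) (hg i) (n := k) (by exact_mod_cast le_top) x
    (fun j hj => hb j (hj.trans hk) i (g i x))
    (fun j h1 h2 => (hd j h1 (h2.trans hk) i x).trans (le_self_pow₀ hD (by omega)))
  refine this.trans (le_of_eq ?_)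
  ring

end SymbolBound

namespace SymbolClass

variable {w w' : ι → E → ℝ} {p q : ι → E → F}

theorem contDiff (h : SymbolClass w p) (i : ι) : ContDiff ℝ ∞ (p i) := (h 0).1 i

theorem continuous (h : SymbolClass w p) (i : ι) : Continuous (p i) := (h.contDiff i).continuous

theorem exists_bound (h : SymbolClass w p) : ∃ C : ℝ, 0 < C ∧ ∀ i x, ‖p i x‖ ≤ C * w i x :=
  (h 0).exists_bound_zero

theorem weight_nonneg (h : SymbolClass w p) (i : ι) (x : E) : 0 ≤ w i x := (h 0).weight_nonneg i x

theorem mono (h : SymbolClass w p) {B : ℝ} (hB : 0 < B) (hw : ∀ i x, w i x ≤ B * w' i x) :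
    SymbolClass w' p := fun n => (h n).mono hB hw

theorem of_weight_le (h : SymbolClass w p) (hw : ∀ i x, w i x ≤ w' i x) :
    SymbolClass w' p := h.mono one_pos (by simpa using hw)

theorem reindex (h : SymbolClass w p) (σ : κ → ι) :
    SymbolClass (fun j => w (σ j)) (fun j => p (σ j)) := fun n => (h n).reindex σ

theorem fderiv (h : SymbolClass w p) : SymbolClass w (fun i => fderiv ℝ (p i)) :=
  fun n => (h (n + 1)).fderiv

theorem of_fderiv (hp : ∀ i, ContDiff ℝ ∞ (p i))
    (h0 : ∃ C : ℝ, 0 < C ∧ ∀ i x, ‖p i x‖ ≤ C * w i x)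
    (h1 : SymbolClass w (fun i => _root_.fderiv ℝ (p i))) : SymbolClass w p := by
  intro n
  cases n with
  | zero => exact SymbolBound.zero_iff.2 ⟨hp, h0⟩
  | succ n => exact SymbolBound.succ_iff.2 ⟨SymbolBound.zero_iff.2 ⟨hp, h0⟩, h1 n⟩

theorem add (hp : SymbolClass w p) (hq : SymbolClass w q) :
    SymbolClass w (fun i x => p i x + q i x) := fun n => (hp n).add (hq n)

theorem sub (hp : SymbolClass w p) (hq : SymbolClass w q) :
    SymbolClass w (fun i x => p i x - q i x) := fun n => (hp n).sub (hq n)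

theorem neg (hp : SymbolClass w p) : SymbolClass w (fun i x => -p i x) := fun n => (hp n).neg

theorem bilin (B : F →L[ℝ] G →L[ℝ] H) {q : ι → E → G} (hp : SymbolClass w p)
    (hq : SymbolClass w' q) :
    SymbolClass (fun i x => w i x * w' i x) (fun i x => B (p i x) (q i x)) :=
  fun n => (hp n).bilin B (hq n)

theorem mul {A : Type*} [NormedRing A] [NormedAlgebra ℝ A] {p q : ι → E → A}
    (hp : SymbolClass w p) (hq : SymbolClass w' q) :
    SymbolClass (fun i x => w i x * w' i x) (fun i x => p i x * q i x) :=
  hp.bilin (ContinuousLinearMap.mul ℝ A) hq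

theorem smul {p : ι → E → ℝ} {q : ι → E → F} (hp : SymbolClass w p) (hq : SymbolClass w' q) :
    SymbolClass (fun i x => w i x * w' i x) (fun i x => p i x • q i x) :=
  hp.bilin (ContinuousLinearMap.lsmul ℝ ℝ) hq

theorem clm (L : F →L[ℝ] G) (hp : SymbolClass w p) : SymbolClass w (fun i x => L (p i x)) :=
  fun n => (hp n).clm L

theorem const_smul (c : ι → ℝ) (hp : SymbolClass w p) :
    SymbolClass (fun i x => |c i| * w i x) (fun i x => c i • p i x) :=
  fun n => (hp n).const_smul c

theorem const (c : ι → F) {B : ℝ} (hc : ∀ i, ‖c i‖ ≤ B) :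
    SymbolClass (fun _ _ => 1) (fun i (_ : E) => c i) := fun _ => SymbolBound.const c hc

theorem comp {f : ι → F → G} {w : ι → F → ℝ} {g : ι → E → F} (hf : SymbolClass w f)
    (hg : ∀ i, ContDiff ℝ ∞ (g i))
    (hg' : SymbolClass (fun _ _ => 1) (fun i => _root_.fderiv ℝ (g i))) :
    SymbolClass (fun i x => w i (g i x)) (fun i x => f i (g i x)) :=
  fun n => (hf n).comp hg fun m _ => hg' m

theorem fderiv_clm (L : E →L[ℝ] F) :
    SymbolClass (fun _ _ => 1) (fun (_ : ι) => _root_.fderiv ℝ (fun x => L x)) := by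
  have : (fun (_ : ι) => _root_.fderiv ℝ (fun x => L x)) = fun _ _ => L := by
    ext i x : 2; exact L.fderiv
  rw [this]
  exact const _ (fun _ => le_rfl)

theorem comp_clm {f : ι → F → G} {w : ι → F → ℝ} (hf : SymbolClass w f) (L : E →L[ℝ] F) :
    SymbolClass (fun i x => w i (L x)) (fun i x => f i (L x)) :=
  hf.comp (fun _ => L.contDiff) (fderiv_clm L)

theorem congr_fun {q : ι → E → F} (h : SymbolClass w p) (hpq : ∀ i x, q i x = p i x) :
    SymbolClass w q := by
  have : q = p := by ext i x; exact hpq i x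
  rwa [this]

theorem congr_weight {w' : ι → E → ℝ} (h : SymbolClass w p) (hw : ∀ i x, w i x = w' i x) :
    SymbolClass w' p := h.of_weight_le fun i x => (hw i x).le

/-- A family of functions with bounded derivatives is uniformly Lipschitz. -/
theorem exists_lipschitz (h : SymbolClass (fun _ _ => 1) (fun i => _root_.fderiv ℝ (p i)))
    (hp : ∀ i, ContDiff ℝ ∞ (p i)) :
    ∃ C : ℝ, 0 < C ∧ ∀ i x y, ‖p i x - p i y‖ ≤ C * ‖x - y‖ := by
  obtain ⟨C, hC, hb⟩ := h.exists_bound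
  refine ⟨C, hC, fun i x y => ?_⟩
  exact Convex.norm_image_sub_le_of_norm_fderiv_le (𝕜 := ℝ) (s := Set.univ)
    (fun x _ => ((hp i).differentiable (by simp)).differentiableAt)
    (fun x _ => by simpa using hb i x) convex_univ (Set.mem_univ y) (Set.mem_univ x)

end SymbolClass

end SymbolBounds

theorem SymbolBound.clm_comp {ι D E F G : Type*} [NormedAddCommGroup D] [NormedSpace ℝ D]
    [NormedAddCommGroup E] [NormedSpace ℝ E] [NormedAddCommGroup F] [NormedSpace ℝ F]
    [NormedAddCommGroup G] [NormedSpace ℝ G] {n : ℕ} {w w' : ι → D → ℝ} {p : ι → D → F →L[ℝ] G}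
    {q : ι → D → E →L[ℝ] F} (hp : SymbolBound n w p) (hq : SymbolBound n w' q) :
    SymbolBound n (fun i x => w i x * w' i x) (fun i x => (p i x).comp (q i x)) :=
  hp.bilin (ContinuousLinearMap.compL ℝ E F G) hq

theorem SymbolClass.clm_comp {ι D E F G : Type*} [NormedAddCommGroup D] [NormedSpace ℝ D]
    [NormedAddCommGroup E] [NormedSpace ℝ E] [NormedAddCommGroup F] [NormedSpace ℝ F]
    [NormedAddCommGroup G] [NormedSpace ℝ G] {w w' : ι → D → ℝ} {p : ι → D → F →L[ℝ] G}
    {q : ι → D → E →L[ℝ] F} (hp : SymbolClass w p) (hq : SymbolClass w' q) :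
    SymbolClass (fun i x => w i x * w' i x) (fun i x => (p i x).comp (q i x)) :=
  fun n => (hp n).clm_comp (hq n)

/-! ### Differences and second-order vanishing inside symbol classes. -/

section SymbolClassCalculus

universe u

variable {ι : Type*} {E : Type*} {F G : Type u}
  [NormedAddCommGroup E] [NormedSpace ℝ E] [NormedAddCommGroup F] [NormedSpace ℝ F]
  [NormedAddCommGroup G] [NormedSpace ℝ G]

namespace SymbolClass

/-- The mean value inequality for each iterated derivative: one more derivative is paid for one
factor `‖τ‖`. The weight is constant in `x` because the whole segment from `x` to `x + τ` is seen.
-/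
theorem translate_sub {c : ι → ℝ} {p : ι → E → G} (hp : SymbolClass (fun i _ => c i) p)
    (τ : ι → E) :
    SymbolClass (fun i _ => c i * ‖τ i‖) (fun i x => p i (x + τ i) - p i x) := by
  intro n
  have hs : ∀ i, ContDiff ℝ ∞ (fun x => p i (x + τ i)) := fun i =>
    (hp.contDiff i).comp (contDiff_id.add contDiff_const)
  refine ⟨fun i => (hs i).sub (hp.contDiff i), fun k _ => ?_⟩
  obtain ⟨C, hC, hb⟩ := (hp (k + 1)).2 (k + 1) le_rfl
  refine ⟨C, hC, fun i x => ?_⟩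
  have h1 : iteratedFDeriv ℝ k (fun x => p i (x + τ i) - p i x) x
      = iteratedFDeriv ℝ k (p i) (x + τ i) - iteratedFDeriv ℝ k (p i) x := by
    rw [← iteratedFDeriv_comp_add_right]
    exact iteratedFDeriv_sub_apply ((hs i).of_le (by exact_mod_cast le_top)).contDiffAt
      ((hp.contDiff i).of_le (by exact_mod_cast le_top)).contDiffAt
  rw [h1]
  have h2 := Convex.norm_image_sub_le_of_norm_fderiv_le (𝕜 := ℝ) (s := Set.univ)
    (f := iteratedFDeriv ℝ k (p i)) (C := C * c i) (x := x) (y := x + τ i)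
    (fun y _ => (((hp.contDiff i).differentiable_iteratedFDeriv (m := k)
      (by exact_mod_cast ENat.natCast_lt_top k)) y))
    (fun y _ => by rw [norm_fderiv_iteratedFDeriv]; exact hb i y) convex_univ (Set.mem_univ _)
    (Set.mem_univ _)
  simpa [mul_assoc] using h2

/-- The derivative of the difference is `(f'∘g - f'∘g') Dg + (f'∘g') D(g - g')`. The first term is
the same problem for `f'` at one order less. -/
theorem comp_sub_comp {w : ι → E → ℝ} {f : ι → F → G} {g g' : ι → E → F}
    (hf : SymbolClass (fun _ _ => 1) f)
    (hg : ∀ i, ContDiff ℝ ∞ (g i)) (hdg : SymbolClass (fun _ _ => 1) (fun i => _root_.fderiv ℝ (g i)))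
    (hg' : ∀ i, ContDiff ℝ ∞ (g' i))
    (hdg' : SymbolClass (fun _ _ => 1) (fun i => _root_.fderiv ℝ (g' i)))
    (hd : SymbolClass w (fun i x => g i x - g' i x)) :
    SymbolClass w (fun i x => f i (g i x) - f i (g' i x)) := by
  intro n
  -- The induction hypothesis is applied to `fderiv f`, with values in `F →L[ℝ] G`; hence the
  -- codomain varies and `F`, `G` share a universe.
  induction n generalizing G with
  | zero =>
    obtain ⟨C, hC, hL⟩ := hf.fderiv.exists_lipschitz hf.contDiff
    obtain ⟨D, hD, hb⟩ := hd.exists_bound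
    refine SymbolBound.zero_iff.2 ⟨fun i => ((hf.contDiff i).comp (hg i)).sub
      ((hf.contDiff i).comp (hg' i)), C * D, by positivity, fun i x => ?_⟩
    calc _ ≤ C * ‖g i x - g' i x‖ := hL i _ _
      _ ≤ C * (D * w i x) := by gcongr; exact hb i x
      _ = _ := by ring
  | succ n ih =>
    obtain ⟨C, hC, hL⟩ := hf.fderiv.exists_lipschitz hf.contDiff
    obtain ⟨D, hD, hb⟩ := hd.exists_bound
    refine SymbolBound.succ_iff.2 ⟨SymbolBound.zero_iff.2 ⟨fun i => ((hf.contDiff i).comp (hg i)).sub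
      ((hf.contDiff i).comp (hg' i)), C * D, by positivity, fun i x => ?_⟩, ?_⟩
    · calc _ ≤ C * ‖g i x - g' i x‖ := hL i _ _
        _ ≤ C * (D * w i x) := by gcongr; exact hb i x
        _ = _ := by ring
    have h1 := (ih hf.fderiv).clm_comp (hdg n)
    have h2 := ((hf.fderiv.comp hg' hdg') n).clm_comp (hd.fderiv n)
    have h3 := (h1.mono (w' := w) one_pos (by simp)).add (h2.mono (w' := w) one_pos (by simp))
    have hfd := fun i => (hf.contDiff i).differentiable (by simp)
    have hgd := fun i => (hg i).differentiable (by simp)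
    have hgd' := fun i => (hg' i).differentiable (by simp)
    convert h3 using 3 with i x
    rw [show _root_.fderiv ℝ (fun x => f i (g i x) - f i (g' i x)) x = _ from
        fderiv_fun_sub ((hfd i).comp (hgd i) x) ((hfd i).comp (hgd' i) x),
      fderiv_fun_sub (hgd i x) (hgd' i x)]
    have e1 : _root_.fderiv ℝ (fun x => f i (g i x)) x
        = (_root_.fderiv ℝ (f i) (g i x)).comp (_root_.fderiv ℝ (g i) x) :=
      fderiv_comp x (hfd i (g i x)) (hgd i x)
    have e2 : _root_.fderiv ℝ (fun x => f i (g' i x)) x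
        = (_root_.fderiv ℝ (f i) (g' i x)).comp (_root_.fderiv ℝ (g' i) x) :=
      fderiv_comp x (hfd i (g' i x)) (hgd' i x)
    rw [e1, e2]
    simp only [ContinuousLinearMap.sub_comp, ContinuousLinearMap.comp_sub]
    abel

/-- Second-order vanishing of `f` at `0` gives size `ε² |U|²`. Its derivative `f'(ε U) · ε DU` is a
product of sizes `ε w` and `ε`; this suffices because `1 ≤ w`. -/
theorem comp_smul_quadratic {w : ι → E → ℝ} (hw : ∀ i x, 1 ≤ w i x) {f : ι → F → G}
    (hf : SymbolClass (fun _ _ => 1) f) (hf0 : ∀ i, f i 0 = 0) (hf1 : ∀ i, _root_.fderiv ℝ (f i) 0 = 0)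
    {U : ι → E → F} (hU : ∀ i, ContDiff ℝ ∞ (U i)) (hUw : SymbolClass w U)
    (hdU : SymbolClass (fun _ _ => 1) (fun i => _root_.fderiv ℝ (U i)))
    {ε : ι → ℝ} (hε : ∀ i, 0 ≤ ε i) (hε1 : ∀ i, ε i ≤ 1) :
    SymbolClass (fun i x => ε i ^ 2 * w i x ^ 2) (fun i x => f i (ε i • U i x)) := by
  obtain ⟨C, hC, hL⟩ := hf.fderiv.fderiv.exists_lipschitz hf.fderiv.contDiff
  obtain ⟨D, hD, hb⟩ := hUw.exists_bound
  have hg : ∀ i, ContDiff ℝ ∞ (fun x => ε i • U i x) := fun i => (hU i).const_smul (ε i)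
  have hdg_eq : (fun i => _root_.fderiv ℝ (fun x => ε i • U i x))
      = fun i x => ε i • _root_.fderiv ℝ (U i) x := by
    ext i x : 2
    exact fderiv_fun_const_smul ((hU i).differentiable (by simp) x) (ε i)
  have hdg' : SymbolClass (fun i _ => ε i) (fun i => _root_.fderiv ℝ (fun x => ε i • U i x)) := by
    rw [hdg_eq]
    exact (hdU.const_smul ε).congr_weight fun i x => by rw [abs_of_nonneg (hε i), mul_one]
  have hdg : SymbolClass (fun _ _ => 1) (fun i => _root_.fderiv ℝ (fun x => ε i • U i x)) :=
    hdg'.of_weight_le fun i _ => hε1 i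
  have hfd := fun i => (hf.contDiff i).differentiable (by simp)
  have hfd' := fun i => (hf.fderiv.contDiff i).differentiable (by simp)
  have hgd := fun i => (hg i).differentiable (by simp)
  have hUe : ∀ i x, ‖ε i • U i x‖ ≤ D * (ε i * w i x) := fun i x => by
    rw [norm_smul, Real.norm_of_nonneg (hε i)]
    calc _ ≤ ε i * (D * w i x) := mul_le_mul_of_nonneg_left (hb i x) (hε i)
      _ = _ := by ring
  have key : SymbolClass (fun i x => ε i * w i x)
      (fun i x => _root_.fderiv ℝ (f i) (ε i • U i x)) := by
    refine of_fderiv (fun i => (hf.fderiv.contDiff i).comp (hg i))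
      ⟨C * D, by positivity, fun i x => ?_⟩ ?_
    · have := hL i (ε i • U i x) 0
      rw [hf1, sub_zero, sub_zero] at this
      calc _ ≤ _ := this
        _ ≤ C * (D * (ε i * w i x)) := by gcongr; exact hUe i x
        _ = _ := by ring
    · have := (hf.fderiv.fderiv.comp hg hdg).clm_comp hdg'
      refine (this.of_weight_le (w' := fun i x => ε i * w i x) fun i x => ?_).congr_fun fun i x => ?_
      · rw [one_mul]; exact le_mul_of_one_le_right (hε i) (hw i x)
      · exact fderiv_comp x (hfd' i _) (hgd i x)
  refine of_fderiv (fun i => (hf.contDiff i).comp (hg i)) ⟨C * D ^ 2, by positivity, fun i x => ?_⟩ ?_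
  · set v := ε i • U i x
    have h1 := Convex.norm_image_sub_le_of_norm_fderiv_le (𝕜 := ℝ) (s := Metric.closedBall 0 ‖v‖)
      (f := f i) (C := C * ‖v‖) (x := 0) (y := v) (fun y _ => hfd i y)
      (fun y hy => by
        have := hL i y 0
        rw [hf1, sub_zero, sub_zero] at this
        have hy' : ‖y‖ ≤ ‖v‖ := by simpa using hy
        exact this.trans (by gcongr))
      (convex_closedBall _ _) (by simp) (by simp)
    rw [hf0, sub_zero, sub_zero] at h1
    have h2 : ‖v‖ ≤ D * (ε i * w i x) := hUe i x
    calc ‖f i v‖ ≤ C * ‖v‖ * ‖v‖ := h1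
      _ ≤ C * (D * (ε i * w i x)) * (D * (ε i * w i x)) :=
          mul_le_mul (mul_le_mul_of_nonneg_left h2 hC.le) h2 (norm_nonneg _)
            (mul_nonneg hC.le ((norm_nonneg _).trans h2))
      _ = _ := by ring
  · have := key.clm_comp hdg'
    refine (this.of_weight_le (w' := fun i x => ε i ^ 2 * w i x ^ 2) fun i x => ?_).congr_fun
      fun i x => ?_
    · have := hw i x
      calc ε i * w i x * ε i = ε i ^ 2 * (w i x * 1) := by ring
        _ ≤ ε i ^ 2 * (w i x * w i x) := by gcongr
        _ = _ := by ring
    · exact fderiv_comp x (hfd i _) (hgd i x)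

theorem of_lipschitz_weight {w : ι → E → ℝ} (hw : ∀ i x, 1 ≤ w i x) {p : ι → E → F}
    (hp : ∀ i, ContDiff ℝ ∞ (p i)) (h0 : ∃ C : ℝ, 0 < C ∧ ∀ i x, ‖p i x‖ ≤ C * w i x)
    (h1 : SymbolClass (fun _ _ => 1) (fun i => _root_.fderiv ℝ (p i))) : SymbolClass w p :=
  of_fderiv hp h0 (h1.of_weight_le hw)

end SymbolClass

end SymbolClassCalculus

/-- The derivative is `-2 (1 + |v|²)⁻² ⟨v, ·⟩`: one of the two factors absorbs the growth of `v` and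
the other is the weight, so induction on the order closes. -/
theorem symbolClass_inv_one_add_norm_sq {ι E : Type*} [NormedAddCommGroup E] [InnerProductSpace ℝ E] :
    SymbolClass (fun (_ : ι) (v : E) => (1 + ‖v‖ ^ 2)⁻¹) (fun _ v => (1 + ‖v‖ ^ 2)⁻¹) := by
  have hpos : ∀ v : E, 0 < 1 + ‖v‖ ^ 2 := fun v => by positivity
  have hs : ContDiff ℝ ∞ (fun v : E => (1 + ‖v‖ ^ 2)⁻¹) :=
    (contDiff_const.add (contDiff_norm_sq ℝ)).inv fun v => (hpos v).ne'
  have h0 : SymbolBound 0 (fun (_ : ι) (v : E) => (1 + ‖v‖ ^ 2)⁻¹) (fun _ v => (1 + ‖v‖ ^ 2)⁻¹) :=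
    SymbolBound.zero_iff.2 ⟨fun _ => hs, 1, one_pos, fun _ v => by
      rw [Real.norm_of_nonneg (inv_nonneg.2 (hpos v).le), one_mul]⟩
  have hlin : SymbolClass (fun (_ : ι) (v : E) => 1 + ‖v‖) (fun _ v => innerSL ℝ v) := by
    refine SymbolClass.of_lipschitz_weight (fun _ v => by simp)
      (fun _ => (innerSL ℝ (E := E)).contDiff) ⟨1, one_pos, fun _ v => ?_⟩
      (SymbolClass.fderiv_clm (innerSL ℝ (E := E)))
    simp
  intro n
  induction n with
  | zero => exact h0
  | succ n ih =>
    refine SymbolBound.succ_iff.2 ⟨h0, ?_⟩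
    have h1 := (ih.bilin (ContinuousLinearMap.mul ℝ ℝ) ih).bilin
      (ContinuousLinearMap.lsmul ℝ ℝ) ((hlin n).clm ((-2 : ℝ) • ContinuousLinearMap.id ℝ _))
    have hle : ∀ v : E, (1 + ‖v‖ ^ 2)⁻¹ * (1 + ‖v‖ ^ 2)⁻¹ * (1 + ‖v‖) ≤ 2 * (1 + ‖v‖ ^ 2)⁻¹ := by
      intro v
      have : (1 + ‖v‖) ≤ 2 * (1 + ‖v‖ ^ 2) := by nlinarith [sq_nonneg (‖v‖ - 1)]
      calc (1 + ‖v‖ ^ 2)⁻¹ * (1 + ‖v‖ ^ 2)⁻¹ * (1 + ‖v‖)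
          ≤ (1 + ‖v‖ ^ 2)⁻¹ * (1 + ‖v‖ ^ 2)⁻¹ * (2 * (1 + ‖v‖ ^ 2)) := by
            have := hpos v; gcongr
        _ = _ := by have := (hpos v).ne'; field_simp
    have h2 := h1.mono (w' := fun (_ : ι) (v : E) => (1 + ‖v‖ ^ 2)⁻¹) two_pos fun _ v => hle v
    convert h2 using 3 with i v
    have hd : HasFDerivAt (fun v : E => 1 + ‖v‖ ^ 2) (2 • innerSL ℝ v) v :=
      (hasStrictFDerivAt_norm_sq v).hasFDerivAt.const_add 1
    have := (hasDerivAt_inv (hpos v).ne').comp_hasFDerivAt v hd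
    rw [show (fun v : E => (1 + ‖v‖ ^ 2)⁻¹) = (fun y => y⁻¹) ∘ (fun v : E => 1 + ‖v‖ ^ 2) from rfl,
      this.fderiv]
    change _ = ((1 + ‖v‖ ^ 2)⁻¹ * (1 + ‖v‖ ^ 2)⁻¹) • ((-2 : ℝ) • innerSL ℝ v)
    rw [two_nsmul, ← two_smul ℝ, smul_smul, smul_smul]
    congr 1
    have := (hpos v).ne'
    field_simp

/-! ### Plane waves, oscillatory kernels and integration by parts in frequency. -/

section OscillatoryKernels

open Complex FourierTransform
open scoped ComplexConjugate

variable {E : Type*} [NormedAddCommGroup E] [InnerProductSpace ℝ E]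

/-- The plane wave `e^{2π i ⟨η, v⟩}`. -/
noncomputable def wave (η v : E) : ℂ := Complex.exp ((2 * Real.pi * inner ℝ η v : ℝ) * I)

@[simp] theorem norm_wave (η v : E) : ‖wave η v‖ = 1 := Complex.norm_exp_ofReal_mul_I _

theorem wave_add_right (η v w : E) : wave η (v + w) = wave η v * wave η w := by
  rw [wave, wave, wave, ← Complex.exp_add, inner_add_right]
  push_cast
  ring_nf

theorem wave_add_left (η ζ v : E) : wave (η + ζ) v = wave η v * wave ζ v := by
  rw [wave, wave, wave, ← Complex.exp_add, inner_add_left]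
  push_cast
  ring_nf

theorem wave_neg_right (η v : E) : wave η (-v) = wave (-η) v := by
  rw [wave, wave, inner_neg_right, inner_neg_left]

theorem conj_wave (η v : E) : conj (wave η v) = wave η (-v) := by
  rw [wave, wave, ← Complex.exp_conj, inner_neg_right, map_mul, Complex.conj_ofReal,
    Complex.conj_I]
  push_cast
  ring_nf

theorem contDiff_wave : ContDiff ℝ ∞ (fun z : E × E => wave z.1 z.2) := by
  unfold wave
  have h : ContDiff ℝ ∞ (fun z : E × E => 2 * Real.pi * inner ℝ z.1 z.2) :=
    contDiff_const.mul (contDiff_fst.inner ℝ contDiff_snd)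
  exact ((Complex.ofRealCLM.contDiff.comp h).mul contDiff_const).cexp

theorem Continuous.wave {X : Type*} [TopologicalSpace X] {f g : X → E} (hf : Continuous f)
    (hg : Continuous g) : Continuous (fun x => wave (f x) (g x)) :=
  (contDiff_wave (E := E)).continuous.comp (hf.prodMk hg)

theorem hasFDerivAt_wave (η v e : E) :
    DifferentiableAt ℝ (fun η => wave η v) η ∧
      fderiv ℝ (fun η => wave η v) η e = (2 * Real.pi * inner ℝ e v : ℝ) * I * wave η v := by
  have h1 : HasFDerivAt (fun η : E => 2 * Real.pi * inner ℝ η v)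
      ((2 * Real.pi) • innerSL ℝ v) η := by
    have : (fun η : E => 2 * Real.pi * inner ℝ η v) = fun η => ((2 * Real.pi) • innerSL ℝ v) η := by
      ext η; simp [real_inner_comm]
    rw [this]
    exact ((2 * Real.pi) • innerSL ℝ v).hasFDerivAt
  have h2 : HasFDerivAt (fun η : E => ((2 * Real.pi * inner ℝ η v : ℝ) : ℂ) * I)
      (I • (Complex.ofRealCLM.comp ((2 * Real.pi) • innerSL ℝ v))) η :=
    (Complex.ofRealCLM.hasFDerivAt.comp η h1).mul_const I
  have h3 : HasFDerivAt (fun η : E => wave η v) _ η := h2.cexp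
  refine ⟨h3.differentiableAt, ?_⟩
  rw [h3.fderiv]
  simp [wave, real_inner_comm]
  ring

theorem fourier_eq_integral_wave [FiniteDimensional ℝ E] [MeasurableSpace E] [BorelSpace E]
    (f : E → ℂ) (ξ : E) : 𝓕 f ξ = ∫ v, wave (-ξ) v * f v := by
  rw [Real.fourier_eq']
  refine integral_congr_ae (.of_forall fun v => ?_)
  simp only [wave, smul_eq_mul, inner_neg_left, real_inner_comm]
  congr 3
  push_cast
  ring

theorem fourierInv_eq_integral_wave [FiniteDimensional ℝ E] [MeasurableSpace E] [BorelSpace E]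
    (f : E → ℂ) (v : E) : 𝓕⁻ f v = ∫ ξ, wave ξ v * f ξ := by
  rw [Real.fourierInv_eq']
  rfl

variable [FiniteDimensional ℝ E] [MeasurableSpace E] [BorelSpace E]

theorem integral_wave_mul_fderiv {q : E → ℂ} (hq : ContDiff ℝ ∞ q) (hc : HasCompactSupport q)
    (v e : E) :
    ∫ η, wave η v * fderiv ℝ q η e
      = -((2 * Real.pi * inner ℝ e v : ℝ) * I) * ∫ η, wave η v * q η := by
  have hw : Continuous (fun η => wave η v) := continuous_id.wave continuous_const
  have hdc : Continuous (fun η => fderiv ℝ q η e) :=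
    (hq.continuous_fderiv (by simp)).clm_apply continuous_const
  have hdcs : HasCompactSupport (fun η => fderiv ℝ q η e) := hc.fderiv_apply ℝ e
  have hfd : (fun η => fderiv ℝ (fun η => wave η v) η e)
      = fun η => (2 * Real.pi * inner ℝ e v : ℝ) * I * wave η v :=
    funext fun η => (hasFDerivAt_wave η v e).2
  rw [integral_mul_fderiv_eq_neg_fderiv_mul_of_integrable (f := fun η => wave η v) (v := e)]
  · rw [← integral_const_mul, ← integral_neg]
    refine integral_congr_ae (.of_forall fun η => ?_)
    simp only [(hasFDerivAt_wave η v e).2]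
    ring
  · simp only [(hasFDerivAt_wave _ v e).2]
    exact ((continuous_const.mul hw).mul hq.continuous).integrable_of_hasCompactSupport
      hc.mul_left
  · exact (hw.mul hdc).integrable_of_hasCompactSupport hdcs.mul_left
  · exact (hw.mul hq.continuous).integrable_of_hasCompactSupport hc.mul_left
  · exact fun x _ => (hasFDerivAt_wave x v e).1
  · exact fun x _ => hq.differentiable (by simp) x

/-- The integral kernel `∫ e^{2π i ⟨η, x - y⟩} p(x, y, η) dη` with amplitude `p`. -/
noncomputable def oscKernel (p : E × E × E → ℂ) (x y : E) : ℂ := ∫ η, wave η (x - y) * p (x, y, η)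

/-- The amplitude `p` vanishes for large frequencies. -/
def FreqCompact (p : E × E × E → ℂ) : Prop := ∃ R : ℝ, ∀ z, R < ‖z.2.2‖ → p z = 0

theorem FreqCompact.hasCompactSupport {p : E × E × E → ℂ} (hp : FreqCompact p) (x y : E) :
    HasCompactSupport (fun η => p (x, y, η)) := by
  obtain ⟨R, hR⟩ := hp
  refine HasCompactSupport.intro (isCompact_closedBall (0 : E) R) fun η hη => hR _ ?_
  simpa using hη

theorem FreqCompact.fderiv_apply {p : E × E × E → ℂ} (hp : FreqCompact p) (e : E × E × E) :
    FreqCompact (fun z => fderiv ℝ p z e) := by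
  obtain ⟨R, hR⟩ := hp
  refine ⟨R, fun z hz => ?_⟩
  have : p =ᶠ[nhds z] fun _ => 0 := by
    have ho : IsOpen {z : E × E × E | R < ‖z.2.2‖} :=
      isOpen_lt continuous_const (continuous_snd.comp continuous_snd).norm
    filter_upwards [ho.mem_nhds hz] with w hw using hR w hw
  simp only [this.fderiv_eq]
  simp

/-- The derivative of an amplitude in the frequency direction `e`. -/
noncomputable def freqDeriv (e : E) (p : E × E × E → ℂ) (z : E × E × E) : ℂ :=
  fderiv ℝ p z (0, 0, e)

/-- Division of `(1 - (2π)⁻² Δ_η) p` by `1 + |x - y|²`, which does not change the kernel. -/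
noncomputable def gainDecay (p : E × E × E → ℂ) (z : E × E × E) : ℂ :=
  (1 + ‖z.1 - z.2.1‖ ^ 2)⁻¹ • (p z - ((2 * Real.pi) ^ 2)⁻¹ •
    ∑ j, freqDeriv (stdOrthonormalBasis ℝ E j) (freqDeriv (stdOrthonormalBasis ℝ E j) p) z)

theorem contDiff_freqDeriv {p : E × E × E → ℂ} (hp : ContDiff ℝ ∞ p) (e : E) :
    ContDiff ℝ ∞ (freqDeriv e p) :=
  (hp.fderiv_right (m := ∞) (by simp)).clm_apply contDiff_const

theorem fderiv_section {p : E × E × E → ℂ} (hp : ContDiff ℝ ∞ p) (x y η e : E) :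
    fderiv ℝ (fun η => p (x, y, η)) η e = freqDeriv e p (x, y, η) := by
  have h1 : HasFDerivAt (fun η : E => ((x, y, η) : E × E × E))
      (ContinuousLinearMap.prod 0 (ContinuousLinearMap.prod 0 (ContinuousLinearMap.id ℝ E))) η :=
    (hasFDerivAt_const x η).prodMk ((hasFDerivAt_const y η).prodMk (hasFDerivAt_id η))
  have h2 := ((hp.differentiable (by simp) (x, y, η)).hasFDerivAt.comp η h1).fderiv
  rw [show (fun η => p (x, y, η)) = p ∘ (fun η : E => ((x, y, η) : E × E × E)) from rfl, h2]
  simp [freqDeriv]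

theorem contDiff_section {p : E × E × E → ℂ} (hp : ContDiff ℝ ∞ p) (x y : E) :
    ContDiff ℝ ∞ (fun η => p (x, y, η)) :=
  hp.comp (contDiff_const.prodMk (contDiff_const.prodMk contDiff_id))

theorem oscKernel_freqDeriv {p : E × E × E → ℂ} (hp : ContDiff ℝ ∞ p) (hc : FreqCompact p)
    (e x y : E) : oscKernel (freqDeriv e p) x y
      = -((2 * Real.pi * inner ℝ e (x - y) : ℝ) * I) * oscKernel p x y := by
  have := integral_wave_mul_fderiv (contDiff_section hp x y) (hc.hasCompactSupport x y) (x - y) e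
  simp only [fderiv_section hp] at this
  exact this

theorem integrable_wave_mul {p : E × E × E → ℂ} (hp : Continuous p) (hc : FreqCompact p) (x y v : E) :
    Integrable (fun η => wave η v * p (x, y, η)) :=
  ((continuous_id.wave continuous_const).mul (by fun_prop)).integrable_of_hasCompactSupport
    (hc.hasCompactSupport x y).mul_left

/-- A frequency derivative `∂_e` of the amplitude multiplies the kernel by `-2πi ⟨e, x - y⟩`. Hence
`1 - (2π)⁻² Δ_η` multiplies it by `1 + |x - y|²`, which the prefactor cancels. -/
theorem oscKernel_gainDecay {p : E × E × E → ℂ} (hp : ContDiff ℝ ∞ p) (hc : FreqCompact p)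
    (x y : E) : oscKernel (gainDecay p) x y = oscKernel p x y := by
  have hI := fun q (hq : ContDiff ℝ ∞ q) (hqc : FreqCompact q) =>
    integrable_wave_mul hq.continuous hqc x y (x - y)
  set b := stdOrthonormalBasis ℝ E
  have hs : ∀ j, ContDiff ℝ ∞ (freqDeriv (b j) (freqDeriv (b j) p)) := fun j =>
    contDiff_freqDeriv (contDiff_freqDeriv hp _) _
  have hcs : ∀ j, FreqCompact (freqDeriv (b j) (freqDeriv (b j) p)) := fun j =>
    (hc.fderiv_apply _).fderiv_apply _
  have h1 : oscKernel (gainDecay p) x y = (1 + ‖x - y‖ ^ 2)⁻¹ • (oscKernel p x y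
      - ((2 * Real.pi) ^ 2)⁻¹ • ∑ j, oscKernel (freqDeriv (b j) (freqDeriv (b j) p)) x y) := by
    have hint : Integrable (fun η => ((2 * Real.pi) ^ 2)⁻¹ •
        ∑ j, wave η (x - y) * freqDeriv (b j) (freqDeriv (b j) p) (x, y, η)) := by
      have := (integrable_finsetSum Finset.univ fun j _ => hI _ (hs j) (hcs j)).smul
        (((2 * Real.pi) ^ 2)⁻¹ : ℝ)
      exact this
    unfold oscKernel
    rw [← integral_finsetSum _ (fun j _ => hI _ (hs j) (hcs j)), ← integral_smul,
      ← integral_sub (hI _ hp hc) hint,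
      ← integral_smul]
    refine integral_congr_ae (.of_forall fun η => ?_)
    simp only [gainDecay, Complex.real_smul, ← Finset.mul_sum, b]
    ring
  have h2 : ∀ j, oscKernel (freqDeriv (b j) (freqDeriv (b j) p)) x y
      = -(((2 * Real.pi) ^ 2 * inner ℝ (b j) (x - y) ^ 2 : ℝ) : ℂ) * oscKernel p x y := fun j => by
    rw [oscKernel_freqDeriv (contDiff_freqDeriv hp _) (hc.fderiv_apply _),
      oscKernel_freqDeriv hp hc]
    push_cast
    linear_combination (4 * (Real.pi : ℂ) ^ 2 * (inner ℝ (b j) (x - y) : ℝ) ^ 2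
      * oscKernel p x y) * I_sq
  rw [h1]
  simp only [h2]
  rw [← Finset.sum_mul, Finset.sum_neg_distrib, ← Complex.ofReal_sum, ← Finset.mul_sum]
  have h3 : ∑ j, inner ℝ (b j) (x - y) ^ 2 = ‖x - y‖ ^ 2 := by
    have := b.sum_sq_norm_inner_right (x - y)
    simpa using this
  rw [h3]
  simp only [Complex.real_smul]
  have h4 : ((1 + ‖x - y‖ ^ 2 : ℝ) : ℂ) ≠ 0 := by
    exact_mod_cast (by positivity : (1 + ‖x - y‖ ^ 2 : ℝ) ≠ 0)
  have h5 : (Real.pi : ℂ) ≠ 0 := by exact_mod_cast Real.pi_ne_zero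
  push_cast at h4 ⊢
  field_simp
  ring

theorem FreqCompact.gainDecay {p : E × E × E → ℂ} (hp : FreqCompact p) :
    FreqCompact (gainDecay p) := by
  have h2 : ∀ e : E, ∀ q : E × E × E → ℂ, ∀ R, (∀ z, R < ‖z.2.2‖ → q z = 0) →
      ∀ z, R < ‖z.2.2‖ → freqDeriv e q z = 0 := by
    intro e q R hR z hz
    have : q =ᶠ[nhds z] fun _ => 0 := by
      have ho : IsOpen {z : E × E × E | R < ‖z.2.2‖} :=
        isOpen_lt continuous_const (continuous_snd.comp continuous_snd).norm
      filter_upwards [ho.mem_nhds hz] with w hw using hR w hw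
    simp [freqDeriv, this.fderiv_eq]
  obtain ⟨R, hR⟩ := hp
  refine ⟨R, fun z hz => ?_⟩
  rw [_root_.gainDecay, hR z hz, Finset.sum_eq_zero fun j _ => h2 _ _ R (h2 _ _ R hR) z hz]
  simp

end OscillatoryKernels

/-! ### Off-diagonal decay of amplitudes at the level of symbol classes. -/

section GainDecayClass

variable {ι : Type*} {E : Type*}

theorem SymbolClass.zero {F G : Type*} [NormedAddCommGroup F] [NormedSpace ℝ F]
    [NormedAddCommGroup G] [NormedSpace ℝ G] {w : ι → F → ℝ} (hw : ∀ i x, 0 ≤ w i x) :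
    SymbolClass w (fun _ _ => (0 : G)) := fun _ =>
  ⟨fun _ => contDiff_const, fun k _ => ⟨1, one_pos, fun i x => by simpa using hw i x⟩⟩

theorem SymbolClass.sum {J F G : Type*} [NormedAddCommGroup F] [NormedSpace ℝ F]
    [NormedAddCommGroup G] [NormedSpace ℝ G] {w : ι → F → ℝ} (hw : ∀ i x, 0 ≤ w i x)
    {p : J → ι → F → G} (hp : ∀ j, SymbolClass w (p j)) (s : Finset J) :
    SymbolClass w (fun i x => ∑ j ∈ s, p j i x) := by
  classical
  induction s using Finset.induction_on with
  | empty => simpa using SymbolClass.zero hw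
  | insert a s ha ih => simpa [Finset.sum_insert ha] using (hp a).add ih

theorem SymbolClass.comp_affine {E F G : Type*} [NormedAddCommGroup E] [NormedSpace ℝ E]
    [NormedAddCommGroup F] [NormedSpace ℝ F] [NormedAddCommGroup G] [NormedSpace ℝ G]
    {f : ι → F → G} {w : ι → F → ℝ} (hf : SymbolClass w f) (L : E →L[ℝ] F) (c : ι → F) :
    SymbolClass (fun i x => w i (L x + c i)) (fun i x => f i (L x + c i)) := by
  refine hf.comp (fun i => L.contDiff.add contDiff_const) ?_
  have : (fun i => _root_.fderiv ℝ (fun x => L x + c i)) = fun _ _ => L := by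
    ext i x : 2
    rw [fderiv_add_const]
    exact L.fderiv
  rw [this]
  exact SymbolClass.const _ (fun _ => le_rfl)

variable [NormedAddCommGroup E] [InnerProductSpace ℝ E]

theorem symbolClass_inv_offDiagonal :
    SymbolClass (fun (_ : ι) (z : E × E × E) => (1 + ‖z.1 - z.2.1‖ ^ 2)⁻¹)
      (fun _ z => (1 + ‖z.1 - z.2.1‖ ^ 2)⁻¹) :=
  (symbolClass_inv_one_add_norm_sq (ι := ι) (E := E)).comp_clm
    (ContinuousLinearMap.fst ℝ E (E × E) -
      (ContinuousLinearMap.fst ℝ E E).comp (ContinuousLinearMap.snd ℝ E (E × E)))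

theorem SymbolClass.freqDeriv {w : ι → E × E × E → ℝ} {p : ι → E × E × E → ℂ}
    (hp : SymbolClass w p) (e : E) : SymbolClass w (fun i => freqDeriv e (p i)) :=
  hp.fderiv.clm (ContinuousLinearMap.apply ℝ ℂ ((0, 0, e) : E × E × E))

variable [FiniteDimensional ℝ E] [MeasurableSpace E] [BorelSpace E]

theorem SymbolClass.gainDecay {w : ι → E × E × E → ℝ} {p : ι → E × E × E → ℂ}
    (hp : SymbolClass w p) :
    SymbolClass (fun i z => (1 + ‖z.1 - z.2.1‖ ^ 2)⁻¹ * w i z) (fun i => gainDecay (p i)) := by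
  refine symbolClass_inv_offDiagonal.smul (hp.sub ?_)
  exact (SymbolClass.sum hp.weight_nonneg (J := Fin (Module.finrank ℝ E))
    (fun _ => (hp.freqDeriv _).freqDeriv _) Finset.univ).clm
    (((2 * Real.pi) ^ 2)⁻¹ • ContinuousLinearMap.id ℝ ℂ)

/-- Only the kernel enters the form, so an amplitude may be traded for one with arbitrary
off-diagonal decay. -/
theorem SymbolClass.exists_gainDecay {w : ι → E × E × E → ℝ} {p : ι → E × E × E → ℂ}
    (hp : SymbolClass w p) (hc : ∀ i, FreqCompact (p i)) (N : ℕ) :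
    ∃ q : ι → E × E × E → ℂ,
      SymbolClass (fun i z => (1 + ‖z.1 - z.2.1‖ ^ 2)⁻¹ ^ N * w i z) q ∧
      (∀ i, FreqCompact (q i)) ∧ ∀ i, oscKernel (q i) = oscKernel (p i) := by
  induction N with
  | zero => exact ⟨p, by simpa using hp, hc, fun _ => rfl⟩
  | succ N ih =>
    obtain ⟨q, hq, hqc, hk⟩ := ih
    refine ⟨fun i => _root_.gainDecay (q i), hq.gainDecay.congr_weight fun i z => by ring,
      fun i => (hqc i).gainDecay, fun i => ?_⟩
    rw [← hk i]
    ext x y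
    exact oscKernel_gainDecay (hq.contDiff i) (hqc i) x y

end GainDecayClass

/-! ### Fourier decay with constants linear in the integral of the weight. -/

section FourierDecay

open FourierTransform

variable {ι V : Type*} [NormedAddCommGroup V] [InnerProductSpace ℝ V] [FiniteDimensional ℝ V]
  [MeasurableSpace V] [BorelSpace V]

theorem integrable_inv_one_add_norm_pow {n : ℕ} (hn : Module.finrank ℝ V < n) :
    Integrable (fun v : V => ((1 + ‖v‖) ^ n)⁻¹) := by
  have := integrable_one_add_norm (E := V) (μ := volume) (r := n) (by exact_mod_cast hn)
  refine this.congr (.of_forall fun v => ?_)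
  simp only
  rw [Real.rpow_neg (by positivity), Real.rpow_natCast]

/-- Integration by parts. All dependence on `i` is through `∫ w i`, which keeps the later estimates
uniform in window positions and frequencies. -/
theorem SymbolClass.norm_fourier_le {w : ι → V → ℝ} {u : ι → V → ℂ} (hu : SymbolClass w u)
    (hw : ∀ i, Integrable (w i)) (n : ℕ) :
    ∃ C : ℝ, 0 < C ∧ ∀ i ξ, ‖𝓕 (u i) ξ‖ ≤ C * (∫ v, w i v) * ((1 + ‖ξ‖) ^ n)⁻¹ := by
  obtain ⟨C, hC, hb⟩ := (hu n).exists_bound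
  have hA : ∀ i, 0 ≤ ∫ v, w i v := fun i => integral_nonneg (hu.weight_nonneg i)
  have hint : ∀ i m, Integrable (fun v => ‖iteratedFDeriv ℝ m (u i) v‖) := by
    intro i m
    obtain ⟨D, hD, hd⟩ := (hu m).2 m le_rfl
    refine ((hw i).const_mul D).mono' ?_ (.of_forall fun v => by simpa using hd i v)
    exact (((hu.contDiff i).continuous_iteratedFDeriv
      (m := m) (by exact_mod_cast le_top)).norm).aestronglyMeasurable
  have key : ∀ m ≤ n, ∀ i ξ, ‖ξ‖ ^ m * ‖𝓕 (u i) ξ‖ ≤ 2 ^ m * ((m + 1) * (C * ∫ v, w i v)) := by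
    intro m hm i ξ
    have h := Real.pow_mul_norm_iteratedFDeriv_fourier_le (K := 0) (N := ⊤) (k := 0) (n := m)
      (hu.contDiff i) (fun k l hk _ => by
        obtain rfl : k = 0 := by simpa using hk
        simpa using hint i l) (by simp) (by simp) ξ
    simp only [norm_iteratedFDeriv_zero, pow_zero, one_mul, Nat.cast_zero, mul_zero, zero_add] at h
    refine h.trans ?_
    gcongr
    calc _ ≤ ∑ p ∈ Finset.range 1 ×ˢ Finset.range (m + 1), C * ∫ v, w i v := by
          refine Finset.sum_le_sum fun p hp => ?_
          simp only [Finset.mem_product, Finset.mem_range] at hp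
          obtain ⟨h1, h2⟩ := hp
          have h1 : p.1 = 0 := by omega
          rw [h1, ← integral_const_mul]
          simp only [pow_zero, one_mul]
          exact integral_mono (hint i p.2) ((hw i).const_mul C) fun v => hb p.2 (by omega) i v
      _ = _ := by simp
  -- The bounds for `m = 0` and `m = n` are combined through `(1 + r)^n ≤ 2^n (1 + r^n)`.
  refine ⟨2 ^ n * (C + 2 ^ n * ((n + 1) * C)), by positivity, fun i ξ => ?_⟩
  rw [← div_eq_mul_inv, le_div_iff₀ (by positivity)]
  have h0 := key 0 (Nat.zero_le n) i ξ
  have h1 := key n le_rfl i ξ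
  simp only [pow_zero, one_mul, Nat.cast_zero, zero_add] at h0
  have h2 : (1 + ‖ξ‖) ^ n ≤ 2 ^ n * (1 + ‖ξ‖ ^ n) := by
    refine (add_pow_le zero_le_one (norm_nonneg ξ) n).trans ?_
    rw [one_pow]
    gcongr
    · norm_num
    · omega
  calc ‖𝓕 (u i) ξ‖ * (1 + ‖ξ‖) ^ n ≤ ‖𝓕 (u i) ξ‖ * (2 ^ n * (1 + ‖ξ‖ ^ n)) := by gcongr
    _ = 2 ^ n * (‖𝓕 (u i) ξ‖ + ‖ξ‖ ^ n * ‖𝓕 (u i) ξ‖) := by ring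
    _ ≤ 2 ^ n * (C * (∫ v, w i v) + 2 ^ n * ((n + 1) * (C * ∫ v, w i v))) := by gcongr
    _ = _ := by ring

end FourierDecay

/-! ### The form of an amplitude that is compactly supported in position and frequency. -/

section LocalForm

open FourierTransform
open scoped ComplexConjugate

variable {E : Type*} [NormedAddCommGroup E] [InnerProductSpace ℝ E] [FiniteDimensional ℝ E]
  [MeasurableSpace E] [BorelSpace E]

/-- The sesquilinear form of the oscillatory integral operator with amplitude `p`. -/
noncomputable def oscForm (p : E × E × E → ℂ) (f g : E → ℂ) : ℂ :=
  ∫ x, ∫ y, conj (g x) * f y * oscKernel p x y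

theorem integrable_norm_sq_schwartz (f : 𝓢(E, ℂ)) : Integrable (fun x => ‖f x‖ ^ 2) := by
  have := (f.memLp 2 volume).integrable_norm_pow (by norm_num)
  simpa using this

theorem conj_fourier_eq (g : E → ℂ) (ξ : E) : conj (𝓕 g ξ) = ∫ x, conj (g x) * wave ξ x := by
  rw [fourier_eq_integral_wave, ← integral_conj]
  refine integral_congr_ae (.of_forall fun x => ?_)
  simp only [map_mul, conj_wave, wave_neg_right, neg_neg]
  ring

/-- Insert Fourier inversion of `q` in the joint variable `(x, y)`: for each `τ` the double integral
factors into shifted Fourier transforms of `g` and `f`. `WithLp 2` supplies the inner product that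
this joint transform needs. -/
theorem integral_prod_wave_eq (f g : 𝓢(E, ℂ)) (q : WithLp 2 (E × E) → ℂ) (hq : Continuous q)
    (hqi : Integrable q) (hQ : Integrable (𝓕 q)) (hqb : ∃ C, ∀ v, ‖q v‖ ≤ C) (η : E) :
    ∫ x, ∫ y, conj (g x) * f y * (wave η (x - y) * q (WithLp.toLp 2 (x, y)))
      = ∫ τ : WithLp 2 (E × E), 𝓕 q τ * (conj (𝓕 (g : E → ℂ) (η + τ.fst)) *
          𝓕 (f : E → ℂ) (η - τ.snd)) := by
  have hg : Integrable (fun x => conj (g x)) := by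
    simpa using (Complex.conjCLE.integrable_comp_iff (φ := (g : E → ℂ))).2 g.integrable
  have hgf : Integrable (fun z : E × E => conj (g z.1) * f z.2) := hg.mul_prod f.integrable
  have hcont : Continuous (fun z : E × E => q (WithLp.toLp 2 z)) :=
    hq.comp (WithLp.prod_continuous_toLp 2 E E)
  have hinv : ∀ v, q v = ∫ τ, wave τ v * 𝓕 q τ := fun v => by
    rw [← fourierInv_eq_integral_wave, hq.fourierInv_fourier_eq hqi hQ]
  have hwv : Continuous (fun z : E × E => wave η (z.1 - z.2)) :=
    continuous_const.wave (continuous_fst.sub continuous_snd)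
  have hI1 : Integrable (fun z : E × E => conj (g z.1) * f z.2 *
      (wave η (z.1 - z.2) * q (WithLp.toLp 2 z))) := by
    obtain ⟨C, hC⟩ := hqb
    refine hgf.mul_bdd (c := C) (hwv.mul hcont).aestronglyMeasurable (.of_forall fun z => ?_)
    simpa using hC _
  have hI2 : Integrable (Function.uncurry fun (z : E × E) (τ : WithLp 2 (E × E)) =>
      conj (g z.1) * f z.2 * (wave η (z.1 - z.2) * (wave τ (WithLp.toLp 2 z) * 𝓕 q τ)))
      ((volume : Measure (E × E)).prod volume) := by
    have h := hgf.mul_prod hQ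
    have hc : Continuous (fun p : (E × E) × WithLp 2 (E × E) =>
        wave η (p.1.1 - p.1.2) * wave p.2 (WithLp.toLp 2 p.1)) :=
      (hwv.comp continuous_fst).mul (continuous_snd.wave
        ((WithLp.prod_continuous_toLp 2 E E).comp continuous_fst))
    refine (h.mul_bdd (c := 1) hc.aestronglyMeasurable
      (.of_forall fun p => by simp)).congr (.of_forall fun p => ?_)
    simp only [Function.uncurry]
    ring
  calc _ = ∫ z : E × E, conj (g z.1) * f z.2 * (wave η (z.1 - z.2) * q (WithLp.toLp 2 z)) :=
        (integral_prod _ hI1).symm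
    _ = ∫ z : E × E, ∫ τ : WithLp 2 (E × E), conj (g z.1) * f z.2 *
          (wave η (z.1 - z.2) * (wave τ (WithLp.toLp 2 z) * 𝓕 q τ)) := by
        refine integral_congr_ae (.of_forall fun z => ?_)
        simp only
        rw [hinv (WithLp.toLp 2 z), ← integral_const_mul, ← integral_const_mul]
    _ = ∫ τ : WithLp 2 (E × E), ∫ z : E × E, conj (g z.1) * f z.2 *
          (wave η (z.1 - z.2) * (wave τ (WithLp.toLp 2 z) * 𝓕 q τ)) :=
        integral_integral_swap hI2
    _ = _ := by
        refine integral_congr_ae (.of_forall fun τ => ?_)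
        simp only
        have : ∀ z : E × E, conj (g z.1) * f z.2 *
            (wave η (z.1 - z.2) * (wave τ (WithLp.toLp 2 z) * 𝓕 q τ))
            = 𝓕 q τ * ((conj (g z.1) * wave (η + τ.fst) z.1) *
              (wave (-(η - τ.snd)) z.2 * f z.2)) := by
          intro z
          have h1 : wave τ (WithLp.toLp 2 z) = wave τ.fst z.1 * wave τ.snd z.2 := by
            rw [wave, wave, wave, ← Complex.exp_add, WithLp.prod_inner_apply]
            simp only [WithLp.ofLp_fst, WithLp.ofLp_snd]
            push_cast
            ring_nf
          rw [h1, sub_eq_add_neg z.1, wave_add_right, wave_neg_right, wave_add_left, neg_sub,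
            sub_eq_add_neg τ.snd, wave_add_left]
          ring
        simp only [this]
        rw [integral_const_mul, conj_fourier_eq, fourier_eq_integral_wave (f : E → ℂ)]
        congr 1
        exact integral_prod_mul (μ := volume) (ν := volume) (fun x => conj (g x) * wave (η + τ.fst) x)
          (fun y => wave (-(η - τ.snd)) y * f y)

/-- After Fourier inversion the product of transforms is at most `|ĝ(η + τ₁)|² + |f̂(η - τ₂)|²`.
Integrating in `η` first removes the shifts, Plancherel restores the `L²` norms, and `∫ ρ` remains.
The support radius only justifies Fubini; it does not enter the bound. -/
theorem norm_oscForm_local_le {q : E × E × E → ℂ} (hq : Continuous q)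
    (hqc : ∃ R, ∀ x y η, q (x, y, η) ≠ 0 → ‖x‖ ≤ R ∧ ‖y‖ ≤ R ∧ ‖η‖ ≤ R)
    {B : ℝ} {ρ : WithLp 2 (E × E) → ℝ} (hρ : Integrable ρ) (hρc : Continuous ρ) (hB : 0 ≤ B)
    (hρ0 : ∀ τ, 0 ≤ ρ τ)
    (hQ : ∀ η τ, ‖𝓕 (fun v : WithLp 2 (E × E) => q (v.fst, v.snd, η)) τ‖ ≤ B * ρ τ)
    (f g : 𝓢(E, ℂ)) :
    ‖oscForm q f g‖ ≤ B * (∫ τ, ρ τ) * ((∫ x, ‖f x‖ ^ 2) + ∫ x, ‖g x‖ ^ 2) := by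
  obtain ⟨R, hR⟩ := hqc
  have hsec : ∀ η, Continuous (fun v : WithLp 2 (E × E) => q (v.fst, v.snd, η)) := fun η =>
    hq.comp ((WithLp.fstL 2 ℝ E E).continuous.prodMk
      ((WithLp.sndL 2 ℝ E E).continuous.prodMk continuous_const))
  have hsecc : ∀ η, HasCompactSupport (fun v : WithLp 2 (E × E) => q (v.fst, v.snd, η)) := by
    intro η
    refine HasCompactSupport.intro
      (((isCompact_closedBall (0 : E) R).prod (isCompact_closedBall (0 : E) R)).image
        (WithLp.prod_continuous_toLp 2 E E)) fun v hv => ?_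
    by_contra hne
    obtain ⟨h1, h2, -⟩ := hR _ _ _ hne
    exact hv ⟨(v.fst, v.snd), ⟨by simpa using h1, by simpa using h2⟩, rfl⟩
  have hsecb : ∀ η, ∃ C, ∀ v : WithLp 2 (E × E), ‖q (v.fst, v.snd, η)‖ ≤ C := fun η =>
    (hsec η).bounded_above_of_compact_support (hsecc η)
  have hFc : Continuous (fun z : E × E × E => conj (g z.1) * f z.2.1 *
      (wave z.2.2 (z.1 - z.2.1) * q z)) := by
    refine ((Complex.continuous_conj.comp (g.continuous.comp continuous_fst)).mul
      (f.continuous.comp (continuous_fst.comp continuous_snd))).mul (Continuous.mul ?_ hq)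
    exact (continuous_snd.comp continuous_snd).wave
      (continuous_fst.sub (continuous_fst.comp continuous_snd))
  have hI : Integrable (fun z : (E × E) × E => conj (g z.1.1) * f z.2 *
      (wave z.1.2 (z.1.1 - z.2) * q (z.1.1, z.2, z.1.2))) := by
    refine Continuous.integrable_of_hasCompactSupport (hFc.comp
      ((continuous_fst.comp continuous_fst).prodMk
        (continuous_snd.prodMk (continuous_snd.comp continuous_fst)))) ?_
    refine HasCompactSupport.intro (((isCompact_closedBall (0 : E) R).prod
      (isCompact_closedBall (0 : E) R)).prod (isCompact_closedBall (0 : E) R)) fun z hz => ?_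
    have : q (z.1.1, z.2, z.1.2) = 0 := by
      by_contra hne
      obtain ⟨h1, h2, h3⟩ := hR _ _ _ hne
      exact hz ⟨⟨by simpa using h1, by simpa using h3⟩, by simpa using h2⟩
    simp [this]
  have hIx : ∀ x, Integrable (Function.uncurry fun y η => conj (g x) * f y *
      (wave η (x - y) * q (x, y, η))) (volume.prod volume) := by
    intro x
    refine Continuous.integrable_of_hasCompactSupport (μ := (volume : Measure (E × E)))
      (hFc.comp (continuous_const.prodMk (continuous_fst.prodMk continuous_snd))) ?_
    refine HasCompactSupport.intro ((isCompact_closedBall (0 : E) R).prod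
      (isCompact_closedBall (0 : E) R)) fun z hz => ?_
    have : q (x, z.1, z.2) = 0 := by
      by_contra hne
      obtain ⟨h1, h2, h3⟩ := hR _ _ _ hne
      exact hz ⟨by simpa using h2, by simpa using h3⟩
    simp only [Function.uncurry, this, mul_zero]
  have heq : oscForm q f g = ∫ η, ∫ x, ∫ y, conj (g x) * f y * (wave η (x - y) * q (x, y, η)) := by
    calc oscForm q f g = ∫ x, ∫ y, ∫ η, conj (g x) * f y * (wave η (x - y) * q (x, y, η)) := by
          simp only [oscForm, oscKernel, integral_const_mul]
      _ = ∫ x, ∫ η, ∫ y, conj (g x) * f y * (wave η (x - y) * q (x, y, η)) :=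
          integral_congr_ae (.of_forall fun x => integral_integral_swap (hIx x))
      _ = _ := integral_integral_swap (f := fun x η => ∫ y, conj (g x) * f y *
          (wave η (x - y) * q (x, y, η))) hI.integral_prod_left
  have hQi : ∀ η, Integrable (𝓕 (fun v : WithLp 2 (E × E) => q (v.fst, v.snd, η))) := by
    intro η
    refine (hρ.const_mul B).mono' ?_ (.of_forall (hQ η))
    exact (VectorFourier.fourierIntegral_continuous Real.continuous_fourierChar
      (L := innerₗ (WithLp 2 (E × E))) (by exact continuous_inner)
      ((hsec η).integrable_of_hasCompactSupport (hsecc η))).aestronglyMeasurable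
  set a : E → ℝ := fun ξ => ‖𝓕 (g : E → ℂ) ξ‖ ^ 2 with ha
  set b : E → ℝ := fun ξ => ‖𝓕 (f : E → ℂ) ξ‖ ^ 2 with hb
  have hac : Continuous a := ((𝓕 g).continuous.norm.pow 2)
  have hbc : Continuous b := ((𝓕 f).continuous.norm.pow 2)
  have hai : Integrable a := integrable_norm_sq_schwartz (𝓕 g)
  have hbi : Integrable b := integrable_norm_sq_schwartz (𝓕 f)
  have hafi : ∫ ξ, a ξ = ∫ x, ‖g x‖ ^ 2 := SchwartzMap.integral_norm_sq_fourier g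
  have hbfi : ∫ ξ, b ξ = ∫ x, ‖f x‖ ^ 2 := SchwartzMap.integral_norm_sq_fourier f
  have hKη : ∀ τ : WithLp 2 (E × E),
      Integrable (fun η => B * ρ τ * (a (η + τ.fst) + b (η - τ.snd))) := fun τ =>
    ((hai.comp_add_right _).add (hbi.comp_sub_right _)).const_mul _
  have hKηi : ∀ τ : WithLp 2 (E × E),
      ∫ η, B * ρ τ * (a (η + τ.fst) + b (η - τ.snd))
        = B * ρ τ * ((∫ x, ‖g x‖ ^ 2) + ∫ x, ‖f x‖ ^ 2) := fun τ => by
    rw [integral_const_mul, integral_add (hai.comp_add_right _) (hbi.comp_sub_right _),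
      integral_add_right_eq_self, integral_sub_right_eq_self, hafi, hbfi]
  have hK : Integrable (Function.uncurry fun η (τ : WithLp 2 (E × E)) =>
      B * ρ τ * (a (η + τ.fst) + b (η - τ.snd))) (volume.prod volume) := by
    have hc : Continuous (Function.uncurry fun η (τ : WithLp 2 (E × E)) =>
        B * ρ τ * (a (η + τ.fst) + b (η - τ.snd))) := by
      refine (continuous_const.mul (hρc.comp continuous_snd)).mul (Continuous.add ?_ ?_)
      · exact hac.comp (continuous_fst.add ((WithLp.fstL 2 ℝ E E).continuous.comp continuous_snd))
      · exact hbc.comp (continuous_fst.sub ((WithLp.sndL 2 ℝ E E).continuous.comp continuous_snd))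
    rw [integrable_prod_iff' hc.aestronglyMeasurable]
    refine ⟨.of_forall hKη, ?_⟩
    refine ((hρ.const_mul B).mul_const ((∫ x, ‖g x‖ ^ 2) + ∫ x, ‖f x‖ ^ 2)).congr
      (.of_forall fun τ => ?_)
    simp only [Function.uncurry]
    rw [← hKηi τ]
    refine integral_congr_ae (.of_forall fun η => ?_)
    simp only
    rw [Real.norm_of_nonneg]
    have := hρ0 τ
    positivity
  have hZ : ∀ η, ‖∫ x, ∫ y, conj (g x) * f y * (wave η (x - y) * q (x, y, η))‖
      ≤ ∫ τ : WithLp 2 (E × E), B * ρ τ * (a (η + τ.fst) + b (η - τ.snd)) := by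
    intro η
    have := integral_prod_wave_eq f g (fun v => q (v.fst, v.snd, η)) (hsec η)
      ((hsec η).integrable_of_hasCompactSupport (hsecc η)) (hQi η) (hsecb η) η
    have h' : ∫ x, ∫ y, conj (g x) * f y * (wave η (x - y) * q (x, y, η)) = _ := this
    rw [h']
    refine norm_integral_le_of_norm_le ?_ (.of_forall fun τ => ?_)
    · have hbd : ∀ h : 𝓢(E, ℂ), ∃ C, ∀ x, ‖h x‖ ^ 2 ≤ C := fun h => by
        obtain ⟨C, hC⟩ := h.decay 0 0
        exact ⟨C ^ 2, fun x => pow_le_pow_left₀ (norm_nonneg _) (by simpa using hC.2 x) 2⟩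
      obtain ⟨Ca, hCa⟩ := hbd (𝓕 g)
      obtain ⟨Cb, hCb⟩ := hbd (𝓕 f)
      refine (hρ.const_mul B).mul_bdd (c := Ca + Cb) ?_ (.of_forall fun τ => ?_)
      · exact ((hac.comp (continuous_const.add (WithLp.fstL 2 ℝ E E).continuous)).add
          (hbc.comp (continuous_const.sub (WithLp.sndL 2 ℝ E E).continuous))).aestronglyMeasurable
      · rw [Real.norm_of_nonneg (by positivity)]
        exact add_le_add (hCa _) (hCb _)
    · rw [norm_mul, norm_mul, RCLike.norm_conj]
      have h1 := hQ η τ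
      have h2 := two_mul_le_add_sq ‖𝓕 (g : E → ℂ) (η + τ.fst)‖ ‖𝓕 (f : E → ℂ) (η - τ.snd)‖
      have h3 : ‖𝓕 (g : E → ℂ) (η + τ.fst)‖ * ‖𝓕 (f : E → ℂ) (η - τ.snd)‖
          ≤ a (η + τ.fst) + b (η - τ.snd) := by
        have : 0 ≤ ‖𝓕 (g : E → ℂ) (η + τ.fst)‖ * ‖𝓕 (f : E → ℂ) (η - τ.snd)‖ := by positivity
        simp only [ha, hb]
        linarith
      exact mul_le_mul h1 h3 (by positivity) (mul_nonneg hB (hρ0 τ))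
  rw [heq]
  calc _ ≤ ∫ η, ∫ τ : WithLp 2 (E × E), B * ρ τ * (a (η + τ.fst) + b (η - τ.snd)) :=
        norm_integral_le_of_norm_le hK.integral_prod_left (.of_forall hZ)
    _ = ∫ τ : WithLp 2 (E × E), ∫ η, B * ρ τ * (a (η + τ.fst) + b (η - τ.snd)) :=
        integral_integral_swap hK
    _ = _ := by
        simp only [hKηi]
        rw [integral_mul_const, integral_const_mul, add_comm]

end LocalForm

/-! ### Compactly supported windows. -/

section Windows

/-- The indicator is kept as weight because it is integrable on compact sets, as the Fourier decay
estimate requires. -/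
theorem symbolClass_of_compactSupport {ι E F : Type*} [NormedAddCommGroup E] [NormedSpace ℝ E]
    [NormedAddCommGroup F] [NormedSpace ℝ F] {u : E → F} (hu : ContDiff ℝ ∞ u)
    {S : Set E} (hS : IsCompact S) (h0 : ∀ x, x ∉ S → u x = 0) :
    SymbolClass (fun (_ : ι) => S.indicator fun _ => (1 : ℝ)) (fun _ => u) := by
  have hc : HasCompactSupport u := HasCompactSupport.intro hS h0
  have hsub : tsupport u ⊆ S := closure_minimal
    (fun x hx => by by_contra h; exact hx (h0 x h)) hS.isClosed
  intro n
  refine ⟨fun _ => hu, fun k _ => ?_⟩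
  obtain ⟨C, hC⟩ := (hu.continuous_iteratedFDeriv (m := k)
    (by exact_mod_cast le_top)).bounded_above_of_compact_support (hc.iteratedFDeriv k)
  refine ⟨|C| + 1, by positivity, fun _ x => ?_⟩
  change ‖iteratedFDeriv ℝ k u x‖ ≤ (|C| + 1) * S.indicator (fun _ => (1 : ℝ)) x
  by_cases hx : x ∈ S
  · rw [Set.indicator_of_mem hx, mul_one]
    exact (hC x).trans ((le_abs_self C).trans (by linarith))
  · rw [Set.indicator_of_notMem hx, mul_zero]
    have : iteratedFDeriv ℝ k u x = 0 := by
      by_contra h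
      exact hx (hsub (support_iteratedFDeriv_subset k h))
    simp [this]

variable {E : Type*} [NormedAddCommGroup E] [InnerProductSpace ℝ E] [FiniteDimensional ℝ E]
  [MeasurableSpace E] [BorelSpace E]

/-- One bump has three uses: position window (`∫ G² > 0`), frequency cutoff (value `1` at the
origin) and coherent window (evenness). -/
theorem exists_smooth_window (E : Type*) [NormedAddCommGroup E] [InnerProductSpace ℝ E]
    [FiniteDimensional ℝ E] [MeasurableSpace E] [BorelSpace E] :
    ∃ G : E → ℝ, ContDiff ℝ ∞ G ∧ (∀ x, x ∉ Metric.closedBall (0 : E) 2 → G x = 0) ∧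
      (∀ x, G (-x) = G x) ∧ (∀ x, 0 ≤ G x) ∧ (∀ x, G x ≤ 1) ∧
      (∀ x, ‖x‖ ≤ 1 → G x = 1) ∧ 0 < ∫ x, G x ^ 2 := by
  let b : ContDiffBump (0 : E) := ⟨1, 2, one_pos, one_lt_two⟩
  have h0 : ∀ x, x ∉ Metric.closedBall (0 : E) 2 → b x = 0 := fun x hx => by
    refine b.zero_of_le_dist ?_
    have : 2 < ‖x‖ := by simpa using hx
    simpa [b] using this.le
  have hcs : HasCompactSupport (fun x => b x ^ 2) :=
    HasCompactSupport.intro (isCompact_closedBall (0 : E) 2) fun x hx => by simp [h0 x hx]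
  refine ⟨b, b.contDiff, h0, fun x => b.neg x, fun x => b.nonneg,
    fun x => b.le_one, fun x hx => b.one_of_mem_closedBall (by simpa using hx), ?_⟩
  refine (integral_pos_iff_support_of_nonneg (fun x => sq_nonneg (b x))
    ((b.continuous.pow 2).integrable_of_hasCompactSupport hcs)).2 ?_
  refine lt_of_lt_of_le (Metric.measure_ball_pos volume (0 : E) one_pos) (measure_mono fun x hx => ?_)
  have : b x = 1 := b.one_of_mem_closedBall (Metric.ball_subset_closedBall hx)
  simp [this]

end Windows

/-! ### Young-type integrals for the Schur test. -/

section Convolution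

variable {E : Type*} [NormedAddCommGroup E] [InnerProductSpace ℝ E] [FiniteDimensional ℝ E]
  [MeasurableSpace E] [BorelSpace E]

theorem integrable_sub_mul_fst {u h : E → ℝ} (hu : Continuous u) (hui : Integrable u)
    (hh : Integrable h) : Integrable (fun z : E × E => u (z.1 - z.2) * h z.1) := by
  have hm : AEStronglyMeasurable (fun z : E × E => u (z.1 - z.2) * h z.1)
      ((volume : Measure E).prod volume) :=
    (hu.comp (continuous_fst.sub continuous_snd)).aestronglyMeasurable.mul
      hh.aestronglyMeasurable.comp_fst
  refine (integrable_prod_iff hm).2 ⟨.of_forall fun x => (hui.comp_sub_left x).mul_const (h x), ?_⟩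
  refine (hh.norm.const_mul (∫ x, ‖u x‖)).congr (.of_forall fun x => ?_)
  simp only [norm_mul]
  rw [integral_mul_const, integral_sub_left_eq_self (fun x => ‖u x‖)]

theorem integrable_sub_mul_snd {u h : E → ℝ} (hu : Continuous u) (hui : Integrable u)
    (hh : Integrable h) : Integrable (fun z : E × E => u (z.1 - z.2) * h z.2) := by
  have hm : AEStronglyMeasurable (fun z : E × E => u (z.1 - z.2) * h z.2)
      ((volume : Measure E).prod volume) :=
    (hu.comp (continuous_fst.sub continuous_snd)).aestronglyMeasurable.mul
      hh.aestronglyMeasurable.comp_snd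
  refine (integrable_prod_iff' hm).2 ⟨.of_forall fun x => (hui.comp_sub_right x).mul_const (h x), ?_⟩
  refine (hh.norm.const_mul (∫ x, ‖u x‖)).congr (.of_forall fun x => ?_)
  simp only [norm_mul]
  rw [integral_mul_const, integral_sub_right_eq_self (fun x => ‖u x‖)]

theorem integral_sub_mul_fst {u h : E → ℝ} (hu : Continuous u) (hui : Integrable u)
    (hh : Integrable h) : ∫ z : E × E, u (z.1 - z.2) * h z.1 = (∫ x, u x) * ∫ x, h x := by
  refine (integral_prod _ (integrable_sub_mul_fst hu hui hh)).trans ?_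
  simp only [integral_mul_const]
  rw [← integral_const_mul]
  refine integral_congr_ae (.of_forall fun x => ?_)
  simp only
  rw [integral_sub_left_eq_self]

theorem integral_sub_mul_snd {u h : E → ℝ} (hu : Continuous u) (hui : Integrable u)
    (hh : Integrable h) : ∫ z : E × E, u (z.1 - z.2) * h z.2 = (∫ x, u x) * ∫ x, h x := by
  refine (integral_prod_symm _ (integrable_sub_mul_snd hu hui hh)).trans ?_
  simp only [integral_mul_const]
  rw [← integral_const_mul]
  refine integral_congr_ae (.of_forall fun x => ?_)
  simp only
  rw [integral_sub_right_eq_self]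

end Convolution

/-! ### Localization of the form to pairs of windows. -/

section CalderonVaillancourt

open FourierTransform
open scoped ComplexConjugate

variable {ι : Type*} {E : Type*} [NormedAddCommGroup E] [InnerProductSpace ℝ E]
  [FiniteDimensional ℝ E] [MeasurableSpace E] [BorelSpace E]

theorem stronglyMeasurable_oscKernel {p : E × E × E → ℂ} (hp : Continuous p) :
    StronglyMeasurable (fun z : E × E => oscKernel p z.1 z.2) := by
  refine StronglyMeasurable.integral_prod_right (f := fun (z : E × E) (η : E) =>
    wave η (z.1 - z.2) * p (z.1, z.2, η)) (Continuous.stronglyMeasurable ?_)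
  refine Continuous.mul ?_ (by fun_prop)
  exact continuous_snd.wave ((continuous_fst.comp continuous_fst).sub
    (continuous_snd.comp continuous_fst))

theorem exists_norm_oscKernel_le {p : E × E × E → ℂ} (hc : FreqCompact p)
    (hb : ∃ C, ∀ z, ‖p z‖ ≤ C) : ∃ C, ∀ x y, ‖oscKernel p x y‖ ≤ C := by
  obtain ⟨R, hR⟩ := hc
  obtain ⟨C, hC⟩ := hb
  refine ⟨∫ η : E, (Metric.closedBall (0 : E) R).indicator (fun _ => C) η, fun x y => ?_⟩
  refine norm_integral_le_of_norm_le ?_ (.of_forall fun η => ?_)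
  · exact (integrable_indicator_iff measurableSet_closedBall).2
      (integrableOn_const (by exact measure_closedBall_lt_top.ne))
  · rw [norm_mul, norm_wave, one_mul]
    by_cases h : η ∈ Metric.closedBall (0 : E) R
    · rw [Set.indicator_of_mem h]; exact hC _
    · rw [Set.indicator_of_notMem h, hR _ (by simpa using h), norm_zero]

/-- Windowed amplitude. -/
noncomputable def windowed (G : E → ℝ) (k j : E) (p : E × E × E → ℂ) (z : E × E × E) : ℂ :=
  (G (z.1 - k) * G (z.2.1 - j)) • p z

theorem inv_one_add_sq_le_of_close {x y k j : E} (hx : ‖x - k‖ ≤ 2) (hy : ‖y - j‖ ≤ 2) :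
    (1 + ‖x - y‖ ^ 2)⁻¹ ≤ 33 * (1 + ‖k - j‖ ^ 2)⁻¹ := by
  have h1 : ‖k - j‖ ≤ ‖x - y‖ + 4 := by
    have : k - j = (x - y) - (x - k) + (y - j) := by abel
    calc ‖k - j‖ = ‖(x - y) - (x - k) + (y - j)‖ := by rw [← this]
      _ ≤ ‖x - y‖ + ‖x - k‖ + ‖y - j‖ := (norm_add_le _ _).trans (by gcongr; exact norm_sub_le _ _)
      _ ≤ _ := by linarith
  -- With `t = ‖x - y‖`, `1 + (t + 4)² ≤ 1 + 2t² + 32 ≤ 33 (1 + t²)`.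
  have h2 : 1 + ‖k - j‖ ^ 2 ≤ 33 * (1 + ‖x - y‖ ^ 2) := by
    have := pow_le_pow_left₀ (norm_nonneg _) h1 2
    nlinarith [sq_nonneg (‖x - y‖ - 4), sq_nonneg ‖x - y‖]
  rw [inv_le_iff_one_le_mul₀ (by positivity), mul_assoc, mul_comm, mul_assoc,
    ← div_eq_inv_mul, le_div_iff₀ (by positivity)]
  linarith

/-- The window centres and the frozen frequency join the index set, so one constant serves them all.
Radius `4` covers the product of two balls of radius `2`, and on the windows the decay in `x - y`
becomes decay in `k - j`. -/
theorem symbolClass_windowed {N : ℕ} {p : ι → E × E × E → ℂ}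
    (hp : SymbolClass (fun _ z => (1 + ‖z.1 - z.2.1‖ ^ 2)⁻¹ ^ N) p) {G : E → ℝ}
    (hG : ContDiff ℝ ∞ G) (hG0 : ∀ x, x ∉ Metric.closedBall (0 : E) 2 → G x = 0) :
    SymbolClass (fun (s : ι × E × E × E) (v : WithLp 2 (E × E)) =>
        (1 + ‖s.2.1 - s.2.2.1‖ ^ 2)⁻¹ ^ N *
          (Metric.closedBall (WithLp.toLp 2 (s.2.1, s.2.2.1)) 4).indicator (fun _ => (1 : ℝ)) v)
      (fun s v => windowed G s.2.1 s.2.2.1 (p s.1) (v.fst, v.snd, s.2.2.2)) := by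
  let L1 : WithLp 2 (E × E) →L[ℝ] E := WithLp.fstL 2 ℝ E E
  let L2 : WithLp 2 (E × E) →L[ℝ] E := WithLp.sndL 2 ℝ E E
  have h1 := (hp.reindex (fun s : ι × E × E × E => s.1)).comp_affine
    (L1.prod (L2.prod (0 : WithLp 2 (E × E) →L[ℝ] E))) (fun s => ((0, 0, s.2.2.2) : E × E × E))
  have hGc := symbolClass_of_compactSupport (ι := ι × E × E × E) hG
    (isCompact_closedBall (0 : E) 2) hG0
  have h2 := hGc.comp_affine L1 (fun s => -s.2.1)
  have h3 := hGc.comp_affine L2 (fun s => -s.2.2.1)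
  have h4 := (h2.mul h3).smul h1
  refine (h4.mono (B := 33 ^ N) (by positivity) fun s v => ?_).congr_fun fun s v => ?_
  · simp only [ContinuousLinearMap.prod_apply, Prod.mk_add_mk, add_zero,
      ← sub_eq_add_neg]
    by_cases hx : L1 v - s.2.1 ∈ Metric.closedBall (0 : E) 2
    · by_cases hy : L2 v - s.2.2.1 ∈ Metric.closedBall (0 : E) 2
      · rw [Set.indicator_of_mem hx, Set.indicator_of_mem hy]
        have hx' : ‖v.fst - s.2.1‖ ≤ 2 := mem_closedBall_zero_iff.1 hx
        have hy' : ‖v.snd - s.2.2.1‖ ≤ 2 := mem_closedBall_zero_iff.1 hy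
        have hv : v ∈ Metric.closedBall (WithLp.toLp 2 (s.2.1, s.2.2.1)) 4 := by
          rw [mem_closedBall_iff_norm]
          refine le_of_sq_le_sq ?_ (by norm_num)
          rw [WithLp.prod_norm_sq_eq_of_L2]
          have e1 : (v - WithLp.toLp 2 (s.2.1, s.2.2.1)).fst = v.fst - s.2.1 := rfl
          have e2 : (v - WithLp.toLp 2 (s.2.1, s.2.2.1)).snd = v.snd - s.2.2.1 := rfl
          rw [e1, e2]
          nlinarith [norm_nonneg (v.fst - s.2.1), norm_nonneg (v.snd - s.2.2.1)]
        rw [Set.indicator_of_mem hv, one_mul, one_mul, mul_one, ← mul_pow]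
        exact pow_le_pow_left₀ (by positivity) (inv_one_add_sq_le_of_close hx' hy') N
      · rw [Set.indicator_of_notMem hy, mul_zero, zero_mul]
        exact mul_nonneg (by positivity) (mul_nonneg (by positivity)
          (Set.indicator_nonneg (fun _ _ => zero_le_one) _))
    · rw [Set.indicator_of_notMem hx, zero_mul, zero_mul]
      exact mul_nonneg (by positivity) (mul_nonneg (by positivity)
        (Set.indicator_nonneg (fun _ _ => zero_le_one) _))
  · simp [windowed, L1, L2, sub_eq_add_neg]

/-- The product of a Schwartz function with a translated window. -/
noncomputable def windowedSchwartz {G : E → ℝ} (hG : ContDiff ℝ ∞ G)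
    (hG0 : ∀ x, x ∉ Metric.closedBall (0 : E) 2 → G x = 0) (f : 𝓢(E, ℂ)) (k : E) : 𝓢(E, ℂ) :=
  HasCompactSupport.toSchwartzMap (f := fun x => G (x - k) • f x)
    (HasCompactSupport.intro (isCompact_closedBall k 2) fun x hx => by
      rw [hG0 (x - k) (by simpa [dist_eq_norm] using hx), zero_smul])
    ((hG.comp (contDiff_id.sub contDiff_const)).smul (f.smooth ⊤))

theorem windowedSchwartz_apply {G : E → ℝ} (hG : ContDiff ℝ ∞ G)
    (hG0 : ∀ x, x ∉ Metric.closedBall (0 : E) 2 → G x = 0) (f : 𝓢(E, ℂ)) (k x : E) :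
    windowedSchwartz hG hG0 f k x = G (x - k) • f x := rfl

theorem norm_sq_windowedSchwartz {G : E → ℝ} (hG : ContDiff ℝ ∞ G)
    (hG0 : ∀ x, x ∉ Metric.closedBall (0 : E) 2 → G x = 0) (f : 𝓢(E, ℂ)) (k x : E) :
    ‖windowedSchwartz hG hG0 f k x‖ ^ 2 = G (x - k) ^ 2 * ‖f x‖ ^ 2 := by
  rw [windowedSchwartz_apply, norm_smul, mul_pow, Real.norm_eq_abs, sq_abs]

theorem oscKernel_windowed (G : E → ℝ) (k j : E) (p : E × E × E → ℂ) (x y : E) :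
    oscKernel (windowed G k j p) x y = (G (x - k) * G (y - j) : ℝ) * oscKernel p x y := by
  simp only [oscKernel, windowed]
  rw [← integral_const_mul]
  refine integral_congr_ae (.of_forall fun η => ?_)
  simp only [Complex.real_smul]
  ring

theorem exists_norm_oscForm_windowed_le {N : ℕ} {p : ι → E × E × E → ℂ}
    (hp : SymbolClass (fun _ z => (1 + ‖z.1 - z.2.1‖ ^ 2)⁻¹ ^ N) p)
    (hc : ∀ i, FreqCompact (p i)) {G : E → ℝ}
    (hG : ContDiff ℝ ∞ G) (hG0 : ∀ x, x ∉ Metric.closedBall (0 : E) 2 → G x = 0) :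
    ∃ C : ℝ, 0 ≤ C ∧ ∀ i k j, ∀ f g : 𝓢(E, ℂ), ‖oscForm (windowed G k j (p i)) f g‖ ≤
      C * (1 + ‖k - j‖ ^ 2)⁻¹ ^ N * ((∫ x, ‖f x‖ ^ 2) + ∫ x, ‖g x‖ ^ 2) := by
  -- The least integer power for which `(1 + |τ|)^(-n)` is integrable over the joint frequency
  -- space.
  set n := Module.finrank ℝ (WithLp 2 (E × E)) + 1 with hn
  have hw : ∀ s : ι × E × E × E, Integrable (fun v : WithLp 2 (E × E) =>
      (1 + ‖s.2.1 - s.2.2.1‖ ^ 2)⁻¹ ^ N *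
        (Metric.closedBall (WithLp.toLp 2 (s.2.1, s.2.2.1)) 4).indicator (fun _ => (1 : ℝ)) v) :=
    fun s => Integrable.const_mul ((integrable_indicator_iff measurableSet_closedBall).2
      (integrableOn_const (by exact measure_closedBall_lt_top.ne))) _
  obtain ⟨C, hC, hb⟩ := (symbolClass_windowed hp hG hG0).norm_fourier_le hw n
  set M := (volume : Measure (WithLp 2 (E × E))).real (Metric.closedBall 0 4) with hM
  have hwi : ∀ s : ι × E × E × E, ∫ v : WithLp 2 (E × E), (1 + ‖s.2.1 - s.2.2.1‖ ^ 2)⁻¹ ^ N *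
        (Metric.closedBall (WithLp.toLp 2 (s.2.1, s.2.2.1)) 4).indicator (fun _ => (1 : ℝ)) v
        = (1 + ‖s.2.1 - s.2.2.1‖ ^ 2)⁻¹ ^ N * M := fun s => by
    rw [integral_const_mul, integral_indicator_const _ measurableSet_closedBall, hM, measureReal_def,
      measureReal_def, Measure.addHaar_closedBall_center]
    simp
  have hρ := integrable_inv_one_add_norm_pow (V := WithLp 2 (E × E)) (n := n) (by omega)
  refine ⟨C * M * ∫ v : WithLp 2 (E × E), ((1 + ‖v‖) ^ n)⁻¹, ?_, fun i k j f g => ?_⟩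
  · have : 0 ≤ ∫ v : WithLp 2 (E × E), ((1 + ‖v‖) ^ n)⁻¹ :=
      integral_nonneg fun v => by positivity
    positivity
  have hqc : Continuous (windowed G k j (p i)) := by
    have := hp.continuous i
    have := hG.continuous
    unfold windowed
    fun_prop
  obtain ⟨R, hR⟩ := hc i
  have h := norm_oscForm_local_le hqc ⟨max (max (2 + ‖k‖) (2 + ‖j‖)) R, fun x y η hne => ?_⟩
    (B := C * ((1 + ‖k - j‖ ^ 2)⁻¹ ^ N * M)) hρ (by
      refine Continuous.inv₀ (by fun_prop) fun v => ?_
      positivity) (by positivity) (fun v => by positivity)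
    (fun η v => by
      have := hb (i, k, j, η) v
      rwa [hwi] at this) f g
  · refine h.trans (le_of_eq ?_)
    ring
  · have h1 : G (x - k) ≠ 0 := fun h => hne (by simp [windowed, h])
    have h2 : G (y - j) ≠ 0 := fun h => hne (by simp [windowed, h])
    have h3 : p i (x, y, η) ≠ 0 := fun h => hne (by simp [windowed, h])
    have hb' : ∀ u v : E, G (u - v) ≠ 0 → ‖u‖ ≤ 2 + ‖v‖ := fun u v huv => by
      have : u - v ∈ Metric.closedBall (0 : E) 2 := by
        by_contra h; exact huv (hG0 _ h)
      have h' : ‖u - v‖ ≤ 2 := by simpa using this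
      calc ‖u‖ = ‖(u - v) + v‖ := by simp
        _ ≤ _ := (norm_add_le _ _).trans (by gcongr)
    refine ⟨?_, ?_, ?_⟩
    · exact (hb' _ _ h1).trans ((le_max_left _ _).trans (le_max_left _ _))
    · exact (hb' _ _ h2).trans ((le_max_right _ _).trans (le_max_left _ _))
    · refine le_trans ?_ (le_max_right _ _)
      by_contra hlt
      exact h3 (hR _ (by simpa using hlt))

end CalderonVaillancourt

/-! ### Reassembling the localized forms: the Calderón–Vaillancourt bound. -/

section CalderonVaillancourtGlobal

open FourierTransform
open scoped ComplexConjugate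

variable {ι : Type*} {E : Type*} [NormedAddCommGroup E] [InnerProductSpace ℝ E]
  [FiniteDimensional ℝ E] [MeasurableSpace E] [BorelSpace E]

theorem integrable_schwartz_mul_bounded (f g : 𝓢(E, ℂ)) {K : E × E → ℂ} (hK : StronglyMeasurable K)
    {C : ℝ} (hC : ∀ z, ‖K z‖ ≤ C) :
    Integrable (fun z : E × E => conj (g z.1) * f z.2 * K z) := by
  have hg : Integrable (fun x => conj (g x)) := by
    simpa using (Complex.conjCLE.integrable_comp_iff (φ := (g : E → ℂ))).2 g.integrable
  have hgf : Integrable (fun z : E × E => conj (g z.1) * f z.2) := hg.mul_prod f.integrable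
  exact hgf.mul_bdd (c := C) hK.aestronglyMeasurable (.of_forall hC)

theorem oscForm_eq_integral_prod (f g : 𝓢(E, ℂ)) {p : E × E × E → ℂ} (hp : Continuous p)
    {C : ℝ} (hC : ∀ x y, ‖oscKernel p x y‖ ≤ C) :
    oscForm p f g = ∫ z : E × E, conj (g z.1) * f z.2 * oscKernel p z.1 z.2 :=
  (integral_prod _ (integrable_schwartz_mul_bounded f g (stronglyMeasurable_oscKernel hp)
    fun z => hC z.1 z.2)).symm

/-- A continuous partition of unity: the form is the average over window centres of localized forms,
which decay like `r(k - j)` with `r` integrable. The Schur test then sums the local `L²` masses of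
`f` and `g`. -/
theorem exists_norm_oscForm_le_of_decay {p : ι → E × E × E → ℂ}
    (hp : SymbolClass (fun _ z => (1 + ‖z.1 - z.2.1‖ ^ 2)⁻¹ ^ (Module.finrank ℝ E + 1)) p)
    (hc : ∀ i, FreqCompact (p i)) :
    ∃ C : ℝ, 0 < C ∧ ∀ i, ∀ f g : 𝓢(E, ℂ), ‖oscForm (p i) f g‖ ≤
      C * ((∫ x, ‖f x‖ ^ 2) + ∫ x, ‖g x‖ ^ 2) := by
  set N := Module.finrank ℝ E + 1 with hN
  obtain ⟨G, hG, hG0, -, -, -, -, hpos⟩ := exists_smooth_window E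
  obtain ⟨C, hC, hb⟩ := exists_norm_oscForm_windowed_le hp hc hG hG0
  set c := ∫ x, G x ^ 2 with hcdef
  have hGc : Continuous (fun x => G x ^ 2) := hG.continuous.pow 2
  have hGi : Integrable (fun x => G x ^ 2) := hGc.integrable_of_hasCompactSupport
    (HasCompactSupport.intro (isCompact_closedBall (0 : E) 2) fun x hx => by simp [hG0 x hx])
  set r : E → ℝ := fun v => (1 + ‖v‖ ^ 2)⁻¹ ^ N with hr
  have hrc : Continuous r := by
    refine Continuous.pow (Continuous.inv₀ (by fun_prop) fun v => ?_) _
    positivity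
  have hr0 : ∀ v, 0 ≤ r v := fun v => by positivity
  have hri : Integrable r := by
    refine ((integrable_inv_one_add_norm_pow (V := E) (n := N) (by omega)).const_mul (2 ^ N)).mono'
      hrc.aestronglyMeasurable (.of_forall fun v => ?_)
    rw [Real.norm_of_nonneg (hr0 v), ← inv_pow, ← mul_pow]
    refine pow_le_pow_left₀ (by positivity) ?_ N
    rw [← div_eq_mul_inv, inv_le_iff_one_le_mul₀ (by positivity), div_mul_eq_mul_div,
      le_div_iff₀ (by positivity)]
    nlinarith [sq_nonneg (‖v‖ - 1)]
  set A := ∫ v, r v with hA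
  have hA0 : 0 ≤ A := integral_nonneg hr0
  refine ⟨(C * (A * c)) / c ^ 2 + 1, by positivity, fun i f g => ?_⟩
  obtain ⟨B, hB⟩ : ∃ B, ∀ x y, ‖oscKernel (p i) x y‖ ≤ B := by
    refine exists_norm_oscKernel_le (hc i) ?_
    obtain ⟨D, hD, hd⟩ := hp.exists_bound
    refine ⟨D, fun z => (hd i z).trans (mul_le_of_le_one_right hD.le ?_)⟩
    refine pow_le_one₀ (by positivity) (inv_le_one_of_one_le₀ ?_)
    have := sq_nonneg ‖z.1 - z.2.1‖
    linarith
  have hKm := stronglyMeasurable_oscKernel (hp.continuous i)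
  set H : E × E → ℂ := fun z => conj (g z.1) * f z.2 * oscKernel (p i) z.1 z.2 with hH
  have hHi : Integrable H := integrable_schwartz_mul_bounded f g hKm fun z => hB z.1 z.2
  -- The windows are squared so that one factor localizes the amplitude and the other the test
  -- function.
  set W : E × E → E × E → ℝ := fun z s => G (z.1 - s.1) ^ 2 * G (z.2 - s.2) ^ 2 with hW
  have hWi : ∀ z, Integrable (W z) := fun z =>
    (hGi.comp_sub_left z.1).mul_prod (hGi.comp_sub_left z.2)
  have hW0 : ∀ z s, 0 ≤ W z s := fun z s => by positivity
  have hWint : ∀ z, ∫ s, W z s = c ^ 2 := fun z => by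
    refine (integral_prod_mul (μ := volume) (ν := volume) (fun s => G (z.1 - s) ^ 2)
      (fun s => G (z.2 - s) ^ 2)).trans ?_
    rw [integral_sub_left_eq_self (fun x => G x ^ 2), integral_sub_left_eq_self (fun x => G x ^ 2),
      sq]
  have hWc : Continuous (Function.uncurry W) := by
    have := hG.continuous
    simp only [hW, Function.uncurry_def]
    fun_prop
  have hint : Integrable (Function.uncurry fun z s => (W z s : ℂ) * H z) (volume.prod volume) := by
    have hm : AEStronglyMeasurable (Function.uncurry fun z s => (W z s : ℂ) * H z)
        ((volume : Measure (E × E)).prod (volume : Measure (E × E))) :=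
      (Complex.continuous_ofReal.comp hWc).aestronglyMeasurable.mul
        hHi.aestronglyMeasurable.comp_fst
    refine (integrable_prod_iff hm).2 ⟨.of_forall fun z => (hWi z).ofReal.mul_const (H z), ?_⟩
    refine (hHi.norm.const_mul (c ^ 2)).congr (.of_forall fun z => ?_)
    simp only [Function.uncurry, norm_mul, Complex.norm_real]
    rw [integral_mul_const, ← hWint z]
    congr 1
    exact integral_congr_ae (.of_forall fun s => (Real.norm_of_nonneg (hW0 z s)).symm)
  have hswap : (c ^ 2 : ℝ) * oscForm (p i) f g = ∫ s, ∫ z, (W z s : ℂ) * H z := by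
    rw [oscForm_eq_integral_prod f g (hp.continuous i) hB, ← integral_integral_swap hint,
      ← integral_const_mul]
    refine integral_congr_ae (.of_forall fun z => ?_)
    simp only
    rw [integral_mul_const, integral_complex_ofReal, hWint]
  have hloc : ∀ s : E × E, ∫ z, (W z s : ℂ) * H z = oscForm (windowed G s.1 s.2 (p i))
      (windowedSchwartz hG hG0 f s.2) (windowedSchwartz hG hG0 g s.1) := by
    intro s
    have hI : Integrable (fun z => (W z s : ℂ) * H z) := by
      obtain ⟨D, hD⟩ := hGc.bounded_above_of_compact_support
        (HasCompactSupport.intro (isCompact_closedBall (0 : E) 2) fun x hx => by simp [hG0 x hx])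
      have hWs : Continuous (fun z => (W z s : ℂ)) :=
        Complex.continuous_ofReal.comp (hWc.comp (continuous_id.prodMk continuous_const))
      refine hHi.bdd_mul (c := D * D) hWs.aestronglyMeasurable (.of_forall fun z => ?_)
      rw [Complex.norm_real, norm_mul]
      exact mul_le_mul (hD _) (hD _) (norm_nonneg _) ((norm_nonneg _).trans (hD 0))
    refine (integral_prod _ hI).trans ?_
    unfold oscForm
    refine integral_congr_ae (.of_forall fun x => integral_congr_ae (.of_forall fun y => ?_))
    simp only [hH, hW, windowedSchwartz_apply, oscKernel_windowed, Complex.real_smul, map_mul,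
      Complex.conj_ofReal]
    push_cast
    ring
  have hfi := integrable_norm_sq_schwartz f
  have hgi := integrable_norm_sq_schwartz g
  set φ : E → ℝ := fun k => ∫ x, G (x - k) ^ 2 * ‖f x‖ ^ 2 with hφ
  set ψ : E → ℝ := fun k => ∫ x, G (x - k) ^ 2 * ‖g x‖ ^ 2 with hψ
  have hφi : Integrable φ := (integrable_sub_mul_fst hGc hGi hfi).integral_prod_right
  have hψi : Integrable ψ := (integrable_sub_mul_fst hGc hGi hgi).integral_prod_right
  have hφint : ∫ k, φ k = c * ∫ x, ‖f x‖ ^ 2 := by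
    rw [← integral_sub_mul_fst hGc hGi hfi]
    exact (integral_prod_symm _ (integrable_sub_mul_fst hGc hGi hfi)).symm
  have hψint : ∫ k, ψ k = c * ∫ x, ‖g x‖ ^ 2 := by
    rw [← integral_sub_mul_fst hGc hGi hgi]
    exact (integral_prod_symm _ (integrable_sub_mul_fst hGc hGi hgi)).symm
  have h1 : ‖∫ s, ∫ z, (W z s : ℂ) * H z‖ ≤
      ∫ s : E × E, C * (r (s.1 - s.2) * φ s.2 + r (s.1 - s.2) * ψ s.1) := by
    refine norm_integral_le_of_norm_le (((integrable_sub_mul_snd hrc hri hφi).add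
      (integrable_sub_mul_fst hrc hri hψi)).const_mul C) (.of_forall fun s => ?_)
    rw [hloc s]
    refine (hb i s.1 s.2 _ _).trans (le_of_eq ?_)
    simp only [norm_sq_windowedSchwartz, hr, hφ, hψ]
    ring
  have h2 : ∫ s : E × E, C * (r (s.1 - s.2) * φ s.2 + r (s.1 - s.2) * ψ s.1)
      = C * (A * c) * ((∫ x, ‖f x‖ ^ 2) + ∫ x, ‖g x‖ ^ 2) := by
    rw [integral_const_mul, integral_add (integrable_sub_mul_snd hrc hri hφi)
      (integrable_sub_mul_fst hrc hri hψi), integral_sub_mul_snd hrc hri hφi,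
      integral_sub_mul_fst hrc hri hψi, hφint, hψint]
    ring
  rw [← hswap, h2, norm_mul, Complex.norm_real, Real.norm_of_nonneg (by positivity)] at h1
  have hS : 0 ≤ (∫ x, ‖f x‖ ^ 2) + ∫ x, ‖g x‖ ^ 2 :=
    add_nonneg (integral_nonneg fun _ => by positivity) (integral_nonneg fun _ => by positivity)
  have h3 : ‖oscForm (p i) f g‖ ≤ (C * (A * c)) / c ^ 2 * ((∫ x, ‖f x‖ ^ 2) + ∫ x, ‖g x‖ ^ 2) := by
    rw [div_mul_eq_mul_div, le_div_iff₀ (by positivity), mul_comm]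
    exact h1
  linarith

/-- **Calderón–Vaillancourt theorem** for frequency-compact amplitudes: the bound on the form only
depends on the bounds of the amplitudes. -/
theorem exists_norm_oscForm_le {p : ι → E × E × E → ℂ}
    (hp : SymbolClass (fun _ z => 1 + ‖z.1 - z.2.1‖ ^ 2) p) (hc : ∀ i, FreqCompact (p i)) :
    ∃ C : ℝ, 0 < C ∧ ∀ i, ∀ f g : 𝓢(E, ℂ), ‖oscForm (p i) f g‖ ≤
      C * ((∫ x, ‖f x‖ ^ 2) + ∫ x, ‖g x‖ ^ 2) := by
  -- One integration by parts pays for the growth `1 + |x - y|²`; the other `dim + 1` give the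
  -- integrable decay.
  obtain ⟨q, hq, hqc, hk⟩ := hp.exists_gainDecay hc (Module.finrank ℝ E + 2)
  obtain ⟨C, hC, hb⟩ := exists_norm_oscForm_le_of_decay (p := q) (hq.congr_weight fun i z => by
    have : (1 + ‖z.1 - z.2.1‖ ^ 2) ≠ 0 := by positivity
    rw [pow_succ, mul_assoc, inv_mul_cancel₀ this, mul_one]) hqc
  refine ⟨C, hC, fun i f g => ?_⟩
  have := hb i f g
  simpa only [oscForm, hk] using this

end CalderonVaillancourtGlobal

/-! ### Weyl quantization as a limit of frequency-cut oscillatory forms. -/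

section WeylAmplitudes

open FourierTransform Filter Topology
open scoped ComplexConjugate

variable {ι : Type*} {E : Type*} [NormedAddCommGroup E] [InnerProductSpace ℝ E]

/-- The amplitude `a((x + y)/2, 2πη)` of the Weyl quantization. -/
noncomputable def weylAmplitude (a : E × E → ℝ) (z : E × E × E) : ℂ :=
  a ((1 / 2 : ℝ) • (z.1 + z.2.1), (2 * Real.pi) • z.2.2)

/-- Multiplication of an amplitude by the frequency cutoff `χ(η / (n + 1))`. -/
noncomputable def freqCut (χ : E → ℝ) (n : ℕ) (p : E × E × E → ℂ) (z : E × E × E) : ℂ :=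
  χ (((n : ℝ) + 1)⁻¹ • z.2.2) • p z

/-- The linear map `(x, y, η) ↦ ((x + y)/2, 2πη)`. -/
noncomputable def weylPoint (E : Type*) [NormedAddCommGroup E] [InnerProductSpace ℝ E] :
    E × E × E →L[ℝ] E × E :=
  ((1 / 2 : ℝ) • (ContinuousLinearMap.fst ℝ E (E × E) +
    (ContinuousLinearMap.fst ℝ E E).comp (ContinuousLinearMap.snd ℝ E (E × E)))).prod
    ((2 * Real.pi) • (ContinuousLinearMap.snd ℝ E E).comp (ContinuousLinearMap.snd ℝ E (E × E)))

theorem symbolClass_weylAmplitude {a : ι → E × E → ℝ} (ha : SymbolClass (fun _ _ => 1) a) :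
    SymbolClass (fun _ _ => 1) (fun i => weylAmplitude (a i)) :=
  (ha.comp_clm (weylPoint E)).clm Complex.ofRealCLM

/-- The rescaling factor `1 / (n + 1)` is at most `1`, so the cutoffs have derivatives bounded
uniformly in `n`, and `n` may join the index set. -/
theorem symbolClass_freqCut {w : ι → E × E × E → ℝ} {p : ι → E × E × E → ℂ}
    (hp : SymbolClass w p) {χ : E → ℝ} (hχ : SymbolClass (fun (_ : Unit) _ => 1) (fun _ => χ)) :
    SymbolClass (fun (s : ι × ℕ) => w s.1) (fun s => freqCut χ s.2 (p s.1)) := by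
  let L : E × E × E →L[ℝ] E :=
    (ContinuousLinearMap.snd ℝ E E).comp (ContinuousLinearMap.snd ℝ E (E × E))
  have h1 : SymbolClass (fun (_ : ι × ℕ) _ => 1)
      (fun s (z : E × E × E) => χ (((s.2 : ℝ) + 1)⁻¹ • L z)) := by
    refine (hχ.reindex (fun _ : ι × ℕ => ())).comp
      (fun s => contDiff_const.smul L.contDiff) ?_
    have : (fun s : ι × ℕ => fderiv ℝ (fun z => ((s.2 : ℝ) + 1)⁻¹ • L z))
        = fun s _ => ((s.2 : ℝ) + 1)⁻¹ • L := by
      ext s z : 2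
      rw [fderiv_fun_const_smul L.differentiableAt, L.fderiv]
    rw [this]
    refine SymbolClass.const _ (B := ‖L‖) fun s => ?_
    rw [norm_smul]
    refine mul_le_of_le_one_left (norm_nonneg _) ?_
    rw [Real.norm_of_nonneg (by positivity)]
    exact inv_le_one_of_one_le₀ (by linarith [s.2.cast_nonneg (α := ℝ)])
  exact (h1.smul (hp.reindex (fun s : ι × ℕ => s.1))).congr_weight fun s z => one_mul _

theorem freqCompact_freqCut {χ : E → ℝ} (hχ : ∀ x, x ∉ Metric.closedBall (0 : E) 2 → χ x = 0)
    (n : ℕ) (p : E × E × E → ℂ) : FreqCompact (freqCut χ n p) := by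
  refine ⟨2 * (n + 1), fun z hz => ?_⟩
  rw [freqCut, hχ, zero_smul]
  rw [mem_closedBall_zero_iff, norm_smul, Real.norm_of_nonneg (by positivity), not_le,
    ← div_eq_inv_mul, lt_div_iff₀ (by positivity)]
  exact hz

variable [FiniteDimensional ℝ E] [MeasurableSpace E] [BorelSpace E]

theorem tendsto_cutoff {χ : E → ℝ} (hχc : Continuous χ) (hχ1 : χ 0 = 1) (η : E) :
    Tendsto (fun n : ℕ => χ (((n : ℝ) + 1)⁻¹ • η)) atTop (𝓝 1) := by
  have h1 : Tendsto (fun n : ℕ => ((n : ℝ) + 1)⁻¹ • η) atTop (𝓝 ((0 : ℝ) • η)) :=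
    (tendsto_inv_atTop_zero.comp (tendsto_atTop_add_const_right _ 1
      tendsto_natCast_atTop_atTop)).smul_const η
  rw [zero_smul] at h1
  have := (hχc.tendsto 0).comp h1
  rwa [hχ1] at this

theorem symbolClass_schwartz (f : 𝓢(E, ℂ)) (n : ℕ) :
    SymbolClass (fun (_ : ι) (x : E) => ((1 + ‖x‖) ^ n)⁻¹) (fun _ => (f : E → ℂ)) := by
  intro m
  refine ⟨fun _ => f.smooth ⊤, fun k _ => ?_⟩
  refine ⟨|2 ^ n * ((Finset.Iic (n, k)).sup fun m => SchwartzMap.seminorm ℝ m.1 m.2) f| + 1,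
    by positivity, fun _ x => ?_⟩
  rw [← div_eq_mul_inv, le_div_iff₀ (by positivity), mul_comm]
  refine (SchwartzMap.one_add_le_sup_seminorm_apply (𝕜 := ℝ) (m := (n, k)) le_rfl le_rfl f x).trans ?_
  exact (le_abs_self _).trans (by linarith)

/-- The inner integral `∫ e^{2πi⟨η, x - y⟩} a((x + y)/2, 2πη) φ(y) dy` of the Weyl quantization. -/
noncomputable def weylInner (a : E × E → ℝ) (φ : E → ℂ) (x η : E) : ℂ :=
  ∫ y, wave η (x - y) * weylAmplitude a (x, y, η) * φ y

variable {a : E × E → ℝ}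

theorem continuous_weylAmplitude (ha : Continuous a) : Continuous (weylAmplitude a) :=
  Complex.continuous_ofReal.comp (ha.comp (weylPoint E).continuous)

theorem exists_norm_weylAmplitude_le (ha : SymbolClass (fun (_ : Unit) _ => 1) (fun _ => a)) :
    ∃ C : ℝ, 0 < C ∧ ∀ z, ‖weylAmplitude a z‖ ≤ C := by
  obtain ⟨C, hC, hb⟩ := (symbolClass_weylAmplitude ha).exists_bound
  exact ⟨C, hC, fun z => by simpa using hb () z⟩

theorem integrable_weylInner_integrand (ha : SymbolClass (fun (_ : Unit) _ => 1) (fun _ => a))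
    (f : 𝓢(E, ℂ)) (x η : E) :
    Integrable (fun y => wave η (x - y) * weylAmplitude a (x, y, η) * f y) := by
  obtain ⟨C, hC, hb⟩ := exists_norm_weylAmplitude_le ha
  have hc := continuous_weylAmplitude (ha.continuous ())
  refine f.integrable.bdd_mul (c := C) (Continuous.aestronglyMeasurable ?_) (.of_forall fun y => ?_)
  · exact (continuous_const.wave (by fun_prop)).mul (by fun_prop)
  · simpa using hb (x, y, η)

/-- Up to a phase, the inner integral is the Fourier transform in `y` of symbol times test function.
The `η` inside the symbol is frozen as a parameter, the decay is uniform in it, and only then is it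
set equal to the transform variable. -/
theorem exists_norm_weylInner_le (ha : SymbolClass (fun (_ : Unit) _ => 1) (fun _ => a))
    (f : 𝓢(E, ℂ)) : ∃ C : ℝ, 0 < C ∧
      ∀ x η, ‖weylInner a f x η‖ ≤ C * ((1 + ‖η‖) ^ (Module.finrank ℝ E + 1))⁻¹ := by
  set n := Module.finrank ℝ E + 1
  have h1 := ((symbolClass_weylAmplitude ha).reindex (fun _ : E × E => ())).comp_affine
    (ContinuousLinearMap.prod (0 : E →L[ℝ] E) (ContinuousLinearMap.prod (ContinuousLinearMap.id ℝ E) 0))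
    (fun s => ((s.1, 0, s.2) : E × E × E))
  have h2 := h1.mul (symbolClass_schwartz (ι := E × E) f n)
  have hρ := integrable_inv_one_add_norm_pow (V := E) (n := n) (by omega)
  obtain ⟨C, hC, hb⟩ := h2.norm_fourier_le (fun _ => by simpa using hρ) n
  simp only [one_mul] at hb
  have h0 : 0 ≤ ∫ v : E, ((1 + ‖v‖) ^ n)⁻¹ := integral_nonneg fun v => by positivity
  refine ⟨C * (∫ v : E, ((1 + ‖v‖) ^ n)⁻¹) + 1, by positivity, fun x η => ?_⟩
  have h3 : weylInner a f x η = wave η x * 𝓕 (fun y => weylAmplitude a (x, y, η) * f y) η := by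
    rw [fourier_eq_integral_wave, ← integral_const_mul]
    refine integral_congr_ae (.of_forall fun y => ?_)
    simp only
    rw [sub_eq_add_neg, wave_add_right, wave_neg_right]
    ring
  rw [h3, norm_mul, norm_wave, one_mul]
  have h4 := hb (x, η) η
  simp only [ContinuousLinearMap.prod_apply, _root_.zero_apply,
    ContinuousLinearMap.id_apply, Prod.mk_add_mk, zero_add, add_zero] at h4
  refine h4.trans (mul_le_mul_of_nonneg_right (by linarith) (by positivity))

theorem stronglyMeasurable_weylInner (ha : Continuous a) {f : E → ℂ} (hf : Continuous f) :
    StronglyMeasurable (fun s : E × E => weylInner a f s.1 s.2) := by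
  have hc := continuous_weylAmplitude ha
  refine StronglyMeasurable.integral_prod_right (f := fun (s : E × E) (y : E) =>
    wave s.2 (s.1 - y) * weylAmplitude a (s.1, y, s.2) * f y) (Continuous.stronglyMeasurable ?_)
  exact ((Continuous.wave (by fun_prop) (by fun_prop)).mul (by fun_prop)).mul (by fun_prop)

theorem integrable_weylInner (ha : SymbolClass (fun (_ : Unit) _ => 1) (fun _ => a))
    (f : 𝓢(E, ℂ)) (x : E) : Integrable (weylInner a f x) := by
  obtain ⟨C, hC, hb⟩ := exists_norm_weylInner_le ha f
  refine ((integrable_inv_one_add_norm_pow (V := E) (n := Module.finrank ℝ E + 1)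
    (by omega)).const_mul C).mono' ?_ (.of_forall (hb x))
  exact ((stronglyMeasurable_weylInner (ha.continuous ()) f.continuous).comp_measurable
    measurable_prodMk_left).aestronglyMeasurable

/-- The Weyl quantization in the normalization with frequencies `2πη`. -/
noncomputable def weylIntegral (a : E × E → ℝ) (φ : E → ℂ) (x : E) : ℂ := ∫ η, weylInner a φ x η

theorem stronglyMeasurable_weylIntegral (ha : Continuous a) {f : E → ℂ} (hf : Continuous f) :
    StronglyMeasurable (weylIntegral a f) :=
  StronglyMeasurable.integral_prod_right (f := weylInner a f) (stronglyMeasurable_weylInner ha hf)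

theorem exists_norm_weylIntegral_le (ha : SymbolClass (fun (_ : Unit) _ => 1) (fun _ => a))
    (f : 𝓢(E, ℂ)) : ∃ C : ℝ, 0 < C ∧ ∀ x, ‖weylIntegral a f x‖ ≤ C := by
  obtain ⟨C, hC, hb⟩ := exists_norm_weylInner_le ha f
  have hρ := integrable_inv_one_add_norm_pow (V := E) (n := Module.finrank ℝ E + 1) (by omega)
  have h0 : 0 ≤ ∫ v : E, C * ((1 + ‖v‖) ^ (Module.finrank ℝ E + 1))⁻¹ :=
    integral_nonneg fun v => by positivity
  refine ⟨(∫ v : E, C * ((1 + ‖v‖) ^ (Module.finrank ℝ E + 1))⁻¹) + 1, by positivity, fun x => ?_⟩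
  have := norm_integral_le_of_norm_le (hρ.const_mul C) (.of_forall (hb x))
  exact this.trans (by linarith)

theorem integrable_cutoff {χ : E → ℝ} (hχc : Continuous χ)
    (hχ0 : ∀ x, x ∉ Metric.closedBall (0 : E) 2 → χ x = 0) (n : ℕ) :
    Integrable (fun η => (χ (((n : ℝ) + 1)⁻¹ • η) : ℂ)) := by
  refine Continuous.integrable_of_hasCompactSupport (by fun_prop) ?_
  refine HasCompactSupport.intro (isCompact_closedBall (0 : E) (2 * (n + 1))) fun η hη => ?_
  rw [hχ0, Complex.ofReal_zero]
  rw [mem_closedBall_zero_iff, norm_smul, Real.norm_of_nonneg (by positivity), not_le,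
    ← div_eq_inv_mul, lt_div_iff₀ (by positivity)]
  simpa using hη

theorem oscForm_freqCut_eq (ha : SymbolClass (fun (_ : Unit) _ => 1) (fun _ => a))
    {χ : E → ℝ} (hχc : Continuous χ) (hχ0 : ∀ x, x ∉ Metric.closedBall (0 : E) 2 → χ x = 0)
    (n : ℕ) (f g : 𝓢(E, ℂ)) :
    oscForm (freqCut χ n (weylAmplitude a)) f g
      = ∫ x, conj (g x) * ∫ η, χ (((n : ℝ) + 1)⁻¹ • η) * weylInner a f x η := by
  obtain ⟨C, hC, hb⟩ := exists_norm_weylAmplitude_le ha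
  have hc := continuous_weylAmplitude (ha.continuous ())
  unfold oscForm
  refine integral_congr_ae (.of_forall fun x => ?_)
  simp only [mul_assoc]
  rw [integral_const_mul]
  congr 1
  simp only [oscKernel, weylInner, ← integral_const_mul]
  have hχi := integrable_cutoff hχc hχ0 n
  have hI : Integrable (Function.uncurry fun y η => f y * (wave η (x - y) *
      freqCut χ n (weylAmplitude a) (x, y, η))) (volume.prod volume) := by
    have h := (f.integrable (μ := volume)).mul_prod hχi
    refine (h.mul_bdd (c := C) (g := fun s : E × E => wave s.2 (x - s.1) *
      weylAmplitude a (x, s.1, s.2)) (Continuous.aestronglyMeasurable ?_)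
      (.of_forall fun s => ?_)).congr (.of_forall fun s => ?_)
    · exact (Continuous.wave (by fun_prop) (by fun_prop)).mul (by fun_prop)
    · simpa using hb _
    · simp only [Function.uncurry, freqCut, Complex.real_smul]
      ring
  rw [integral_integral_swap hI]
  refine integral_congr_ae (.of_forall fun η => integral_congr_ae (.of_forall fun y => ?_))
  simp only [freqCut, Complex.real_smul]
  ring

/-- The bridge between the two descriptions of the form: every bound uniform in `n` passes to the
Weyl form by dominated convergence. -/
theorem tendsto_oscForm_freqCut (ha : SymbolClass (fun (_ : Unit) _ => 1) (fun _ => a))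
    {χ : E → ℝ} (hχc : Continuous χ) (hχ0 : ∀ x, x ∉ Metric.closedBall (0 : E) 2 → χ x = 0)
    (hχ1 : χ 0 = 1) (hχn : ∀ x, 0 ≤ χ x) (hχl : ∀ x, χ x ≤ 1) (f g : 𝓢(E, ℂ)) :
    Tendsto (fun n => oscForm (freqCut χ n (weylAmplitude a)) f g) atTop
      (𝓝 (∫ x, conj (g x) * weylIntegral a f x)) := by
  obtain ⟨C, hC, hb⟩ := exists_norm_weylInner_le ha f
  have hρ := (integrable_inv_one_add_norm_pow (V := E) (n := Module.finrank ℝ E + 1)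
    (by omega)).const_mul C
  have hbd : ∀ (n : ℕ) x η, ‖(χ (((n : ℝ) + 1)⁻¹ • η) : ℂ) * weylInner a f x η‖
      ≤ C * ((1 + ‖η‖) ^ (Module.finrank ℝ E + 1))⁻¹ := fun n x η => by
    rw [norm_mul, Complex.norm_real, Real.norm_of_nonneg (hχn _)]
    exact (mul_le_of_le_one_left (norm_nonneg _) (hχl _)).trans (hb x η)
  have hm := stronglyMeasurable_weylInner (ha.continuous ()) f.continuous
  have hm2 : ∀ n : ℕ, StronglyMeasurable (fun s : E × E =>
      (χ (((n : ℝ) + 1)⁻¹ • s.2) : ℂ) * weylInner a f s.1 s.2) := fun n =>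
    (Continuous.stronglyMeasurable (by fun_prop)).mul hm
  simp only [oscForm_freqCut_eq ha hχc hχ0]
  refine tendsto_integral_of_dominated_convergence
    (fun x => ‖g x‖ * ∫ η : E, C * ((1 + ‖η‖) ^ (Module.finrank ℝ E + 1))⁻¹) (fun n => ?_)
    (g.integrable.norm.mul_const _) (fun n => .of_forall fun x => ?_) (.of_forall fun x => ?_)
  · exact (Complex.continuous_conj.comp g.continuous).aestronglyMeasurable.mul
      (StronglyMeasurable.integral_prod_right (hm2 n)).aestronglyMeasurable
  · rw [norm_mul, RCLike.norm_conj]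
    exact mul_le_mul_of_nonneg_left
      (norm_integral_le_of_norm_le hρ (.of_forall (hbd n x))) (norm_nonneg _)
  · refine Tendsto.const_mul _ ?_
    refine tendsto_integral_of_dominated_convergence _ (fun n => ?_) hρ
      (fun n => .of_forall (hbd n x)) (.of_forall fun η => ?_)
    · exact ((hm2 n).comp_measurable measurable_prodMk_left).aestronglyMeasurable
    · have h1 := (Complex.continuous_ofReal.tendsto _).comp (tendsto_cutoff hχc hχ1 η)
      simpa using h1.mul_const (weylInner a f x η)

end WeylAmplitudes

/-! ### Boundedness and symmetry of the Weyl form, and its operator. -/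

section WeylForms

open FourierTransform Filter Topology
open scoped ComplexConjugate

variable {ι : Type*} {E : Type*} [NormedAddCommGroup E] [InnerProductSpace ℝ E]

theorem symbolClass_one_of_compactSupport {ι E F : Type*} [NormedAddCommGroup E] [NormedSpace ℝ E]
    [NormedAddCommGroup F] [NormedSpace ℝ F] {u : E → F} (hu : ContDiff ℝ ∞ u)
    {S : Set E} (hS : IsCompact S) (h0 : ∀ x, x ∉ S → u x = 0) :
    SymbolClass (fun (_ : ι) _ => 1) (fun _ => u) :=
  (symbolClass_of_compactSupport hu hS h0).of_weight_le fun _ x =>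
    Set.indicator_le_self' (fun _ _ => zero_le_one) x

variable [FiniteDimensional ℝ E] [MeasurableSpace E] [BorelSpace E]

/-- The sesquilinear form `⟨g, Op(a) f⟩` of the Weyl quantization. -/
noncomputable def weylForm (a : E × E → ℝ) (f g : E → ℂ) : ℂ :=
  ∫ x, conj (g x) * weylIntegral a f x

/-- Optimization at `s² = √B / √A`, regularized by `ε` to allow `A` or `B` to vanish. -/
theorem le_two_mul_sqrt_mul_sqrt {X C A B : ℝ} (hC : 0 ≤ C) (hA : 0 ≤ A) (hB : 0 ≤ B)
    (h : ∀ s : ℝ, 0 < s → X ≤ C * (s ^ 2 * A + (s⁻¹) ^ 2 * B)) : X ≤ 2 * C * (√A * √B) := by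
  have key : ∀ ε : ℝ, 0 < ε → X ≤ C * ((√B + ε) * √A + (√A + ε) * √B) := by
    intro ε hε
    have hA' : 0 < √A + ε := by positivity
    have hB' : 0 < √B + ε := by positivity
    refine (h (√((√B + ε) / (√A + ε))) (by positivity)).trans ?_
    rw [inv_pow, Real.sq_sqrt (by positivity)]
    refine mul_le_mul_of_nonneg_left (add_le_add ?_ ?_) hC
    · rw [div_mul_eq_mul_div, div_le_iff₀ hA', mul_assoc]
      refine mul_le_mul_of_nonneg_left ?_ hB'.le
      nlinarith [Real.sq_sqrt hA, Real.sqrt_nonneg A]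
    · rw [inv_div, div_mul_eq_mul_div, div_le_iff₀ hB', mul_assoc]
      refine mul_le_mul_of_nonneg_left ?_ hA'.le
      nlinarith [Real.sq_sqrt hB, Real.sqrt_nonneg B]
  have hlim : Tendsto (fun ε : ℝ => C * ((√B + ε) * √A + (√A + ε) * √B)) (𝓝[>] 0)
      (𝓝 (C * ((√B + 0) * √A + (√A + 0) * √B))) :=
    (Continuous.tendsto (by fun_prop) (0 : ℝ)).mono_left nhdsWithin_le_nhds
  have := ge_of_tendsto hlim (eventually_mem_nhdsWithin.mono fun ε hε => key ε hε)
  linarith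

theorem weylIntegral_const_smul (a : E × E → ℝ) (c : ℂ) (f : E → ℂ) (x : E) :
    weylIntegral a (fun y => c * f y) x = c * weylIntegral a f x := by
  simp only [weylIntegral, weylInner, ← integral_const_mul]
  refine integral_congr_ae (.of_forall fun η => integral_congr_ae (.of_forall fun y => ?_))
  simp only
  ring

theorem weylIntegral_add {a : E × E → ℝ} (ha : SymbolClass (fun (_ : Unit) _ => 1) (fun _ => a))
    (f g : 𝓢(E, ℂ)) (x : E) :
    weylIntegral a (fun y => f y + g y) x = weylIntegral a f x + weylIntegral a g x := by
  rw [weylIntegral, weylIntegral, weylIntegral,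
    ← integral_add (integrable_weylInner ha f x) (integrable_weylInner ha g x)]
  refine integral_congr_ae (.of_forall fun η => ?_)
  simp only [weylInner]
  rw [← integral_add (integrable_weylInner_integrand ha f x η)
    (integrable_weylInner_integrand ha g x η)]
  simp only [mul_add]

theorem weylIntegral_neg_symbol (a : E × E → ℝ) (f : E → ℂ) (x : E) :
    weylIntegral (fun z => - a z) f x = - weylIntegral a f x := by
  simp only [weylIntegral, weylInner, weylAmplitude, ← integral_neg]
  refine integral_congr_ae (.of_forall fun η => integral_congr_ae (.of_forall fun y => ?_))
  simp only [Complex.ofReal_neg]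
  ring

theorem symbolClass_freqCut_weylAmplitude {a : ι → E × E → ℝ}
    (ha : SymbolClass (fun _ _ => 1) a) {χ : E → ℝ}
    (hχ : SymbolClass (fun (_ : Unit) _ => 1) (fun _ => χ)) :
    SymbolClass (fun (_ : ι × ℕ) _ => 1) (fun s => freqCut χ s.2 (weylAmplitude (a s.1))) :=
  symbolClass_freqCut (symbolClass_weylAmplitude ha) hχ

theorem exists_norm_oscForm_freqCut_le {a : ι → E × E → ℝ} (ha : SymbolClass (fun _ _ => 1) a)
    {χ : E → ℝ} (hχ : SymbolClass (fun (_ : Unit) _ => 1) (fun _ => χ))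
    (hχ0 : ∀ x, x ∉ Metric.closedBall (0 : E) 2 → χ x = 0) :
    ∃ C : ℝ, 0 < C ∧ ∀ i (n : ℕ) (f g : 𝓢(E, ℂ)),
      ‖oscForm (freqCut χ n (weylAmplitude (a i))) f g‖
        ≤ C * ((∫ x, ‖f x‖ ^ 2) + ∫ x, ‖g x‖ ^ 2) := by
  obtain ⟨C, hC, hb⟩ := exists_norm_oscForm_le (p := fun s : ι × ℕ =>
    freqCut χ s.2 (weylAmplitude (a s.1)))
    ((symbolClass_freqCut_weylAmplitude ha hχ).of_weight_le fun s z => by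
      have : 0 ≤ ‖z.1 - z.2.1‖ ^ 2 := by positivity
      linarith) (fun s => freqCompact_freqCut hχ0 _ _)
  exact ⟨C, hC, fun i n f g => hb (i, n) f g⟩

theorem exists_smooth_cutoff (E : Type*) [NormedAddCommGroup E] [InnerProductSpace ℝ E]
    [FiniteDimensional ℝ E] [MeasurableSpace E] [BorelSpace E] :
    ∃ χ : E → ℝ, SymbolClass (fun (_ : Unit) _ => 1) (fun _ => χ) ∧
      (∀ x, x ∉ Metric.closedBall (0 : E) 2 → χ x = 0) ∧ (∀ x, χ (-x) = χ x) ∧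
      χ 0 = 1 ∧ (∀ x, 0 ≤ χ x) ∧ (∀ x, χ x ≤ 1) := by
  obtain ⟨G, hG, hG0, hGe, hGn, hGl, hG1, -⟩ := exists_smooth_window E
  exact ⟨G, symbolClass_one_of_compactSupport hG (isCompact_closedBall _ _) hG0, hG0, hGe,
    hG1 0 (by simp), hGn, hGl⟩

theorem exists_norm_weylForm_le {a : ι → E × E → ℝ} (ha : SymbolClass (fun _ _ => 1) a) :
    ∃ C : ℝ, 0 < C ∧ ∀ i (f g : 𝓢(E, ℂ)),
      ‖weylForm (a i) f g‖ ≤ C * (√(∫ x, ‖f x‖ ^ 2) * √(∫ x, ‖g x‖ ^ 2)) := by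
  obtain ⟨χ, hχ, hχ0, -, hχ1, hχn, hχl⟩ := exists_smooth_cutoff E
  obtain ⟨C, hC, hb⟩ := exists_norm_oscForm_freqCut_le ha hχ hχ0
  refine ⟨2 * C, by positivity, fun i f g => ?_⟩
  have h1 : ∀ f g : 𝓢(E, ℂ), ‖weylForm (a i) f g‖ ≤ C * ((∫ x, ‖f x‖ ^ 2) + ∫ x, ‖g x‖ ^ 2) :=
    fun f g => le_of_tendsto (tendsto_oscForm_freqCut (ha.reindex fun _ : Unit => i)
      (hχ.continuous ()) hχ0 hχ1 hχn hχl f g).norm (.of_forall fun n => hb i n f g)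
  -- The form is unchanged under `f ↦ s f`, `g ↦ s⁻¹ g`, which turns the sum of squared norms into
  -- their product.
  refine le_two_mul_sqrt_mul_sqrt hC.le (integral_nonneg fun x => by positivity)
    (integral_nonneg fun x => by positivity) fun s hs => ?_
  have h2 := h1 ((s : ℂ) • f) (((s⁻¹ : ℝ) : ℂ) • g)
  have h3 : weylForm (a i) ((s : ℂ) • f : 𝓢(E, ℂ)) (((s⁻¹ : ℝ) : ℂ) • g : 𝓢(E, ℂ))
      = weylForm (a i) f g := by
    refine integral_congr_ae (.of_forall fun x => ?_)
    have h4 := weylIntegral_const_smul (a i) s f x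
    have h5 : (((s : ℂ) • f : 𝓢(E, ℂ)) : E → ℂ) = fun y => (s : ℂ) * f y := by
      ext y; simp
    simp only [h5, h4, _root_.smul_apply, smul_eq_mul, map_mul, Complex.conj_ofReal]
    have : (s : ℂ) ≠ 0 := by exact_mod_cast hs.ne'
    push_cast
    field_simp
  rw [h3] at h2
  refine h2.trans_eq ?_
  simp only [_root_.smul_apply, norm_smul, mul_pow, integral_const_mul, Complex.norm_real,
    Real.norm_of_nonneg hs.le, Real.norm_of_nonneg (inv_nonneg.2 hs.le)]

theorem norm_toLp_two (f : 𝓢(E, ℂ)) : ‖f.toLp 2 volume‖ = √(∫ x, ‖f x‖ ^ 2) := by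
  rw [SchwartzMap.norm_toLp' (by norm_num) (by norm_num), Real.sqrt_eq_rpow]
  norm_num

/-- Duality: `g ↦ ∫ g ū` extends to `L²` by density, Riesz represents it by some `v`, and testing on
smooth compactly supported functions gives `v = u` almost everywhere. The crude bound `B` only makes
the pairings converge. -/
theorem memLp_of_forall_schwartz {u : E → ℂ} (hu : StronglyMeasurable u) {B : ℝ}
    (hB : ∀ x, ‖u x‖ ≤ B) {K : ℝ} (hK : 0 ≤ K)
    (h : ∀ g : 𝓢(E, ℂ), ‖∫ x, conj (g x) * u x‖ ≤ K * ‖g.toLp 2 volume‖) :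
    ∃ hm : MemLp u 2 volume, ‖hm.toLp u‖ ≤ K := by
  have hu' : StronglyMeasurable (fun x => conj (u x)) := Complex.continuous_conj.comp_stronglyMeasurable hu
  have hint : ∀ g : 𝓢(E, ℂ), Integrable (fun x => g x * conj (u x)) := fun g =>
    g.integrable.mul_bdd (c := B) hu'.aestronglyMeasurable (.of_forall fun x => by simpa using hB x)
  let ℓ : 𝓢(E, ℂ) →ₗ[ℂ] ℂ :=
    { toFun := fun g => ∫ x, g x * conj (u x)
      map_add' := fun f g => by
        simp only [_root_.add_apply, add_mul]
        exact integral_add (hint f) (hint g)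
      map_smul' := fun c g => by
        simp only [_root_.smul_apply, smul_eq_mul, mul_assoc, integral_const_mul,
          RingHom.id_apply] }
  have hℓ : ∀ g, ‖ℓ g‖ ≤ K * ‖(SchwartzMap.toLpCLM ℂ ℂ 2 volume : 𝓢(E, ℂ) →L[ℂ] Lp ℂ 2 volume).toLinearMap g‖ := by
    intro g
    have h1 : ℓ g = conj (∫ x, conj (g x) * u x) := by
      rw [← integral_conj]
      exact integral_congr_ae (.of_forall fun x => by simp)
    rw [h1, RCLike.norm_conj]
    exact h g
  have hd : DenseRange (SchwartzMap.toLpCLM ℂ ℂ 2 volume : 𝓢(E, ℂ) →L[ℂ] Lp ℂ 2 volume).toLinearMap :=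
    SchwartzMap.denseRange_toLpCLM (F := ℂ) (μ := (volume : Measure E)) (p := 2) (by norm_num)
  let L := ℓ.extendOfNorm (SchwartzMap.toLpCLM ℂ ℂ 2 volume : 𝓢(E, ℂ) →L[ℂ] Lp ℂ 2 volume).toLinearMap
  have hL : ∀ g : 𝓢(E, ℂ), L (g.toLp 2 volume) = ∫ x, g x * conj (u x) := fun g =>
    LinearMap.extendOfNorm_eq hd ⟨K, hℓ⟩ g
  have hLn : ‖L‖ ≤ K := LinearMap.opNorm_extendOfNorm_le hd hK hℓ
  let v : Lp ℂ 2 (volume : Measure E) := (InnerProductSpace.toDual ℂ _).symm L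
  have hvn : ‖v‖ ≤ K := by simpa [v] using hLn
  have hv : ∀ g : 𝓢(E, ℂ), ∫ x, g x * conj (v x) = ∫ x, g x * conj (u x) := by
    intro g
    have h1 : inner ℂ v (g.toLp 2 volume) = L (g.toLp 2 volume) :=
      InnerProductSpace.toDual_symm_apply
    rw [← hL, ← h1, MeasureTheory.L2.inner_def]
    refine integral_congr_ae ?_
    filter_upwards [g.coeFn_toLp 2 volume] with x hx
    rw [hx]
    rfl
  have hvu : (v : E → ℂ) =ᵐ[volume] u := by
    refine ae_eq_of_integral_contDiff_smul_eq ((Lp.memLp v).locallyIntegrable (by norm_num)) ?_ ?_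
    · refine LocallyIntegrable.mono (locallyIntegrable_const B) hu.aestronglyMeasurable
        (.of_forall fun x => ?_)
      rw [Real.norm_eq_abs]
      exact (hB x).trans (le_abs_self B)
    · intro g hg hgc
      have hg' : ContDiff ℝ ∞ (fun x => (g x : ℂ)) := Complex.ofRealCLM.contDiff.comp hg
      have hgc' : HasCompactSupport (fun x => (g x : ℂ)) :=
        hgc.comp_left (g := Complex.ofReal) Complex.ofReal_zero
      have h1 := congrArg conj (hv (hgc'.toSchwartzMap hg'))
      simp only [← integral_conj, map_mul, Complex.conj_conj] at h1
      simpa using h1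
  have hm : MemLp u 2 volume := (memLp_congr_ae hvu).1 (Lp.memLp v)
  refine ⟨hm, ?_⟩
  have : hm.toLp u = v := Lp.ext (hm.coeFn_toLp.trans hvu.symm)
  rwa [this]

theorem exists_memLp_weylIntegral {a : E × E → ℝ}
    (ha : SymbolClass (fun (_ : Unit) _ => 1) (fun _ => a)) :
    ∃ K : ℝ, 0 < K ∧ ∀ f : 𝓢(E, ℂ), ∃ hm : MemLp (weylIntegral a f) 2 volume,
      ‖hm.toLp (weylIntegral a f)‖ ≤ K * ‖f.toLp 2 volume‖ := by
  obtain ⟨C, hC, hb⟩ := exists_norm_weylForm_le ha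
  refine ⟨C, hC, fun f => ?_⟩
  obtain ⟨B, -, hB⟩ := exists_norm_weylIntegral_le ha f
  refine memLp_of_forall_schwartz (stronglyMeasurable_weylIntegral (ha.continuous ()) f.continuous)
    hB (by positivity) fun g => (hb () f g).trans_eq ?_
  rw [norm_toLp_two, norm_toLp_two, mul_assoc]

theorem exists_clm_weylIntegral {a : E × E → ℝ}
    (ha : SymbolClass (fun (_ : Unit) _ => 1) (fun _ => a)) :
    ∃ T : Lp ℂ 2 (volume : Measure E) →L[ℂ] Lp ℂ 2 (volume : Measure E), ∀ f : 𝓢(E, ℂ),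
      (T (f.toLp 2 volume) : E → ℂ) =ᵐ[volume] weylIntegral a f := by
  obtain ⟨K, hK, hm⟩ := exists_memLp_weylIntegral ha
  choose hm hn using hm
  let A : 𝓢(E, ℂ) →ₗ[ℂ] Lp ℂ 2 (volume : Measure E) :=
    { toFun := fun f => (hm f).toLp _
      map_add' := fun f g => by
        rw [← MemLp.toLp_add, MemLp.toLp_eq_toLp_iff]
        exact .of_forall (weylIntegral_add ha f g)
      map_smul' := fun c f => by
        rw [RingHom.id_apply, ← MemLp.toLp_const_smul, MemLp.toLp_eq_toLp_iff]
        exact .of_forall (weylIntegral_const_smul a c f) }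
  have hd : DenseRange (SchwartzMap.toLpCLM ℂ ℂ 2 volume : 𝓢(E, ℂ) →L[ℂ] Lp ℂ 2 volume).toLinearMap :=
    SchwartzMap.denseRange_toLpCLM (F := ℂ) (μ := (volume : Measure E)) (p := 2) (by norm_num)
  refine ⟨A.extendOfNorm
    (SchwartzMap.toLpCLM ℂ ℂ 2 volume : 𝓢(E, ℂ) →L[ℂ] Lp ℂ 2 volume).toLinearMap, fun f => ?_⟩
  have h : A.extendOfNorm
      (SchwartzMap.toLpCLM ℂ ℂ 2 volume : 𝓢(E, ℂ) →L[ℂ] Lp ℂ 2 volume).toLinearMap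
      (f.toLp 2 volume) = (hm f).toLp _ := LinearMap.extendOfNorm_eq (f := A) hd ⟨K, hn⟩ f
  rw [h]
  exact (hm f).coeFn_toLp

theorem oscKernel_conj_symm {p : E × E × E → ℂ} (hp : ∀ x y η, p (y, x, η) = conj (p (x, y, η)))
    (x y : E) : oscKernel p y x = conj (oscKernel p x y) := by
  rw [oscKernel, oscKernel, ← integral_conj]
  refine integral_congr_ae (.of_forall fun η => ?_)
  beta_reduce
  rw [hp x y η, map_mul, conj_wave, neg_sub]

/-- The midpoint is symmetric in `x, y` and the symbol is real, so each cut kernel is Hermitian; the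
limit inherits the symmetry. -/
theorem weylForm_conj_symm {a : E × E → ℝ}
    (ha : SymbolClass (fun (_ : Unit) _ => 1) (fun _ => a)) (f g : 𝓢(E, ℂ)) :
    weylForm a g f = conj (weylForm a f g) := by
  obtain ⟨χ, hχ, hχ0, -, hχ1, hχn, hχl⟩ := exists_smooth_cutoff E
  have h1 := tendsto_oscForm_freqCut ha (hχ.continuous ()) hχ0 hχ1 hχn hχl f g
  have h2 := tendsto_oscForm_freqCut ha (hχ.continuous ()) hχ0 hχ1 hχn hχl g f
  refine tendsto_nhds_unique h2 (((Complex.continuous_conj.tendsto _).comp h1).congr fun n => ?_)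
  set p := freqCut χ n (weylAmplitude a) with hp
  have hs : ∀ x y η, p (y, x, η) = conj (p (x, y, η)) := fun x y η => by
    simp only [hp, freqCut, weylAmplitude, Complex.real_smul, map_mul, Complex.conj_ofReal,
      add_comm y x]
  have hpc := (symbolClass_freqCut_weylAmplitude ha hχ)
  have hpc' : Continuous p := hpc.continuous ((), n)
  obtain ⟨B, hB, hb⟩ := hpc.exists_bound
  obtain ⟨C, hC⟩ := exists_norm_oscKernel_le (p := p) (freqCompact_freqCut hχ0 n _)
    ⟨B, fun z => by simpa using hb ((), n) z⟩
  simp only [Function.comp]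
  rw [oscForm_eq_integral_prod f g hpc' hC, oscForm_eq_integral_prod g f hpc' hC, ← integral_conj]
  refine Eq.trans ?_ (integral_prod_swap (μ := (volume : Measure E)) (ν := (volume : Measure E)) _)
  refine integral_congr_ae (.of_forall fun z => ?_)
  simp only [Prod.fst_swap, Prod.snd_swap, map_mul, Complex.conj_conj, oscKernel_conj_symm hs z.1 z.2]
  ring

end WeylForms

/-! ### Calculus of maps with bounded derivatives of positive order. -/

section BoundedDerivatives

/-- A family of smooth maps all of whose derivatives of positive order are uniformly bounded. -/
def BoundedDeriv {ι E F : Type*} [NormedAddCommGroup E] [NormedSpace ℝ E] [NormedAddCommGroup F]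
    [NormedSpace ℝ F] (g : ι → E → F) : Prop :=
  (∀ i, ContDiff ℝ ∞ (g i)) ∧ SymbolClass (fun _ _ => 1) (fun i => fderiv ℝ (g i))

variable {ι κ E F G : Type*} [NormedAddCommGroup E] [NormedSpace ℝ E] [NormedAddCommGroup F]
  [NormedSpace ℝ F] [NormedAddCommGroup G] [NormedSpace ℝ G]

namespace BoundedDeriv

theorem differentiable {g : ι → E → F} (hg : BoundedDeriv g) (i : ι) : Differentiable ℝ (g i) :=
  (hg.1 i).differentiable (by simp)

theorem reindex {g : ι → E → F} (hg : BoundedDeriv g) (σ : κ → ι) :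
    BoundedDeriv (fun j => g (σ j)) :=
  ⟨fun j => hg.1 (σ j), hg.2.reindex σ⟩

theorem of_clm (L : E →L[ℝ] F) : BoundedDeriv (fun (_ : ι) x => L x) :=
  ⟨fun _ => L.contDiff, SymbolClass.fderiv_clm L⟩

theorem add {f g : ι → E → F} (hf : BoundedDeriv f) (hg : BoundedDeriv g) :
    BoundedDeriv (fun i x => f i x + g i x) :=
  ⟨fun i => (hf.1 i).add (hg.1 i), (hf.2.add hg.2).congr_fun fun i x =>
    fderiv_fun_add (hf.differentiable i x) (hg.differentiable i x)⟩

theorem comp {f : ι → F → G} {g : ι → E → F} (hf : BoundedDeriv f) (hg : BoundedDeriv g) :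
    BoundedDeriv (fun i x => f i (g i x)) := by
  refine ⟨fun i => (hf.1 i).comp (hg.1 i), ?_⟩
  refine (((hf.2.comp hg.1 hg.2).clm_comp hg.2).congr_fun fun i x => ?_).congr_weight
    fun _ _ => one_mul _
  exact fderiv_comp x (hf.differentiable i _) (hg.differentiable i x)

theorem clm {g : ι → E → F} (hg : BoundedDeriv g) (L : F →L[ℝ] G) :
    BoundedDeriv (fun i x => L (g i x)) := (of_clm L).comp hg

theorem comp_clm {f : ι → F → G} (hf : BoundedDeriv f) (L : E →L[ℝ] F) :
    BoundedDeriv (fun i x => f i (L x)) := hf.comp (of_clm L)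

theorem const_smul {g : ι → E → F} (hg : BoundedDeriv g) {c : ι → ℝ} {B : ℝ}
    (hc : ∀ i, |c i| ≤ B) : BoundedDeriv (fun i x => c i • g i x) := by
  refine ⟨fun i => contDiff_const.smul (hg.1 i), ?_⟩
  refine ((hg.2.const_smul c).congr_fun fun i x =>
    fderiv_fun_const_smul (hg.differentiable i x) (c i)).mono (B := |B| + 1)
    (by positivity) fun i x => ?_
  simpa using ((hc i).trans (le_abs_self B)).trans (by linarith)

theorem neg {g : ι → E → F} (hg : BoundedDeriv g) : BoundedDeriv (fun i x => - g i x) :=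
  hg.clm (-ContinuousLinearMap.id ℝ F)

theorem sub {f g : ι → E → F} (hf : BoundedDeriv f) (hg : BoundedDeriv g) :
    BoundedDeriv (fun i x => f i x - g i x) := by
  simpa only [sub_eq_add_neg] using hf.add hg.neg

theorem prodMk {f : ι → E → F} {g : ι → E → G} (hf : BoundedDeriv f) (hg : BoundedDeriv g) :
    BoundedDeriv (fun i x => (f i x, g i x)) := by
  have h1 := hf.clm (ContinuousLinearMap.inl ℝ F G)
  have h2 := hg.clm (ContinuousLinearMap.inr ℝ F G)
  simpa using h1.add h2

theorem exists_lipschitz {g : ι → E → F} (hg : BoundedDeriv g) :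
    ∃ C : ℝ, 0 < C ∧ ∀ i x y, ‖g i x - g i y‖ ≤ C * ‖x - y‖ := hg.2.exists_lipschitz hg.1

end BoundedDeriv

theorem SymbolClass.comp_boundedDeriv {f : ι → F → G} {w : ι → F → ℝ} {g : ι → E → F}
    (hf : SymbolClass w f) (hg : BoundedDeriv g) :
    SymbolClass (fun i x => w i (g i x)) (fun i x => f i (g i x)) := hf.comp hg.1 hg.2

end BoundedDerivatives

/-! ### The error amplitude and its size `δ (1 + |x - y|²)`. -/

section CoherentAmplitudes

variable {ι : Type*} {E : Type} [NormedAddCommGroup E] [InnerProductSpace ℝ E]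

/-- The first position variable of an amplitude. -/
abbrev ampFst (E : Type*) [NormedAddCommGroup E] [InnerProductSpace ℝ E] : E × E × E →L[ℝ] E :=
  ContinuousLinearMap.fst ℝ E (E × E)

/-- The second position variable of an amplitude. -/
abbrev ampSnd (E : Type*) [NormedAddCommGroup E] [InnerProductSpace ℝ E] : E × E × E →L[ℝ] E :=
  (ContinuousLinearMap.fst ℝ E E).comp (ContinuousLinearMap.snd ℝ E (E × E))

/-- The frequency variable of an amplitude. -/
abbrev ampFreq (E : Type*) [NormedAddCommGroup E] [InnerProductSpace ℝ E] : E × E × E →L[ℝ] E :=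
  (ContinuousLinearMap.snd ℝ E E).comp (ContinuousLinearMap.snd ℝ E (E × E))

/-- The midpoint `(φ(x) + φ(y)) / 2` of the images under `φ = id + δ F`, together with the
frequency `2πη`. -/
noncomputable def imageMidpoint (δ : ℝ) (F : E → E) (z : E × E × E) : E × E :=
  ((1 / 2 : ℝ) • (z.1 + z.2.1) + (δ / 2) • (F z.1 + F z.2.1), (2 * Real.pi) • z.2.2)

/-- The image `φ((x + y) / 2)` of the midpoint under `φ = id + δ F`, together with the
frequency `2πη`. -/
noncomputable def midpointImage (δ : ℝ) (F : E → E) (z : E × E × E) : E × E :=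
  ((1 / 2 : ℝ) • (z.1 + z.2.1) + δ • F ((1 / 2 : ℝ) • (z.1 + z.2.1)), (2 * Real.pi) • z.2.2)

/-- Half of the rescaled displacement difference. -/
noncomputable def halfShift (δ : ℝ) (F : E → E) (x y : E) : E := (√δ) • ((1 / 2 : ℝ) • (F x - F y))

/-- The product of two translated windows. -/
def windowPair (h : E → ℝ) (s u : E) : ℝ := h (s - u) * h (s + u)

/-- The error amplitude of the symmetrized coherent state decomposition. -/
noncomputable def errorAmplitude (h : E → ℝ) (a : E × E → ℝ) (δ : ℝ) (F : E → E) (s : E)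
    (z : E × E × E) : ℂ :=
  ((1 / 2 * windowPair h s (halfShift δ F z.1 z.2.1) *
      (a (imageMidpoint δ F z + (√δ • s, 0)) + a (imageMidpoint δ F z + (-(√δ • s), 0)))
    - h s ^ 2 * a (midpointImage δ F z) : ℝ) : ℂ)

variable {a : ι → E × E → ℝ} {F : ι → E → E} {δ : ι → ℝ} {s : ι → E}

/-- Since `2s = (s - u) + (s + u)`, the range of `s` that matters is one fixed ball, whatever `u`
is. -/
theorem windowPair_eq_zero {h : E → ℝ} (h0 : ∀ x, x ∉ Metric.closedBall (0 : E) 2 → h x = 0)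
    {s : E} (hs : s ∉ Metric.closedBall (0 : E) 2) (u : E) : windowPair h s u = 0 := by
  by_contra hne
  obtain ⟨h1, h2⟩ := mul_ne_zero_iff.1 hne
  have h1' : ‖s - u‖ ≤ 2 := by simpa using not_imp_comm.1 (h0 _) h1
  have h2' : ‖s + u‖ ≤ 2 := by simpa using not_imp_comm.1 (h0 _) h2
  have h3 : (2 : ℝ) • s = (s - u) + (s + u) := by module
  have h4 := norm_add_le (s - u) (s + u)
  rw [← h3, norm_smul, Real.norm_two] at h4
  exact hs (by simp; linarith)

theorem boundedDeriv_imageMidpoint (hF : BoundedDeriv F) (hδ : ∀ i, 0 ≤ δ i) (hδ1 : ∀ i, δ i ≤ 1) :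
    BoundedDeriv (fun i => imageMidpoint (δ i) (F i)) := by
  have h1 : BoundedDeriv (fun i (z : E × E × E) => (δ i / 2) • (F i z.1 + F i z.2.1)) := by
    refine ((hF.comp_clm (ampFst E)).add (hF.comp_clm (ampSnd E))).const_smul (B := 1) fun i => ?_
    rw [abs_of_nonneg (by have := hδ i; positivity)]
    linarith [hδ1 i, hδ i]
  exact ((BoundedDeriv.of_clm ((1 / 2 : ℝ) • (ampFst E + ampSnd E))).add h1).prodMk
    (BoundedDeriv.of_clm ((2 * Real.pi) • ampFreq E))

theorem boundedDeriv_midpointImage (hF : BoundedDeriv F) (hδ : ∀ i, 0 ≤ δ i) (hδ1 : ∀ i, δ i ≤ 1) :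
    BoundedDeriv (fun i => midpointImage (δ i) (F i)) := by
  have h1 : BoundedDeriv (fun i (z : E × E × E) => δ i • F i ((1 / 2 : ℝ) • (z.1 + z.2.1))) := by
    refine (hF.comp_clm ((1 / 2 : ℝ) • (ampFst E + ampSnd E))).const_smul (B := 1) fun i => ?_
    rw [abs_of_nonneg (hδ i)]
    exact hδ1 i
  exact ((BoundedDeriv.of_clm ((1 / 2 : ℝ) • (ampFst E + ampSnd E))).add h1).prodMk
    (BoundedDeriv.of_clm ((2 * Real.pi) • ampFreq E))

/-- Both endpoints lie at distance `|x - y| / 2` from the midpoint, so the Lipschitz bound on `F`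
controls the size; derivatives of the difference are bounded by `O(δ)`. -/
theorem symbolClass_imageMidpoint_sub (hF : BoundedDeriv F) (hδ : ∀ i, 0 ≤ δ i) :
    SymbolClass (fun i (z : E × E × E) => δ i * (1 + ‖z.1 - z.2.1‖))
      (fun i z => imageMidpoint (δ i) (F i) z - midpointImage (δ i) (F i) z) := by
  have hb : BoundedDeriv (fun i (z : E × E × E) =>
      (1 / 2 : ℝ) • (F i z.1 + F i z.2.1) - F i ((1 / 2 : ℝ) • (z.1 + z.2.1))) :=
    (((hF.comp_clm (ampFst E)).add (hF.comp_clm (ampSnd E))).clm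
      ((1 / 2 : ℝ) • ContinuousLinearMap.id ℝ E)).sub (hF.comp_clm ((1 / 2 : ℝ) • (ampFst E + ampSnd E)))
  obtain ⟨C, hC, hl⟩ := hF.exists_lipschitz
  have h1 : SymbolClass (fun _ (z : E × E × E) => 1 + ‖z.1 - z.2.1‖) (fun i (z : E × E × E) =>
      (1 / 2 : ℝ) • (F i z.1 + F i z.2.1) - F i ((1 / 2 : ℝ) • (z.1 + z.2.1))) := by
    refine SymbolClass.of_lipschitz_weight (fun i z => by linarith [norm_nonneg (z.1 - z.2.1)])
      hb.1 ⟨C, hC, fun i z => ?_⟩ hb.2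
    have e : (1 / 2 : ℝ) • (F i z.1 + F i z.2.1) - F i ((1 / 2 : ℝ) • (z.1 + z.2.1))
        = (1 / 2 : ℝ) • (F i z.1 - F i ((1 / 2 : ℝ) • (z.1 + z.2.1)))
          + (1 / 2 : ℝ) • (F i z.2.1 - F i ((1 / 2 : ℝ) • (z.1 + z.2.1))) := by module
    have e1 : z.1 - (1 / 2 : ℝ) • (z.1 + z.2.1) = (1 / 2 : ℝ) • (z.1 - z.2.1) := by module
    have e2 : z.2.1 - (1 / 2 : ℝ) • (z.1 + z.2.1) = (-(1 / 2) : ℝ) • (z.1 - z.2.1) := by module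
    have l1 := hl i z.1 ((1 / 2 : ℝ) • (z.1 + z.2.1))
    have l2 := hl i z.2.1 ((1 / 2 : ℝ) • (z.1 + z.2.1))
    rw [e1, norm_smul] at l1
    rw [e2, norm_smul] at l2
    rw [e]
    refine (norm_add_le _ _).trans ?_
    rw [norm_smul, norm_smul]
    norm_num at l1 l2 ⊢
    have := mul_nonneg hC.le (norm_nonneg (z.1 - z.2.1))
    linarith
  refine (((h1.const_smul δ).clm (ContinuousLinearMap.inl ℝ E E)).congr_fun fun i z => ?_).congr_weight
    fun i z => by rw [abs_of_nonneg (hδ i)]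
  simp only [imageMidpoint, midpointImage, Prod.mk_sub_mk, sub_self, ContinuousLinearMap.inl_apply]
  congr 1
  module

theorem symbolClass_second_difference (ha : SymbolClass (fun _ _ => 1) a) (τ : ι → E × E) :
    SymbolClass (fun i _ => ‖τ i‖ ^ 2) (fun i x => a i (x + τ i) + a i (x - τ i) - 2 * a i x) := by
  -- Translating by `τ` and then by `-τ` produces minus the centred second difference, with one
  -- factor `‖τ‖` from each.
  have h1 := (ha.translate_sub τ).translate_sub (fun i => - τ i)
  refine (h1.neg.congr_fun fun i x => ?_).congr_weight fun i x => by rw [norm_neg]; ring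
  simp only [neg_add_cancel_right, sub_eq_add_neg]
  ring

theorem symbolClass_windowPair {h : E → ℝ} (hh : SymbolClass (fun (_ : Unit) _ => 1) (fun _ => h))
    (s : ι → E) : SymbolClass (fun _ _ => 1) (fun i => windowPair h (s i)) := by
  have hh' := hh.reindex (fun _ : ι => ())
  have h1 := hh'.comp_affine (-ContinuousLinearMap.id ℝ E) s
  have h2 := hh'.comp_affine (ContinuousLinearMap.id ℝ E) s
  refine ((h1.mul h2).congr_fun fun i x => ?_).congr_weight fun _ _ => one_mul _
  simp [windowPair, sub_eq_add_neg, add_comm]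

/-- Swapping the two windows is `u ↦ -u`, so the function is even and its derivative at `0`
vanishes. -/
theorem fderiv_windowPair_zero {h : E → ℝ} (hh : ContDiff ℝ ∞ h) (s : E) :
    fderiv ℝ (fun u => windowPair h s u - h s ^ 2) 0 = 0 := by
  set k : E → ℝ := fun u => windowPair h s u - h s ^ 2
  have hk : ∀ u, k (-u) = k u := fun u => by simp only [k, windowPair, sub_neg_eq_add, ← sub_eq_add_neg]; ring
  have hd : HasFDerivAt k (fderiv ℝ k 0) (-0) := by
    rw [neg_zero]
    refine DifferentiableAt.hasFDerivAt ?_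
    have := hh.differentiable (by simp)
    simp only [k, windowPair]
    fun_prop
  have h1 := hd.comp (0 : E) (hasFDerivAt_id (𝕜 := ℝ) (0 : E)).neg
  rw [show k ∘ Neg.neg = k from funext hk] at h1
  have h2 : fderiv ℝ k 0 + fderiv ℝ k 0 = 0 := by
    nth_rewrite 1 [h1.fderiv]
    ext v
    simp
  have h3 : (2 : ℝ) • fderiv ℝ k 0 = 0 := by rw [two_smul]; exact h2
  simpa using h3

/-- With `m` the image midpoint, the amplitude splits into three parts: `t1`, half the window pair
times the second difference of `a` at `m` with step `√δ s`, is `O(δ)`; `t2'`, the deviation of the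
window pair from `h(s)²` times `a(m)`, is quadratic in `√δ (F(x) - F(y))`; `t3`, `h(s)²` times the
change of `a` from `m` to the midpoint image, is `O(δ (1 + |x - y|))`. -/
theorem symbolClass_errorAmplitude (ha : SymbolClass (fun _ _ => 1) a) (hF : BoundedDeriv F)
    (hδ : ∀ i, 0 ≤ δ i) (hδ1 : ∀ i, δ i ≤ 1) (hs : ∀ i, ‖s i‖ ≤ 2)
    {h : E → ℝ} (hh : SymbolClass (fun (_ : Unit) _ => 1) (fun _ => h)) :
    SymbolClass (fun i (z : E × E × E) => δ i * (1 + ‖z.1 - z.2.1‖ ^ 2))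
      (fun i => errorAmplitude h (a i) (δ i) (F i) (s i)) := by
  obtain ⟨C, hC, hl⟩ := hF.exists_lipschitz
  have hr : ∀ i, |√(δ i)| ≤ 1 := fun i => by
    rw [abs_of_nonneg (Real.sqrt_nonneg _)]
    exact Real.sqrt_le_one.2 (hδ1 i)
  have hU : BoundedDeriv (fun i (z : E × E × E) => (1 / 2 : ℝ) • (F i z.1 - F i z.2.1)) :=
    ((hF.comp_clm (ampFst E)).sub (hF.comp_clm (ampSnd E))).clm ((1 / 2 : ℝ) • ContinuousLinearMap.id ℝ E)
  have hM := boundedDeriv_imageMidpoint hF hδ hδ1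
  have hM' := boundedDeriv_midpointImage hF hδ hδ1
  have hW := symbolClass_windowPair hh s
  obtain ⟨B, hB, hhb⟩ := hh.exists_bound
  have hsq : SymbolClass (fun (_ : ι) (_ : E × E × E) => 1) (fun i _ => h (s i) ^ 2) :=
    SymbolClass.const _ (B := B ^ 2) fun i => by
      rw [norm_pow]
      exact pow_le_pow_left₀ (norm_nonneg _) (by simpa using hhb () (s i)) 2
  have t1 := (hW.comp_boundedDeriv (hU.const_smul hr)).mul
    ((symbolClass_second_difference ha (fun i => (√(δ i) • s i, 0))).comp_boundedDeriv hM)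
  have t2 : SymbolClass (fun i (z : E × E × E) => √(δ i) ^ 2 * (1 + ‖z.1 - z.2.1‖) ^ 2)
      (fun i z => windowPair h (s i) (√(δ i) • ((1 / 2 : ℝ) • (F i z.1 - F i z.2.1)))
        - h (s i) ^ 2) := by
    refine SymbolClass.comp_smul_quadratic (w := fun _ (z : E × E × E) => 1 + ‖z.1 - z.2.1‖)
      (f := fun i u => windowPair h (s i) u - h (s i) ^ 2)
      (fun i z => by linarith [norm_nonneg (z.1 - z.2.1)]) ?_ (fun i => ?_) (fun i => ?_) hU.1 ?_
      hU.2 (fun i => Real.sqrt_nonneg _) (fun i => (le_abs_self _).trans (hr i))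
    · refine hW.sub (SymbolClass.const _ (B := B ^ 2) fun i => ?_)
      rw [norm_pow]
      exact pow_le_pow_left₀ (norm_nonneg _) (by simpa using hhb () (s i)) 2
    · simp [windowPair]; ring
    · exact fderiv_windowPair_zero (hh.contDiff ()) (s i)
    · refine SymbolClass.of_lipschitz_weight (fun i z => by linarith [norm_nonneg (z.1 - z.2.1)])
        hU.1 ⟨C, hC, fun i z => ?_⟩ hU.2
      rw [norm_smul]
      have := hl i z.1 z.2.1
      norm_num
      nlinarith [mul_nonneg hC.le (norm_nonneg (z.1 - z.2.1))]
  have t2' := t2.mul (ha.comp_boundedDeriv hM)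
  have t3 := hsq.mul (SymbolClass.comp_sub_comp ha hM.1 hM.2 hM'.1 hM'.2
    (symbolClass_imageMidpoint_sub hF hδ))
  have u1 : SymbolClass (fun i (z : E × E × E) => δ i * (1 + ‖z.1 - z.2.1‖ ^ 2)) _ :=
    (t1.const_smul (fun _ => 1 / 2)).mono (B := 2) (by norm_num) fun i z => by
      have h1 : ‖((√(δ i) • s i, 0) : E × E)‖ ^ 2 ≤ δ i * 4 := by
        simp only [Prod.norm_mk, norm_zero, norm_smul, Real.norm_of_nonneg (Real.sqrt_nonneg _)]
        rw [max_eq_left (by positivity), mul_pow, Real.sq_sqrt (hδ i)]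
        exact mul_le_mul_of_nonneg_left (by nlinarith [hs i, norm_nonneg (s i)]) (hδ i)
      have h2 : 0 ≤ δ i * ‖z.1 - z.2.1‖ ^ 2 := mul_nonneg (hδ i) (by positivity)
      rw [abs_of_nonneg (by norm_num)]
      linarith
  have u2 : SymbolClass (fun i (z : E × E × E) => δ i * (1 + ‖z.1 - z.2.1‖ ^ 2)) _ :=
    t2'.mono (B := 2) (by norm_num) fun i z => by
      rw [Real.sq_sqrt (hδ i), mul_one, mul_left_comm]
      refine mul_le_mul_of_nonneg_left ?_ (hδ i)
      nlinarith [sq_nonneg (1 - ‖z.1 - z.2.1‖)]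
  have u3 : SymbolClass (fun i (z : E × E × E) => δ i * (1 + ‖z.1 - z.2.1‖ ^ 2)) _ :=
    t3.mono (B := 2) (by norm_num) fun i z => by
      rw [one_mul, mul_left_comm]
      refine mul_le_mul_of_nonneg_left ?_ (hδ i)
      nlinarith [sq_nonneg (1 - ‖z.1 - z.2.1‖)]
  refine (((u1.add u2).add u3).clm Complex.ofRealCLM).congr_fun fun i z => ?_
  simp only [errorAmplitude, halfShift, Complex.ofRealCLM_apply, smul_eq_mul, sub_eq_add_neg,
    Prod.neg_mk, neg_zero]
  congr 1
  ring

end CoherentAmplitudes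

/-! ### The kernel identity behind the coherent state decomposition. -/

section CoherentDecomposition

open Filter Topology
open scoped ComplexConjugate

variable {E : Type} [NormedAddCommGroup E] [InnerProductSpace ℝ E] [FiniteDimensional ℝ E]
  [MeasurableSpace E] [BorelSpace E]

/-- The partial Fourier transform of a symbol, with frequency cutoff. -/
noncomputable def cutKernel (χ : E → ℝ) (n : ℕ) (a : E × E → ℝ) (m v : E) : ℂ :=
  ∫ η, wave η v * ((χ (((n : ℝ) + 1)⁻¹ • η) : ℂ) * (a (m, (2 * Real.pi) • η) : ℂ))

/-- The window of the coherent state decomposition. -/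
noncomputable def coherentWindow (h : E → ℝ) (δ : ℝ) (F : E → E) (s x : E) : ℝ :=
  h ((√δ)⁻¹ • (s - δ • F x))

variable {χ : E → ℝ} {n : ℕ} {a : E × E → ℝ} {h : E → ℝ} {δ : ℝ} {F : E → E}

theorem integrable_cutKernel_integrand (hχc : Continuous χ)
    (hχ0 : ∀ x, x ∉ Metric.closedBall (0 : E) 2 → χ x = 0) (ha : Continuous a) {B : ℝ}
    (hB : ∀ z, |a z| ≤ B) (m v : E) : Integrable (fun η =>
      wave η v * ((χ (((n : ℝ) + 1)⁻¹ • η) : ℂ) * (a (m, (2 * Real.pi) • η) : ℂ))) := by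
  refine ((integrable_cutoff hχc hχ0 n).mul_bdd (c := B)
    (g := fun η => wave η v * (a (m, (2 * Real.pi) • η) : ℂ))
    (Continuous.aestronglyMeasurable ?_) (.of_forall fun η => ?_)).congr (.of_forall fun η => ?_)
  · exact (continuous_id.wave continuous_const).mul (by fun_prop)
  · simpa using hB _
  · simp only; ring

theorem exists_norm_cutKernel_le (hχc : Continuous χ)
    (hχ0 : ∀ x, x ∉ Metric.closedBall (0 : E) 2 → χ x = 0) {B : ℝ}
    (hB : ∀ z, |a z| ≤ B) (n : ℕ) : ∃ C : ℝ, 0 ≤ C ∧ ∀ m v, ‖cutKernel χ n a m v‖ ≤ C := by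
  refine ⟨∫ η, ‖(χ (((n : ℝ) + 1)⁻¹ • η) : ℂ)‖ * B, integral_nonneg fun η =>
    mul_nonneg (norm_nonneg _) ((abs_nonneg _).trans (hB 0)), fun m v => ?_⟩
  refine norm_integral_le_of_norm_le ((integrable_cutoff hχc hχ0 n).norm.mul_const B)
    (.of_forall fun η => ?_)
  rw [norm_mul, norm_wave, one_mul, norm_mul]
  exact mul_le_mul_of_nonneg_left (by simpa using hB _) (norm_nonneg _)

theorem stronglyMeasurable_cutKernel (hχc : Continuous χ) (ha : Continuous a) :
    StronglyMeasurable (fun z : E × E => cutKernel χ n a z.1 z.2) := by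
  refine StronglyMeasurable.integral_prod_right (f := fun (z : E × E) (η : E) =>
    wave η z.2 * ((χ (((n : ℝ) + 1)⁻¹ • η) : ℂ) * (a (z.1, (2 * Real.pi) • η) : ℂ)))
    (Continuous.stronglyMeasurable ?_)
  exact (Continuous.wave (by fun_prop) (by fun_prop)).mul (by fun_prop)

theorem oscKernel_freqCut_weylAmplitude (a : E × E → ℝ) (x y : E) :
    oscKernel (freqCut χ n (weylAmplitude a)) x y
      = cutKernel χ n a ((1 / 2 : ℝ) • (x + y)) (x - y) := by
  simp only [oscKernel, cutKernel, freqCut, weylAmplitude, Complex.real_smul]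

theorem integral_mul_add_sub_mul {f g k : E → ℂ} (hf : Integrable f) (hg : Integrable g)
    (hk : Integrable k) (c d : ℂ) :
    ∫ s, (c * (f s + g s) - d * k s) = c * (∫ s, f s) + c * (∫ s, g s) - d * ∫ s, k s := by
  have h1 : Integrable (fun s => c * (f s + g s)) := (hf.add hg).const_mul c
  rw [integral_sub h1 (hk.const_mul d), integral_const_mul, integral_const_mul, integral_add hf hg,
    mul_add]

theorem oscKernel_freqCut_errorAmplitude (hχc : Continuous χ)
    (hχ0 : ∀ x, x ∉ Metric.closedBall (0 : E) 2 → χ x = 0) (ha : Continuous a) {B : ℝ}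
    (hB : ∀ z, |a z| ≤ B) (s x y : E) :
    oscKernel (freqCut χ n (errorAmplitude h a δ F s)) x y
      = (1 / 2 : ℂ) * windowPair h s (halfShift δ F x y) *
        (cutKernel χ n a ((1 / 2 : ℝ) • (x + y) + (δ / 2) • (F x + F y) + √δ • s) (x - y)
          + cutKernel χ n a ((1 / 2 : ℝ) • (x + y) + (δ / 2) • (F x + F y) + -(√δ • s)) (x - y))
        - (h s : ℂ) ^ 2 * cutKernel χ n a
          ((1 / 2 : ℝ) • (x + y) + δ • F ((1 / 2 : ℝ) • (x + y))) (x - y) := by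
  have hi := fun m => integrable_cutKernel_integrand (n := n) hχc hχ0 ha hB m (x - y)
  simp only [oscKernel, cutKernel]
  rw [mul_add, ← integral_mul_add_sub_mul (hi _) (hi _) (hi _)]
  refine integral_congr_ae (.of_forall fun η => ?_)
  simp only [freqCut, errorAmplitude, Complex.real_smul, imageMidpoint, midpointImage,
    Prod.mk_add_mk, add_zero]
  push_cast
  ring

theorem integrable_prod_of_compact {Φ : E × E → ℂ} (hΦ : Integrable Φ)
    {K : E × (E × E) → ℂ} (hK : AEStronglyMeasurable K) {C R : ℝ} (hC : ∀ z, ‖K z‖ ≤ C)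
    (hR : ∀ s z, R < ‖s‖ → Φ z ≠ 0 → K (s, z) = 0) :
    Integrable (fun w : E × (E × E) => Φ w.2 * K w) := by
  have h1 : Integrable (fun w : E × (E × E) =>
      (Metric.closedBall (0 : E) R).indicator (fun _ => C) w.1 * ‖Φ w.2‖) := by
    refine Integrable.mul_prod ((integrable_indicator_iff measurableSet_closedBall).2
      (integrableOn_const (by exact measure_closedBall_lt_top.ne))) hΦ.norm
  refine h1.mono' ((hΦ.aestronglyMeasurable.comp_snd).mul hK) (.of_forall fun w => ?_)
  rw [norm_mul]
  by_cases hw : w.1 ∈ Metric.closedBall (0 : E) R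
  · rw [Set.indicator_of_mem hw, mul_comm]
    exact mul_le_mul_of_nonneg_right (hC _) (norm_nonneg _)
  · rw [Set.indicator_of_notMem hw, zero_mul]
    by_cases h0 : Φ w.2 = 0
    · simp [h0]
    · rw [show w = (w.1, w.2) from rfl, hR w.1 w.2 (by simpa using hw) h0]
      simp

theorem integral_smul_add (r : ℝ) (hr : 0 < r) (c : E) (Ψ : E → ℂ) :
    ∫ s, Ψ s = (r ^ Module.finrank ℝ E : ℝ) * ∫ s, Ψ (r • s + c) := by
  have h1 := Measure.integral_comp_smul (volume : Measure E) (fun s => Ψ (s + c)) r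
  rw [h1, integral_add_right_eq_self, abs_of_nonneg (by positivity), Complex.real_smul, ← mul_assoc,
    ← Complex.ofReal_mul, mul_inv_cancel₀ (by positivity), Complex.ofReal_one, one_mul]

/-- The new variable is centred at the average of `δ F(x)` and `δ F(y)`, so the two windows are
displaced by opposite amounts. -/
theorem coherentWindow_mul (hδ : 0 < δ) (x y s : E) :
    coherentWindow h δ F (√δ • s + (δ / 2) • (F x + F y)) x *
      coherentWindow h δ F (√δ • s + (δ / 2) • (F x + F y)) y
      = windowPair h s (halfShift δ F x y) := by
  have h0 : √δ ≠ 0 := (Real.sqrt_pos.2 hδ).ne'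
  have h1 : δ = √δ * √δ := (Real.mul_self_sqrt hδ.le).symm
  have h2 : ∀ v : E, (√δ)⁻¹ • (δ • v) = √δ • v := fun v => by
    nth_rewrite 2 [h1]
    rw [smul_smul, ← mul_assoc, inv_mul_cancel₀ h0, one_mul]
  have e1 : (√δ)⁻¹ • (√δ • s + (δ / 2) • (F x + F y) - δ • F x) = s - halfShift δ F x y := by
    have : √δ • s + (δ / 2) • (F x + F y) - δ • F x
      = √δ • s - δ • ((1 / 2 : ℝ) • (F x - F y)) := by module
    rw [this, smul_sub, h2, smul_smul, inv_mul_cancel₀ h0, one_smul]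
    rfl
  have e2 : (√δ)⁻¹ • (√δ • s + (δ / 2) • (F x + F y) - δ • F y) = s + halfShift δ F x y := by
    have : √δ • s + (δ / 2) • (F x + F y) - δ • F y
      = √δ • s + δ • ((1 / 2 : ℝ) • (F x - F y)) := by module
    rw [this, smul_add, h2, smul_smul, inv_mul_cancel₀ h0, one_smul]
    rfl
  rw [coherentWindow, coherentWindow, e1, e2, windowPair]

/-- After recentring and rescaling `s`, evenness of `h` permits averaging over `s` and `-s`. Adding
and subtracting `h(s)²` times the perturbed kernel leaves exactly the error amplitude. -/
theorem integral_coherentWindow_mul_cutKernel (hδ : 0 < δ) (hχc : Continuous χ)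
    (hχ0 : ∀ x, x ∉ Metric.closedBall (0 : E) 2 → χ x = 0) (ha : Continuous a) {B : ℝ}
    (hB : ∀ z, |a z| ≤ B) (hhc : Continuous h)
    (hh0 : ∀ x, x ∉ Metric.closedBall (0 : E) 2 → h x = 0) (hhe : ∀ x, h (-x) = h x) (x y : E) :
    ∫ s, ((coherentWindow h δ F s x * coherentWindow h δ F s y : ℝ) : ℂ) *
        cutKernel χ n a ((1 / 2 : ℝ) • (x + y) + s) (x - y)
      = ((√δ) ^ Module.finrank ℝ E : ℝ) * ((∫ s, h s ^ 2 : ℝ) *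
          oscKernel (freqCut χ n (weylAmplitude fun z => a (z.1 + δ • F z.1, z.2))) x y
        + ∫ s, oscKernel (freqCut χ n (errorAmplitude h a δ F s)) x y) := by
  obtain ⟨C, hC, hCb⟩ := exists_norm_cutKernel_le hχc hχ0 hB n
  rw [integral_smul_add (√δ) (Real.sqrt_pos.2 hδ) ((δ / 2) • (F x + F y))]
  congr 1
  simp only [coherentWindow_mul hδ, oscKernel_freqCut_errorAmplitude hχc hχ0 ha hB]
  set Δ := halfShift δ F x y
  set v := x - y
  set Y := (1 / 2 : ℝ) • (x + y) + (δ / 2) • (F x + F y)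
  have hm : ∀ ε : ℝ, StronglyMeasurable (fun s : E => cutKernel χ n a (Y + ε • √δ • s) v) := fun ε =>
    (stronglyMeasurable_cutKernel hχc ha).comp_measurable
      (g := fun s : E => (Y + ε • √δ • s, v)) (by fun_prop)
  have hw : Integrable (fun s => (windowPair h s Δ : ℂ)) := by
    refine Continuous.integrable_of_hasCompactSupport ?_
      (HasCompactSupport.intro (isCompact_closedBall (0 : E) 2) fun s hs => ?_)
    · unfold windowPair; fun_prop
    · rw [windowPair_eq_zero hh0 hs, Complex.ofReal_zero]
  have hw1 : ∀ ε : ℝ, Integrable (fun s => (windowPair h s Δ : ℂ) *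
      cutKernel χ n a (Y + ε • √δ • s) v) := fun ε =>
    hw.mul_bdd (c := C) (hm ε).aestronglyMeasurable (.of_forall fun s => hCb _ _)
  have hh2 : Integrable (fun s => (h s : ℂ) ^ 2) := by
    refine Continuous.integrable_of_hasCompactSupport (by fun_prop)
      (HasCompactSupport.intro (isCompact_closedBall (0 : E) 2) fun s hs => ?_)
    rw [hh0 s hs]; simp
  have hneg : ∫ s, (windowPair h s Δ : ℂ) * cutKernel χ n a (Y + (-1 : ℝ) • √δ • s) v
      = ∫ s, (windowPair h s Δ : ℂ) * cutKernel χ n a (Y + (1 : ℝ) • √δ • s) v := by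
    rw [← integral_neg_eq_self]
    refine integral_congr_ae (.of_forall fun s => ?_)
    have : windowPair h (-s) Δ = windowPair h s Δ := by
      rw [windowPair, windowPair, show -s - Δ = -(s + Δ) by abel, show -s + Δ = -(s - Δ) by abel,
        hhe, hhe, mul_comm]
    simp only [this, smul_neg, neg_smul, one_smul, neg_neg]
  have key : ∀ s, (1 / 2 : ℂ) * windowPair h s Δ *
        (cutKernel χ n a (Y + √δ • s) v + cutKernel χ n a (Y + -(√δ • s)) v)
        - (h s : ℂ) ^ 2 * cutKernel χ n a
          ((1 / 2 : ℝ) • (x + y) + δ • F ((1 / 2 : ℝ) • (x + y))) v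
      = (1 / 2 : ℂ) * ((windowPair h s Δ : ℂ) * cutKernel χ n a (Y + (1 : ℝ) • √δ • s) v
        + (windowPair h s Δ : ℂ) * cutKernel χ n a (Y + (-1 : ℝ) • √δ • s) v)
        - cutKernel χ n a
          ((1 / 2 : ℝ) • (x + y) + δ • F ((1 / 2 : ℝ) • (x + y))) v * (h s : ℂ) ^ 2 := fun s => by
    simp only [one_smul, neg_smul]
    ring
  simp only [key]
  rw [integral_mul_add_sub_mul (hw1 1) (hw1 (-1)) hh2, hneg, oscKernel_freqCut_weylAmplitude]
  have hsq : ∫ s, (h s : ℂ) ^ 2 = ((∫ s, h s ^ 2 : ℝ) : ℂ) := by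
    rw [← integral_complex_ofReal]; push_cast; rfl
  rw [hsq]
  have hlast : ∫ s, (windowPair h s Δ : ℂ) *
        cutKernel χ n a ((1 / 2 : ℝ) • (x + y) + (√δ • s + (δ / 2) • (F x + F y))) v
      = ∫ s, (windowPair h s Δ : ℂ) * cutKernel χ n a (Y + (1 : ℝ) • √δ • s) v := by
    refine integral_congr_ae (.of_forall fun s => ?_)
    simp only [Y, one_smul]
    congr 2
    abel
  rw [hlast]
  unfold cutKernel
  ring

/-- The translation by `s`, which the window keeps near `δ F(x)`, is what shifts the position
argument of the symbol. -/
theorem exists_coherentState (hh : ContDiff ℝ ∞ h) (hF : ContDiff ℝ ∞ F) (f : 𝓢(E, ℂ))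
    (hf : HasCompactSupport f) (s : E) : ∃ g : 𝓢(E, ℂ), HasCompactSupport g ∧
      ∀ x, g x = coherentWindow h δ F s (x - s) * f (x - s) := by
  have h1 : ContDiff ℝ ∞ (fun x => (coherentWindow h δ F s (x - s) : ℂ) * f (x - s)) := by
    have h2 : ContDiff ℝ ∞ (fun x => coherentWindow h δ F s (x - s)) := by
      unfold coherentWindow; fun_prop
    have h3 : ContDiff ℝ ∞ (fun x => f (x - s)) :=
      (f.smooth ⊤).comp (contDiff_id.sub contDiff_const)
    exact (Complex.ofRealCLM.contDiff.comp h2).mul h3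
  have h2 : HasCompactSupport (fun x => (coherentWindow h δ F s (x - s) : ℂ) * f (x - s)) :=
    (hf.comp_homeomorph (Homeomorph.subRight s)).mul_left
  exact ⟨h2.toSchwartzMap h1, h2, fun x => rfl⟩

end CoherentDecomposition

/-! ### The coherent state identity for quadratic forms. -/

section CoherentIdentity

open Filter Topology
open scoped ComplexConjugate

variable {E : Type} [NormedAddCommGroup E] [InnerProductSpace ℝ E] [FiniteDimensional ℝ E]
  [MeasurableSpace E] [BorelSpace E]

variable {χ : E → ℝ} {n : ℕ} {a : E × E → ℝ} {h : E → ℝ} {δ : ℝ} {F : E → E}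

/-- The kernel of the coherent state decomposition at the point `s`. -/
noncomputable def coherentKernel (χ : E → ℝ) (n : ℕ) (a : E × E → ℝ) (h : E → ℝ) (δ : ℝ) (F : E → E)
    (w : E × (E × E)) : ℂ :=
  ((coherentWindow h δ F w.1 w.2.1 * coherentWindow h δ F w.1 w.2.2 : ℝ) : ℂ) *
    cutKernel χ n a ((1 / 2 : ℝ) • (w.2.1 + w.2.2) + w.1) (w.2.1 - w.2.2)

theorem continuous_freqCut (hχc : Continuous χ) {p : E × E × E → ℂ} (hp : Continuous p) :
    Continuous (freqCut χ n p) := by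
  unfold freqCut; fun_prop

/-- Undoing the translation preserves `x - y` and moves the midpoint by `s`. -/
theorem oscForm_coherentState (hχc : Continuous χ)
    (hχ0 : ∀ x, x ∉ Metric.closedBall (0 : E) 2 → χ x = 0) (ha : Continuous a) {B : ℝ}
    (hB : ∀ z, |a z| ≤ B) {f g : 𝓢(E, ℂ)} {s : E}
    (hg : ∀ x, g x = coherentWindow h δ F s (x - s) * f (x - s)) :
    oscForm (freqCut χ n (weylAmplitude a)) g g
      = ∫ z : E × E, (conj (f z.1) * f z.2) * coherentKernel χ n a h δ F (s, z) := by
  obtain ⟨C, hC, hCb⟩ := exists_norm_cutKernel_le hχc hχ0 hB n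
  rw [oscForm_eq_integral_prod g g (continuous_freqCut hχc (continuous_weylAmplitude ha))
    (fun x y => by rw [oscKernel_freqCut_weylAmplitude]; exact hCb _ _)]
  have : (volume : Measure (E × E)).IsAddRightInvariant :=
    inferInstanceAs ((volume : Measure E).prod (volume : Measure E)).IsAddRightInvariant
  refine Eq.trans (integral_add_right_eq_self _ ((s, s) : E × E)).symm ?_
  refine integral_congr_ae (.of_forall fun z => ?_)
  simp only [Prod.fst_add, Prod.snd_add, hg, add_sub_cancel_right, oscKernel_freqCut_weylAmplitude,
    add_sub_add_right_eq_sub, map_mul, Complex.conj_ofReal, coherentKernel]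
  rw [show (1 / 2 : ℝ) • (z.1 + s + (z.2 + s)) = (1 / 2 : ℝ) • (z.1 + z.2) + s by module]
  push_cast
  ring

/-- `F` may be unbounded, but it is bounded on the compact support of `f`; this confines `s` to a
ball and makes the integrals over `s` converge. -/
theorem exists_coherentWindow_eq_zero (hδ : 0 < δ)
    (hh0 : ∀ x, x ∉ Metric.closedBall (0 : E) 2 → h x = 0) (hF : Continuous F) {f : E → ℂ}
    (hf : HasCompactSupport f) :
    ∃ R : ℝ, ∀ s x, R < ‖s‖ → f x ≠ 0 → coherentWindow h δ F s x = 0 := by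
  obtain ⟨M, hM⟩ := (hf.isCompact.image hF).isBounded.exists_norm_le
  refine ⟨√δ * 2 + δ * M, fun s x hs hx => hh0 _ ?_⟩
  have h1 : ‖F x‖ ≤ M := hM _ ⟨x, subset_tsupport _ hx, rfl⟩
  have hr : 0 < √δ := Real.sqrt_pos.2 hδ
  rw [mem_closedBall_zero_iff, norm_smul, norm_inv, Real.norm_of_nonneg hr.le, not_le,
    ← div_eq_inv_mul, lt_div_iff₀ hr]
  have h2 := norm_sub_norm_le s (δ • F x)
  rw [norm_smul, Real.norm_of_nonneg hδ.le] at h2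
  have h3 := mul_le_mul_of_nonneg_left h1 hδ.le
  linarith

theorem integrable_conj_mul (f : 𝓢(E, ℂ)) :
    Integrable (fun z : E × E => conj (f z.1) * f z.2) := by
  have hg : Integrable (fun x => conj (f x)) := by
    simpa using (Complex.conjCLE.integrable_comp_iff (φ := (f : E → ℂ))).2 f.integrable
  exact hg.mul_prod f.integrable

theorem integrable_coherentKernel (hδ : 0 < δ) (hχc : Continuous χ)
    (hχ0 : ∀ x, x ∉ Metric.closedBall (0 : E) 2 → χ x = 0) (ha : Continuous a) {B : ℝ}
    (hB : ∀ z, |a z| ≤ B) (hhc : Continuous h) (hhl : ∀ x, |h x| ≤ 1)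
    (hh0 : ∀ x, x ∉ Metric.closedBall (0 : E) 2 → h x = 0) (hF : Continuous F) (f : 𝓢(E, ℂ))
    (hf : HasCompactSupport f) :
    Integrable (fun w : E × (E × E) =>
      (conj (f w.2.1) * f w.2.2) * coherentKernel χ n a h δ F w) := by
  obtain ⟨C, hC, hCb⟩ := exists_norm_cutKernel_le hχc hχ0 hB n
  obtain ⟨R, hR⟩ := exists_coherentWindow_eq_zero hδ hh0 hF hf
  refine integrable_prod_of_compact (integrable_conj_mul f) (StronglyMeasurable.aestronglyMeasurable ?_)
    (C := C) (R := R) (fun w => ?_) (fun s z hs hz => ?_)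
  · refine StronglyMeasurable.mul (Continuous.stronglyMeasurable ?_) ?_
    · unfold coherentWindow; fun_prop
    · exact (stronglyMeasurable_cutKernel hχc ha).comp_measurable
        (g := fun w : E × (E × E) => ((1 / 2 : ℝ) • (w.2.1 + w.2.2) + w.1, w.2.1 - w.2.2))
        (by fun_prop)
  · rw [coherentKernel, norm_mul, Complex.norm_real, norm_mul]
    have h1 := mul_le_one₀ (hhl ((√δ)⁻¹ • (w.1 - δ • F w.2.1))) (abs_nonneg _)
      (hhl ((√δ)⁻¹ • (w.1 - δ • F w.2.2)))
    exact (mul_le_of_le_one_left (norm_nonneg _) h1).trans (hCb _ _)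
  · have hz1 : f z.1 ≠ 0 := fun h0 => hz (by simp [h0])
    rw [coherentKernel, hR s z.1 hs hz1]
    simp

theorem continuous_errorAmplitude (ha : Continuous a) (hhc : Continuous h) (hF : Continuous F) (s : E) :
    Continuous (errorAmplitude h a δ F s) := by
  unfold errorAmplitude windowPair halfShift imageMidpoint midpointImage
  fun_prop

/-- The kernel identity integrated against `conj f(x) f(y)`, with Fubini. The error term lives on
the ball of radius `2` because both of its window factors vanish outside. -/
theorem integral_oscForm_coherentState (hδ : 0 < δ) (hχc : Continuous χ)
    (hχ0 : ∀ x, x ∉ Metric.closedBall (0 : E) 2 → χ x = 0) (ha : Continuous a) {B : ℝ}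
    (hB : ∀ z, |a z| ≤ B) (hhc : Continuous h) (hhl : ∀ x, |h x| ≤ 1)
    (hh0 : ∀ x, x ∉ Metric.closedBall (0 : E) 2 → h x = 0) (hhe : ∀ x, h (-x) = h x)
    (hF : Continuous F) (f : 𝓢(E, ℂ)) (hf : HasCompactSupport f) {g : E → 𝓢(E, ℂ)}
    (hg : ∀ s x, g s x = coherentWindow h δ F s (x - s) * f (x - s)) :
    ∫ s, oscForm (freqCut χ n (weylAmplitude a)) (g s) (g s)
      = ((√δ) ^ Module.finrank ℝ E : ℝ) * ((∫ s, h s ^ 2 : ℝ) *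
          oscForm (freqCut χ n (weylAmplitude fun z => a (z.1 + δ • F z.1, z.2))) f f
        + ∫ s in Metric.closedBall (0 : E) 2,
            oscForm (freqCut χ n (errorAmplitude h a δ F s)) f f) := by
  obtain ⟨C, hC, hCb⟩ := exists_norm_cutKernel_le hχc hχ0 hB n
  have hosc : ∀ s x y, _ := fun s x y =>
    oscKernel_freqCut_errorAmplitude (h := h) (δ := δ) (F := F) (n := n) hχc hχ0 ha hB s x y
  have hEb : ∀ s x y, ‖oscKernel (freqCut χ n (errorAmplitude h a δ F s)) x y‖ ≤ 2 * C := by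
    intro s x y
    rw [hosc]
    refine (norm_sub_le _ _).trans ?_
    rw [norm_mul, norm_mul, norm_mul, norm_pow, Complex.norm_real, Complex.norm_real]
    have h1 : ‖windowPair h s (halfShift δ F x y)‖ ≤ 1 := by
      rw [windowPair, norm_mul]
      exact mul_le_one₀ (hhl _) (abs_nonneg _) (hhl _)
    have h2 : ‖h s‖ ^ 2 ≤ 1 := pow_le_one₀ (norm_nonneg _) (hhl s)
    have h3 := norm_add_le
      (cutKernel χ n a ((1 / 2 : ℝ) • (x + y) + (δ / 2) • (F x + F y) + √δ • s) (x - y))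
      (cutKernel χ n a ((1 / 2 : ℝ) • (x + y) + (δ / 2) • (F x + F y) + -(√δ • s)) (x - y))
    have h4 := hCb ((1 / 2 : ℝ) • (x + y) + (δ / 2) • (F x + F y) + √δ • s) (x - y)
    have h5 := hCb ((1 / 2 : ℝ) • (x + y) + (δ / 2) • (F x + F y) + -(√δ • s)) (x - y)
    have h6 := mul_le_mul h2 (hCb ((1 / 2 : ℝ) • (x + y) + δ • F ((1 / 2 : ℝ) • (x + y))) (x - y))
      (norm_nonneg _) zero_le_one
    have h7 := mul_le_mul h1 (h3.trans (add_le_add h4 h5)) (norm_nonneg _) zero_le_one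
    have h8 : ‖(1 / 2 : ℂ)‖ = 1 / 2 := by norm_num
    rw [h8, mul_assoc]
    linarith
  have hE0 : ∀ s, s ∉ Metric.closedBall (0 : E) 2 → ∀ x y,
      oscKernel (freqCut χ n (errorAmplitude h a δ F s)) x y = 0 := by
    intro s hs x y
    rw [hosc, windowPair_eq_zero hh0 hs, hh0 s hs]
    simp
  have hEi : Integrable (fun w : E × (E × E) => (conj (f w.2.1) * f w.2.2) *
      oscKernel (freqCut χ n (errorAmplitude h a δ F w.1)) w.2.1 w.2.2) := by
    refine integrable_prod_of_compact (integrable_conj_mul f)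
      (K := fun w => oscKernel (freqCut χ n (errorAmplitude h a δ F w.1)) w.2.1 w.2.2)
      (StronglyMeasurable.aestronglyMeasurable ?_) (C := 2 * C) (R := 2)
      (fun w => hEb _ _ _) (fun s z hs _ => hE0 s (by simpa using hs) _ _)
    simp only [hosc]
    have hm := stronglyMeasurable_cutKernel (n := n) hχc ha
    have m1 := hm.comp_measurable (g := fun w : E × (E × E) => ((1 / 2 : ℝ) • (w.2.1 + w.2.2) +
      (δ / 2) • (F w.2.1 + F w.2.2) + √δ • w.1, w.2.1 - w.2.2)) (by
        exact Continuous.measurable (by fun_prop))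
    have m2 := hm.comp_measurable (g := fun w : E × (E × E) => ((1 / 2 : ℝ) • (w.2.1 + w.2.2) +
      (δ / 2) • (F w.2.1 + F w.2.2) + -(√δ • w.1), w.2.1 - w.2.2)) (by
        exact Continuous.measurable (by fun_prop))
    have m3 := hm.comp_measurable (g := fun w : E × (E × E) => ((1 / 2 : ℝ) • (w.2.1 + w.2.2) +
      δ • F ((1 / 2 : ℝ) • (w.2.1 + w.2.2)), w.2.1 - w.2.2)) (by
        exact Continuous.measurable (by fun_prop))
    refine (StronglyMeasurable.mul (Continuous.stronglyMeasurable ?_) (m1.add m2)).sub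
      (StronglyMeasurable.mul (Continuous.stronglyMeasurable ?_) m3)
    · unfold windowPair halfShift; fun_prop
    · fun_prop
  have hL : ∀ s, oscForm (freqCut χ n (weylAmplitude a)) (g s) (g s)
      = ∫ z : E × E, (conj (f z.1) * f z.2) * coherentKernel χ n a h δ F (s, z) := fun s =>
    oscForm_coherentState hχc hχ0 ha hB (hg s)
  have hR : ∀ s, oscForm (freqCut χ n (errorAmplitude h a δ F s)) f f
      = ∫ z : E × E, (conj (f z.1) * f z.2) *
          oscKernel (freqCut χ n (errorAmplitude h a δ F s)) z.1 z.2 := fun s =>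
    oscForm_eq_integral_prod f f (continuous_freqCut hχc (continuous_errorAmplitude ha hhc hF s))
      (hEb s)
  have hbc : Continuous (weylAmplitude fun z => a (z.1 + δ • F z.1, z.2)) :=
    continuous_weylAmplitude (by fun_prop)
  obtain ⟨C', hC', hCb'⟩ := exists_norm_cutKernel_le (a := fun z => a (z.1 + δ • F z.1, z.2))
    hχc hχ0 (fun z => hB _) n
  have hbi : Integrable (fun z : E × E => (conj (f z.1) * f z.2) *
      oscKernel (freqCut χ n (weylAmplitude fun z => a (z.1 + δ • F z.1, z.2))) z.1 z.2) :=
    integrable_schwartz_mul_bounded f f (C := C')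
      (stronglyMeasurable_oscKernel (continuous_freqCut hχc hbc))
      (fun z => by rw [oscKernel_freqCut_weylAmplitude]; exact hCb' _ _)
  rw [setIntegral_eq_integral_of_forall_compl_eq_zero fun s hs => by
    rw [hR]; simp [hE0 s hs]]
  simp only [hL, hR]
  rw [integral_integral_swap (f := fun s z => (conj (f z.1) * f z.2) * coherentKernel χ n a h δ F (s, z))
      (integrable_coherentKernel hδ hχc hχ0 ha hB hhc hhl hh0 hF f hf),
    integral_integral_swap (f := fun (s : E) (z : E × E) => (conj (f z.1) * f z.2) *
      oscKernel (freqCut χ n (errorAmplitude h a δ F s)) z.1 z.2) hEi,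
    oscForm_eq_integral_prod f f (continuous_freqCut hχc hbc) (C := C')
      (fun x y => by rw [oscKernel_freqCut_weylAmplitude]; exact hCb' _ _),
    ← integral_const_mul, ← integral_add (hbi.const_mul _) hEi.integral_prod_right,
    ← integral_const_mul]
  refine integral_congr_ae (.of_forall fun z => ?_)
  simp only [integral_const_mul, coherentKernel]
  rw [integral_coherentWindow_mul_cutKernel hδ hχc hχ0 ha hB hhc hh0 hhe]
  ring

/-- The normalization matches the factor in front of the perturbed form, so an upper bound `M`
passes through with no loss in its leading constant. -/
theorem integral_coherentWindow_sq (hδ : 0 < δ) (x : E) :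
    ∫ s, coherentWindow h δ F s x ^ 2 = (√δ) ^ Module.finrank ℝ E * ∫ s, h s ^ 2 := by
  have h1 := integral_smul_add (√δ) (Real.sqrt_pos.2 hδ) (δ • F x)
    (fun s => ((coherentWindow h δ F s x ^ 2 : ℝ) : ℂ))
  have h2 : ∀ s, coherentWindow h δ F (√δ • s + δ • F x) x = h s := fun s => by
    rw [coherentWindow, add_sub_cancel_right, smul_smul, inv_mul_cancel₀ (Real.sqrt_pos.2 hδ).ne',
      one_smul]
  simp only [h2, integral_complex_ofReal] at h1
  exact_mod_cast h1

end CoherentIdentity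

/-! ### Transfer of upper bounds from a symbol to its perturbation. -/

section Transfer

open Filter Topology
open scoped ComplexConjugate

variable {ι : Type*} {E : Type} [NormedAddCommGroup E] [InnerProductSpace ℝ E]
  [FiniteDimensional ℝ E] [MeasurableSpace E] [BorelSpace E]

theorem oscForm_freqCut_smul (χ : E → ℝ) (n : ℕ) (c : ℝ) (p : E × E × E → ℂ) (f g : E → ℂ) :
    oscForm (freqCut χ n fun z => c • p z) f g = c * oscForm (freqCut χ n p) f g := by
  have h1 : ∀ x y, oscKernel (freqCut χ n fun z => c • p z) x y
      = c * oscKernel (freqCut χ n p) x y := fun x y => by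
    simp only [oscKernel, ← integral_const_mul]
    refine integral_congr_ae (.of_forall fun η => ?_)
    simp only [freqCut, Complex.real_smul]
    ring
  simp only [oscForm, h1, ← integral_const_mul]
  refine integral_congr_ae (.of_forall fun x => integral_congr_ae (.of_forall fun y => ?_))
  simp only
  ring

/-- The error amplitude divided by `δ`, with `s` as an extra index, is a uniform family of weight `1
+ |x - y|²`, which Calderón–Vaillancourt accepts. -/
theorem exists_norm_oscForm_errorAmplitude_le {a : ι → E × E → ℝ} {F : ι → E → E} {δ : ι → ℝ}
    (ha : SymbolClass (fun _ _ => 1) a) (hF : BoundedDeriv F) (hδ : ∀ i, 0 < δ i)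
    (hδ1 : ∀ i, δ i ≤ 1) {h χ : E → ℝ} (hh : SymbolClass (fun (_ : Unit) _ => 1) (fun _ => h))
    (hχ : SymbolClass (fun (_ : Unit) _ => 1) (fun _ => χ))
    (hχ0 : ∀ x, x ∉ Metric.closedBall (0 : E) 2 → χ x = 0) :
    ∃ C : ℝ, 0 < C ∧ ∀ i (n : ℕ), ∀ s ∈ Metric.closedBall (0 : E) 2, ∀ f : 𝓢(E, ℂ),
      ‖oscForm (freqCut χ n (errorAmplitude h (a i) (δ i) (F i) s)) f f‖
        ≤ C * δ i * ∫ x, ‖f x‖ ^ 2 := by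
  have h1 := symbolClass_errorAmplitude (ι := ι × Metric.closedBall (0 : E) 2)
    (s := fun j => (j.2 : E)) (ha.reindex Prod.fst) (hF.reindex Prod.fst) (fun j => (hδ j.1).le)
    (fun j => hδ1 j.1) (fun j => mem_closedBall_zero_iff.1 j.2.2) hh
  have h2 := (h1.const_smul (fun j => (δ j.1)⁻¹)).congr_weight
    (w' := fun _ (z : E × E × E) => 1 + ‖z.1 - z.2.1‖ ^ 2) fun j z => by
      rw [abs_of_pos (inv_pos.2 (hδ j.1)), inv_mul_cancel_left₀ (hδ j.1).ne']
  obtain ⟨C, hC, hb⟩ := exists_norm_oscForm_le (symbolClass_freqCut h2 hχ)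
    (fun j => freqCompact_freqCut hχ0 _ _)
  refine ⟨2 * C, by positivity, fun i n s hs f => ?_⟩
  have h3 := hb ((i, ⟨s, hs⟩), n) f f
  simp only [oscForm_freqCut_smul] at h3
  rw [norm_mul, Complex.norm_real, Real.norm_of_nonneg (inv_pos.2 (hδ i)).le, inv_mul_le_iff₀ (hδ i)]
    at h3
  refine h3.trans_eq ?_
  ring

theorem symbolClass_perturbed {a : ι → E × E → ℝ} {F : ι → E → E} {δ : ι → ℝ}
    (ha : SymbolClass (fun _ _ => 1) a) (hF : BoundedDeriv F) {B : ℝ} (hδ : ∀ i, |δ i| ≤ B) :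
    SymbolClass (fun _ _ => 1) (fun i (z : E × E) => a i (z.1 + δ i • F i z.1, z.2)) := by
  refine ha.comp_boundedDeriv (g := fun i (z : E × E) => (z.1 + δ i • F i z.1, z.2)) ?_
  exact ((BoundedDeriv.of_clm (ContinuousLinearMap.fst ℝ E E)).add
    ((hF.comp_clm (ContinuousLinearMap.fst ℝ E E)).const_smul hδ)).prodMk
    (BoundedDeriv.of_clm (ContinuousLinearMap.snd ℝ E E))

theorem integrable_coherentWindow_sq {h : E → ℝ} {δ : ℝ} {F : E → E} (hδ : 0 < δ)
    (hhc : Continuous h) (hhl : ∀ x, |h x| ≤ 1)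
    (hh0 : ∀ x, x ∉ Metric.closedBall (0 : E) 2 → h x = 0) (hF : Continuous F) (f : 𝓢(E, ℂ))
    (hf : HasCompactSupport f) :
    Integrable (fun w : E × E => coherentWindow h δ F w.1 w.2 ^ 2 * ‖f w.2‖ ^ 2) := by
  obtain ⟨R, hR⟩ := exists_coherentWindow_eq_zero hδ hh0 hF hf
  have h1 : Integrable (fun w : E × E =>
      (Metric.closedBall (0 : E) R).indicator (fun _ => (1 : ℝ)) w.1 * ‖f w.2‖ ^ 2) :=
    Integrable.mul_prod ((integrable_indicator_iff measurableSet_closedBall).2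
      (integrableOn_const (by exact measure_closedBall_lt_top.ne))) (integrable_norm_sq_schwartz f)
  refine h1.mono' (Continuous.aestronglyMeasurable ?_) (.of_forall fun w => ?_)
  · have hfc := f.continuous
    unfold coherentWindow; fun_prop
  · rw [Real.norm_of_nonneg (by positivity)]
    by_cases hw : w.1 ∈ Metric.closedBall (0 : E) R
    · rw [Set.indicator_of_mem hw]
      refine mul_le_mul_of_nonneg_right ?_ (by positivity)
      rw [sq_le_one_iff_abs_le_one]
      exact hhl _
    · rw [Set.indicator_of_notMem hw, zero_mul]
      by_cases h0 : f w.2 = 0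
      · simp [h0]
      · rw [hR w.1 w.2 (by simpa using hw) h0]; simp

/-- Test the bound `M` on every coherent state and integrate in `s`. The constant is uniform over
the family, since the return trip uses symbols and maps that depend on `δ`. -/
theorem exists_weylForm_perturbed_le {a : ι → E × E → ℝ} {F : ι → E → E} {δ : ι → ℝ}
    (ha : SymbolClass (fun _ _ => 1) a) (hF : BoundedDeriv F) (hδ : ∀ i, 0 < δ i)
    (hδ1 : ∀ i, δ i ≤ 1) :
    ∃ C : ℝ, 0 < C ∧ ∀ i (M : ℝ),
      (∀ g : 𝓢(E, ℂ), HasCompactSupport g → (weylForm (a i) g g).re ≤ M * ∫ x, ‖g x‖ ^ 2) →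
      ∀ f : 𝓢(E, ℂ), HasCompactSupport f →
        (weylForm (fun z => a i (z.1 + δ i • F i z.1, z.2)) f f).re
          ≤ (M + C * δ i) * ∫ x, ‖f x‖ ^ 2 := by
  obtain ⟨h, hhs, hh0, hhe, hhn, hhl, -, hhpos⟩ := exists_smooth_window E
  have hh : SymbolClass (fun (_ : Unit) _ => 1) (fun _ => h) :=
    symbolClass_one_of_compactSupport hhs (isCompact_closedBall _ _) hh0
  obtain ⟨χ, hχ, hχ0, -, hχ1, hχn, hχl⟩ := exists_smooth_cutoff E
  have hχc : Continuous χ := hχ.continuous ()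
  obtain ⟨C, hC, hCb⟩ := exists_norm_oscForm_errorAmplitude_le ha hF hδ hδ1 hh hχ hχ0
  obtain ⟨C₁, hC₁, hCb₁⟩ := exists_norm_oscForm_freqCut_le ha hχ hχ0
  obtain ⟨B, hB, hBa⟩ := ha.exists_bound
  set c := ∫ s, h s ^ 2
  set V := (volume : Measure E).real (Metric.closedBall (0 : E) 2)
  have hV : 0 ≤ V := measureReal_nonneg
  -- The error is at most `C δ` at each `s` in a ball of volume `V`, divided by the normalization `c
  -- = ∫ h²`; the `1` makes the constant positive.
  refine ⟨V * C / c + 1, by positivity, fun i M hM f hf => ?_⟩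
  set N := ∫ x, ‖f x‖ ^ 2
  have hN : 0 ≤ N := integral_nonneg fun x => by positivity
  have hac : Continuous (a i) := ha.continuous i
  have hFc : Continuous (F i) := (hF.1 i).continuous
  have hab : ∀ z, |a i z| ≤ B := fun z => by simpa using hBa i z
  have hhl' : ∀ x, |h x| ≤ 1 := fun x => by rw [abs_of_nonneg (hhn x)]; exact hhl x
  choose g hgc hg using fun s => exists_coherentState (δ := δ i) hhs (hF.1 i) f hf s
  set D := √(δ i) ^ Module.finrank ℝ E with hD
  have hDpos : 0 < D := pow_pos (Real.sqrt_pos.2 (hδ i)) _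
  have hW := integrable_coherentWindow_sq (hδ i) hhs.continuous hhl' hh0 hFc f hf
  have hgN : ∀ s, ∫ x, ‖g s x‖ ^ 2 = ∫ x, coherentWindow h (δ i) (F i) s x ^ 2 * ‖f x‖ ^ 2 := by
    intro s
    rw [← integral_sub_right_eq_self (fun x => coherentWindow h (δ i) (F i) s x ^ 2 * ‖f x‖ ^ 2) s]
    refine integral_congr_ae (.of_forall fun x => ?_)
    simp only [hg, norm_mul, mul_pow, Complex.norm_real, Real.norm_eq_abs, sq_abs]
  have hgNi : Integrable (fun s => ∫ x, ‖g s x‖ ^ 2) := by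
    simp only [hgN]; exact hW.integral_prod_left
  have hgNint : ∫ s, ∫ x, ‖g s x‖ ^ 2 = D * c * N := by
    simp only [hgN]
    rw [integral_integral_swap hW]
    simp only [integral_mul_const, integral_coherentWindow_sq (hδ i)]
    rw [integral_const_mul]
  let Q : ℕ → E → ℂ := fun n s => oscForm (freqCut χ n (weylAmplitude (a i))) (g s) (g s)
  have hQi : ∀ n, Integrable (Q n) := fun n => by
    have := (integrable_coherentKernel (n := n) (hδ i) hχc hχ0 hac hab hhs.continuous hhl' hh0 hFc f
      hf).integral_prod_left
    refine this.congr (.of_forall fun s => ?_)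
    exact (oscForm_coherentState hχc hχ0 hac hab (hg s)).symm
  have hQlim : ∀ s, Tendsto (fun n => Q n s) atTop (𝓝 (weylForm (a i) (g s) (g s))) := fun s =>
    tendsto_oscForm_freqCut (ha.reindex fun _ : Unit => i) hχc hχ0 hχ1 hχn hχl (g s) (g s)
  have hQb : ∀ n s, ‖Q n s‖ ≤ 2 * C₁ * ∫ x, ‖g s x‖ ^ 2 := fun n s =>
    (hCb₁ i n (g s) (g s)).trans_eq (by ring)
  have hQint : Tendsto (fun n => ∫ s, Q n s) atTop (𝓝 (∫ s, weylForm (a i) (g s) (g s))) :=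
    tendsto_integral_of_dominated_convergence _ (fun n => (hQi n).aestronglyMeasurable)
      (hgNi.const_mul (2 * C₁)) (fun n => .of_forall (hQb n)) (.of_forall hQlim)
  have hwi : Integrable (fun s => weylForm (a i) (g s) (g s)) :=
    (hgNi.const_mul (2 * C₁)).mono'
      (aestronglyMeasurable_of_tendsto_ae atTop (fun n => (hQi n).aestronglyMeasurable)
        (.of_forall hQlim))
      (.of_forall fun s => le_of_tendsto (hQlim s).norm (.of_forall fun n => hQb n s))
  have hup : (∫ s, weylForm (a i) (g s) (g s)).re ≤ M * (D * c * N) := by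
    have e : (∫ s, weylForm (a i) (g s) (g s)).re = ∫ s, (weylForm (a i) (g s) (g s)).re :=
      (integral_re hwi).symm
    rw [e, ← hgNint, ← integral_const_mul]
    exact integral_mono hwi.re (hgNi.const_mul M) fun s => hM (g s) (hgc s)
  have hb := symbolClass_perturbed (ι := Unit) (a := fun _ => a i) (F := fun _ => F i)
    (δ := fun _ => δ i) (ha.reindex fun _ => i) (hF.reindex fun _ => i) (B := δ i)
    (fun _ => (abs_of_pos (hδ i)).le)
  have hblim := tendsto_oscForm_freqCut hb hχc hχ0 hχ1 hχn hχl f f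
  -- The identity and the error bound hold at each frequency cutoff; `hfinal` then lets `n → ∞` on
  -- both sides.
  have hlevel : ∀ n, D * (c * (oscForm (freqCut χ n
      (weylAmplitude fun z => a i (z.1 + δ i • F i z.1, z.2))) f f).re - V * C * δ i * N)
      ≤ (∫ s, Q n s).re := by
    intro n
    have h1 := integral_oscForm_coherentState (n := n) (hδ i) hχc hχ0 hac hab hhs.continuous hhl' hh0
      hhe hFc f hf hg
    have h2 : ‖∫ s in Metric.closedBall (0 : E) 2,
        oscForm (freqCut χ n (errorAmplitude h (a i) (δ i) (F i) s)) f f‖ ≤ C * δ i * N * V :=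
      norm_setIntegral_le_of_norm_le_const measure_closedBall_lt_top
        (fun s hs => hCb i n s hs f)
    have h3 := (Complex.abs_re_le_norm _).trans h2
    have h4 := (abs_le.1 h3).1
    simp only [Q]
    rw [h1, Complex.re_ofReal_mul, Complex.add_re, Complex.re_ofReal_mul]
    refine mul_le_mul_of_nonneg_left ?_ hDpos.le
    simp only [c]
    linarith
  have hfinal : D * (c * (weylForm (fun z => a i (z.1 + δ i • F i z.1, z.2)) f f).re
      - V * C * δ i * N) ≤ (∫ s, weylForm (a i) (g s) (g s)).re := by
    refine le_of_tendsto_of_tendsto' ?_ ((Complex.continuous_re.tendsto _).comp hQint) hlevel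
    exact ((((Complex.continuous_re.tendsto _).comp hblim).const_mul c).sub_const _).const_mul D
  have h5 := hfinal.trans hup
  rw [show M * (D * c * N) = D * (c * M * N) by ring] at h5
  have h6 := le_of_mul_le_mul_left h5 hDpos
  have h7 : c * (weylForm (fun z => a i (z.1 + δ i • F i z.1, z.2)) f f).re
      ≤ c * ((M + V * C / c * δ i) * N) := by
    have : c * ((M + V * C / c * δ i) * N) = c * M * N + V * C * δ i * N := by
      field_simp
    linarith
  refine (le_of_mul_le_mul_left h7 hhpos).trans ?_
  refine mul_le_mul_of_nonneg_right ?_ hN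
  have := hδ i
  linarith

end Transfer

/-! ### Inverting `id + δ F` with uniform derivative bounds. -/

section InverseMap

variable {ι : Type*} {E : Type*} [NormedAddCommGroup E] [NormedSpace ℝ E]

/-- `Dψ` inverts `id + DA(ψ)`, hence has norm at most `2`. Differentiating this relation expresses
`D²ψ` through `Dψ` and `D²A(ψ)`, which bootstraps the bounds. -/
theorem symbolClass_fderiv_inverse {A : ι → E → E} {ψ : ι → E → E} (hA : BoundedDeriv A)
    (hA1 : ∀ i x, ‖fderiv ℝ (A i) x‖ ≤ 1 / 2) (hψ : ∀ i, ContDiff ℝ ∞ (ψ i))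
    (h1 : ∀ i y, ψ i y + A i (ψ i y) = y) (h2 : ∀ i x, ψ i (x + A i x) = x) :
    BoundedDeriv ψ := by
  refine ⟨hψ, ?_⟩
  have hdψ : ∀ i, Differentiable ℝ (ψ i) := fun i => (hψ i).differentiable (by simp)
  have hP : ∀ i, ContDiff ℝ ∞ (fderiv ℝ (ψ i)) := fun i => (hψ i).fderiv_right (by simp)
  have hA' : ∀ i, ContDiff ℝ ∞ (fderiv ℝ (A i)) := fun i => (hA.1 i).fderiv_right (by simp)
  have e1 : ∀ i y, (ContinuousLinearMap.id ℝ E + fderiv ℝ (A i) (ψ i y)).comp (fderiv ℝ (ψ i) y)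
      = ContinuousLinearMap.id ℝ E := by
    intro i y
    have h := (hdψ i y).hasFDerivAt.add
      ((hA.differentiable i (ψ i y)).hasFDerivAt.comp y (hdψ i y).hasFDerivAt)
    have h' := h.congr_of_eventuallyEq (f₁ := fun y => y) (.of_forall fun y => (h1 i y).symm)
    rw [ContinuousLinearMap.add_comp, ContinuousLinearMap.id_comp]
    exact h'.unique (hasFDerivAt_id y)
  have e2 : ∀ i y, (fderiv ℝ (ψ i) y).comp
      (ContinuousLinearMap.id ℝ E + fderiv ℝ (A i) (ψ i y)) = ContinuousLinearMap.id ℝ E := by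
    intro i y
    have hd := (hdψ i (ψ i y + A i (ψ i y))).hasFDerivAt.comp (ψ i y)
      ((hasFDerivAt_id (ψ i y)).add (hA.differentiable i (ψ i y)).hasFDerivAt)
    rw [h1] at hd
    have h' := hd.congr_of_eventuallyEq (f₁ := fun x => x) (.of_forall fun x => (h2 i x).symm)
    exact h'.unique (hasFDerivAt_id _)
  have hP0 : ∀ i y, ‖fderiv ℝ (ψ i) y‖ ≤ 2 := by
    intro i y
    have h := e1 i y
    rw [ContinuousLinearMap.add_comp, ContinuousLinearMap.id_comp] at h
    have h3 := ContinuousLinearMap.opNorm_comp_le (fderiv ℝ (A i) (ψ i y)) (fderiv ℝ (ψ i) y)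
    have h4 := mul_le_mul_of_nonneg_right (hA1 i (ψ i y)) (norm_nonneg (fderiv ℝ (ψ i) y))
    have h5 : ‖fderiv ℝ (ψ i) y‖ ≤ ‖ContinuousLinearMap.id ℝ E‖
        + ‖(fderiv ℝ (A i) (ψ i y)).comp (fderiv ℝ (ψ i) y)‖ := by
      nth_rewrite 1 [eq_sub_of_add_eq h]
      exact norm_sub_le _ _
    have h6 : ‖ContinuousLinearMap.id ℝ E‖ ≤ 1 := ContinuousLinearMap.norm_id_le
    linarith
  have hD : ∀ i y, fderiv ℝ (fderiv ℝ (ψ i)) y =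
      -((ContinuousLinearMap.compL ℝ E E E (fderiv ℝ (ψ i) y)).comp
        (((ContinuousLinearMap.compL ℝ E E E).flip (fderiv ℝ (ψ i) y)).comp
          ((fderiv ℝ (fderiv ℝ (A i)) (ψ i y)).comp (fderiv ℝ (ψ i) y)))) := by
    intro i y
    have hdP := ((hP i).differentiable (by simp) y).hasFDerivAt
    have hdA := (((hA' i).differentiable (by simp) (ψ i y)).hasFDerivAt.comp y
      (hdψ i y).hasFDerivAt).const_add (ContinuousLinearMap.id ℝ E)
    have h := hdA.clm_comp hdP
    have h0 := (h.congr_of_eventuallyEq (f₁ := fun _ => ContinuousLinearMap.id ℝ E)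
      (.of_forall fun y => (e1 i y).symm)).unique (hasFDerivAt_const _ _)
    ext1 v
    have hv := congrArg (fun L => (fderiv ℝ (ψ i) y).comp (L v)) h0
    simp only [_root_.add_apply, ContinuousLinearMap.comp_apply,
      ContinuousLinearMap.compL_apply, ContinuousLinearMap.flip_apply, _root_.zero_apply,
      ContinuousLinearMap.comp_zero, ContinuousLinearMap.comp_add] at hv
    rw [← ContinuousLinearMap.comp_assoc, Function.comp_apply, e2,
      ContinuousLinearMap.id_comp] at hv
    simpa using eq_neg_of_add_eq_zero_left hv
  intro n
  induction n with
  | zero => exact SymbolBound.zero_iff.2 ⟨hP, 2, by norm_num, fun i y => by simpa using hP0 i y⟩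
  | succ n ih =>
    refine SymbolBound.succ_iff.2 ⟨SymbolBound.zero_iff.2 ⟨hP, 2, by norm_num, fun i y => by
      simpa using hP0 i y⟩, ?_⟩
    -- Order `n` of the composite needs `Dψ` only up to order `n - 1`, which the induction
    -- hypothesis covers.
    have h3 : SymbolBound n (fun _ _ => 1) (fun i y => fderiv ℝ (fderiv ℝ (A i)) (ψ i y)) :=
      (hA.2.fderiv n).comp hψ fun m hm => ih.of_le (by omega)
    have h4 := ih.clm (ContinuousLinearMap.compL ℝ E E E)
    have h5 := ih.clm (ContinuousLinearMap.compL ℝ E E E).flip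
    have h6 := (h4.clm_comp (h5.clm_comp (h3.clm_comp ih))).neg
    have h7 : (fun i => fderiv ℝ (fderiv ℝ (ψ i))) = _ := funext fun i => funext fun y => hD i y
    rw [h7]
    exact h6.mono one_pos fun i x => by norm_num

/-- `A` is a `1/2`-contraction, so `id + A` is a homeomorphism; its derivative is invertible by the
Neumann series, hence the inverse is smooth. -/
theorem exists_smooth_inverse [CompleteSpace E] {A : E → E} (hA : ContDiff ℝ ∞ A)
    (hA1 : ∀ x, ‖fderiv ℝ A x‖ ≤ 1 / 2) :
    ∃ ψ : E → E, ContDiff ℝ ∞ ψ ∧ (∀ y, ψ y + A (ψ y) = y) ∧ ∀ x, ψ (x + A x) = x := by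
  have hd : Differentiable ℝ A := hA.differentiable (by simp)
  have hap : ApproximatesLinearOn (fun x => x + A x)
      ((ContinuousLinearEquiv.refl ℝ E : E ≃L[ℝ] E) : E →L[ℝ] E) Set.univ (1 / 2) := by
    intro x _ y _
    have := convex_univ.norm_image_sub_le_of_norm_fderiv_le (𝕜 := ℝ) (fun x _ => hd x)
      (fun x _ => hA1 x) (Set.mem_univ y) (Set.mem_univ x)
    simpa [add_sub_add_comm] using this
  have hc : Subsingleton E ∨ (1 / 2 : NNReal) <
      ‖((ContinuousLinearEquiv.refl ℝ E).symm : E →L[ℝ] E)‖₊⁻¹ := by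
    rcases subsingleton_or_nontrivial E with h | h
    · exact .inl h
    · right
      have : ‖((ContinuousLinearEquiv.refl ℝ E).symm : E →L[ℝ] E)‖₊ = 1 :=
        NNReal.eq ContinuousLinearMap.norm_id
      rw [this, inv_one]
      exact NNReal.half_lt_self one_ne_zero
  let Φ := hap.toHomeomorph _ hc
  have hΦ : ∀ x, Φ x = x + A x := fun x => rfl
  have hlt : ∀ x, ‖-fderiv ℝ A x‖ < 1 := fun x => by
    rw [norm_neg]; exact (hA1 x).trans_lt (by norm_num)
  refine ⟨Φ.symm, ?_, fun y => Φ.apply_symm_apply y, fun x => Φ.symm_apply_apply x⟩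
  refine Φ.contDiff_symm (f₀' := fun x => ContinuousLinearEquiv.unitsEquiv ℝ E
    (Units.oneSub (-fderiv ℝ A x) (hlt x))) (fun x => ?_) (contDiff_id.add hA)
  have h := (hasFDerivAt_id x).add (hd x).hasFDerivAt
  have e : ((ContinuousLinearEquiv.unitsEquiv ℝ E (Units.oneSub (-fderiv ℝ A x) (hlt x)) :
      E ≃L[ℝ] E) : E →L[ℝ] E) = ContinuousLinearMap.id ℝ E + fderiv ℝ A x := by
    ext v
    simp [ContinuousLinearEquiv.unitsEquiv_apply]
  rw [e]
  exact h

theorem exists_inverse_perturbation [CompleteSpace E] {F : E → E}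
    (hF : BoundedDeriv (fun _ : Unit => F)) :
    ∃ δ₀ : ℝ, 0 < δ₀ ∧ δ₀ ≤ 1 ∧ ∃ G : {δ : ℝ // 0 < δ ∧ δ ≤ δ₀} → E → E, BoundedDeriv G ∧
      ∀ (δ : {δ : ℝ // 0 < δ ∧ δ ≤ δ₀}) (y : E), (y + (δ : ℝ) • G δ y) + (δ : ℝ) • F (y + (δ : ℝ) • G δ y) = y := by
  obtain ⟨C, hC, hb⟩ := hF.2.exists_bound
  have hb' : ∀ x, ‖fderiv ℝ F x‖ ≤ C := fun x => by simpa using hb () x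
  refine ⟨min 1 (1 / (2 * C)), by positivity, min_le_left _ _, ?_⟩
  set I := {δ : ℝ // 0 < δ ∧ δ ≤ min 1 (1 / (2 * C))}
  have hFI := hF.reindex (fun _ : I => ())
  have hδ1 : ∀ δ : I, |(δ : ℝ)| ≤ 1 := fun δ => by
    rw [abs_of_pos δ.2.1]; exact δ.2.2.trans (min_le_left _ _)
  have hA : BoundedDeriv (fun (δ : I) x => (δ : ℝ) • F x) := hFI.const_smul hδ1
  have hA1 : ∀ (δ : I) x, ‖fderiv ℝ (fun x => (δ : ℝ) • F x) x‖ ≤ 1 / 2 := fun δ x => by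
    rw [fderiv_fun_const_smul (hF.differentiable () x), norm_smul, Real.norm_of_nonneg δ.2.1.le]
    have h1 := δ.2.2.trans (min_le_right _ _)
    rw [le_div_iff₀ (by positivity)] at h1
    have h2 := mul_le_mul_of_nonneg_left (hb' x) δ.2.1.le
    linarith
  choose ψ hψ h1 h2 using fun δ : I => exists_smooth_inverse (hA.1 δ) (hA1 δ)
  have hψb := symbolClass_fderiv_inverse hA hA1 hψ h1 h2
  -- From `ψ(y) + δ F(ψ(y)) = y` the inverse is `id + δ G` with `G = -F ∘ ψ`.
  refine ⟨fun δ y => -F (ψ δ y), (hFI.comp hψb).neg, fun (δ : I) (y : E) => ?_⟩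
  have h3 : y + (δ : ℝ) • -F (ψ δ y) = ψ δ y := by
    rw [smul_neg, ← sub_eq_add_neg, sub_eq_iff_eq_add]
    exact (h1 δ y).symm
  rw [h3]
  exact h1 δ y

end InverseMap

/-! ### The operators on `L²`, their spectral edges and the conclusion. -/

section WeylOperator

open Filter Topology
open scoped ComplexConjugate

variable {d : ℕ}

theorem IsSymbolS000.symbolClass {a : Rd d × Rd d → ℝ} (ha : IsSymbolS000 a) :
    SymbolClass (fun (_ : Unit) _ => 1) (fun _ => a) := by
  refine fun n => ⟨fun _ => ha.1, fun k _ => ?_⟩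
  obtain ⟨C, hC⟩ := ha.2 k
  exact ⟨|C| + 1, by positivity, fun _ x => by linarith [hC x, le_abs_self C]⟩

theorem IsC1infty.boundedDeriv {F : Rd d → Rd d} (hF : IsC1infty F) :
    BoundedDeriv (fun _ : Unit => F) := by
  refine ⟨fun _ => hF.1, fun n => ⟨fun _ => hF.1.fderiv_right (by simp), fun k _ => ?_⟩⟩
  obtain ⟨C, hC⟩ := hF.2 (k + 1) (by omega)
  refine ⟨|C| + 1, by positivity, fun _ x => ?_⟩
  rw [norm_iteratedFDeriv_fderiv]
  linarith [hC x, le_abs_self C]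

theorem weylAction_eq_weylIntegral (a : Rd d × Rd d → ℝ) (φ : 𝓢(Rd d, ℂ)) :
    weylAction a φ = weylIntegral a φ := by
  ext x
  set Ψ : Rd d → ℂ := fun η => ∫ y : Rd d, Complex.exp (Complex.I * (inner ℝ η (x - y) : ℝ)) *
        (a ((1 / 2 : ℝ) • (x + y), η) : ℂ) * φ y with hΨ
  have h1 := Measure.integral_comp_smul (volume : Measure (Rd d)) Ψ (2 * Real.pi)
  rw [finrank_euclideanSpace_fin, abs_of_pos (by positivity), Complex.real_smul] at h1
  rw [weylAction, ← h1, weylIntegral]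
  refine integral_congr_ae (.of_forall fun η => integral_congr_ae (.of_forall fun y => ?_))
  simp only [wave, weylAmplitude, inner_smul_left, conj_trivial]
  rw [mul_comm Complex.I]

theorem isWeylExtension_weylOp {a : Rd d × Rd d → ℝ}
    (ha : SymbolClass (fun (_ : Unit) _ => 1) (fun _ => a)) : IsWeylExtension a (weylOp a) := by
  have h : ∃ T : L2Rd d →L[ℂ] L2Rd d, IsWeylExtension a T := by
    obtain ⟨T, hT⟩ := exists_clm_weylIntegral ha
    exact ⟨T, fun φ => by rw [weylAction_eq_weylIntegral]; exact hT φ⟩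
  rw [weylOp, dif_pos h]
  exact h.choose_spec

theorem inner_weylOp {a : Rd d × Rd d → ℝ}
    (ha : SymbolClass (fun (_ : Unit) _ => 1) (fun _ => a)) (f g : 𝓢(Rd d, ℂ)) :
    inner ℂ (g.toLp 2 volume) (weylOp a (f.toLp 2 volume)) = weylForm a f g := by
  have h := isWeylExtension_weylOp ha f
  rw [weylAction_eq_weylIntegral] at h
  rw [MeasureTheory.L2.inner_def, weylForm]
  refine integral_congr_ae ?_
  filter_upwards [h, g.coeFn_toLp 2 volume] with x hx hgx
  rw [hx, hgx, RCLike.inner_apply, mul_comm]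

theorem denseRange_toLp_two : DenseRange (fun f : 𝓢(Rd d, ℂ) => f.toLp 2 volume) :=
  SchwartzMap.denseRange_toLpCLM (F := ℂ) (μ := (volume : Measure (Rd d))) (p := 2) (by norm_num)

theorem isSelfAdjoint_weylOp {a : Rd d × Rd d → ℝ}
    (ha : SymbolClass (fun (_ : Unit) _ => 1) (fun _ => a)) : IsSelfAdjoint (weylOp a) := by
  rw [ContinuousLinearMap.isSelfAdjoint_iff_isSymmetric]
  intro u v
  refine denseRange_toLp_two.induction_on₂
    (p := fun u v => inner ℂ (weylOp a u) v = inner ℂ u (weylOp a v))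
    (isClosed_eq (by fun_prop) (by fun_prop)) (fun f g => ?_) u v
  rw [← inner_conj_symm, inner_weylOp ha, inner_weylOp ha, weylForm_conj_symm ha, Complex.conj_conj]

theorem weylOp_neg {a : Rd d × Rd d → ℝ}
    (ha : SymbolClass (fun (_ : Unit) _ => 1) (fun _ => a)) :
    weylOp (fun z => - a z) = - weylOp a := by
  refine IsWeylExtension.unique (isWeylExtension_weylOp ha.neg) fun φ => ?_
  have h := isWeylExtension_weylOp ha φ
  rw [weylAction_eq_weylIntegral] at h ⊢
  filter_upwards [h, Lp.coeFn_neg (weylOp a (φ.toLp 2 volume))] with x hx hn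
  rw [_root_.neg_apply, hn, Pi.neg_apply, hx, weylIntegral_neg_symbol]

/-- Needed for a nonempty spectrum, without which `sSup` would be a default value. -/
theorem nontrivial_L2Rd : Nontrivial (L2Rd d) := by
  obtain ⟨G, hG, hG0, -, -, -, -, hpos⟩ := exists_smooth_window (Rd d)
  have hc : HasCompactSupport (fun x => (G x : ℂ)) :=
    HasCompactSupport.intro (isCompact_closedBall (0 : Rd d) 2) fun x hx => by rw [hG0 x hx]; simp
  have hs : ContDiff ℝ ∞ (fun x => (G x : ℂ)) := Complex.ofRealCLM.contDiff.comp hG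
  refine ⟨(hc.toSchwartzMap hs).toLp 2 volume, 0, fun h => ?_⟩
  have h1 := norm_toLp_two (hc.toSchwartzMap hs)
  rw [h, norm_zero, eq_comm, Real.sqrt_eq_zero (integral_nonneg fun x => by positivity)] at h1
  have h2 : ∫ x, G x ^ 2 = 0 := by
    rw [← h1]
    exact integral_congr_ae (.of_forall fun x => by simp)
  exact hpos.ne' h2

/-- The spectrum is real, and lying below `M` means that `M - T` is a positive operator. -/
theorem IsSelfAdjoint.sSup_re_spectrum_le_iff {H : Type*} [NormedAddCommGroup H]
    [InnerProductSpace ℂ H] [CompleteSpace H] [Nontrivial H] {T : H →L[ℂ] H} (hT : IsSelfAdjoint T)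
    (M : ℝ) :
    sSup (Complex.re '' spectrum ℂ T) ≤ M ↔ ∀ u, (inner ℂ u (T u)).re ≤ M * ‖u‖ ^ 2 := by
  have himg : Complex.re '' spectrum ℂ T = spectrum ℝ T := hT.spectrumRestricts.image
  have hne : (Complex.re '' spectrum ℂ T).Nonempty := (spectrum.nonempty T).image _
  have hbd : BddAbove (Complex.re '' spectrum ℂ T) :=
    ((spectrum.isCompact T).image Complex.continuous_re).bddAbove
  rw [csSup_le_iff hbd hne, himg, ← le_algebraMap_iff_spectrum_le (a := T) hT,
    ContinuousLinearMap.le_def, ContinuousLinearMap.isPositive_def']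
  have hsa : IsSelfAdjoint (algebraMap ℝ (H →L[ℂ] H) M - T) :=
    (IsSelfAdjoint.algebraMap _ (IsSelfAdjoint.all M)).sub hT
  rw [and_iff_right hsa]
  refine forall_congr' fun u => ?_
  have h1 : (algebraMap ℝ (H →L[ℂ] H) M) u = (M : ℂ) • u := by
    rw [Algebra.algebraMap_eq_smul_one]
    rfl
  have h2 : (algebraMap ℝ (H →L[ℂ] H) M - T).reApplyInnerSelf u
      = M * ‖u‖ ^ 2 - (inner ℂ u (T u)).re := by
    rw [ContinuousLinearMap.reApplyInnerSelf_apply, inner_re_symm, _root_.sub_apply, h1,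
      inner_sub_right, inner_smul_right, inner_self_eq_norm_sq_to_K]
    simp [← Complex.ofReal_pow]
  rw [h2, sub_nonneg]

theorem upperEdge_le_iff {T : L2Rd d →L[ℂ] L2Rd d} (hT : IsSelfAdjoint T) (M : ℝ) :
    upperEdge T ≤ M ↔ ∀ u, (inner ℂ u (T u)).re ≤ M * ‖u‖ ^ 2 := by
  have := nontrivial_L2Rd (d := d)
  exact hT.sSup_re_spectrum_le_iff M

/-- By density and continuity the edge is tested on smooth compactly supported functions, the class
for which coherent states are available. -/
theorem upperEdge_weylOp_le_iff {a : Rd d × Rd d → ℝ}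
    (ha : SymbolClass (fun (_ : Unit) _ => 1) (fun _ => a)) (M : ℝ) :
    upperEdge (weylOp a) ≤ M ↔ ∀ f : 𝓢(Rd d, ℂ), HasCompactSupport f →
      (weylForm a f f).re ≤ M * ∫ x, ‖f x‖ ^ 2 := by
  have hn : ∀ f : 𝓢(Rd d, ℂ), ‖f.toLp 2 volume‖ ^ 2 = ∫ x, ‖f x‖ ^ 2 := fun f => by
    rw [norm_toLp_two, Real.sq_sqrt (integral_nonneg fun x => by positivity)]
  rw [upperEdge_le_iff (isSelfAdjoint_weylOp ha)]
  refine ⟨fun h f _ => ?_, fun h u => ?_⟩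
  · rw [← inner_weylOp ha, ← hn]
    exact h _
  · refine (Lp.dense_hasCompactSupport_contDiff (F := ℂ) (μ := (volume : Measure (Rd d))) (p := 2)
      (by norm_num)).induction (P := fun u => (inner ℂ u (weylOp a u)).re ≤ M * ‖u‖ ^ 2) ?_
      (isClosed_le (Complex.continuous_re.comp (by fun_prop)) (by fun_prop)) u
    rintro u ⟨g, hug, hgc, hgs⟩
    have hu : u = (hgc.toSchwartzMap hgs).toLp 2 volume :=
      Lp.ext (hug.trans ((hgc.toSchwartzMap hgs).coeFn_toLp 2 volume).symm)
    rw [hu, inner_weylOp ha, hn]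
    exact h _ hgc

theorem lowerEdge_eq_neg_upperEdge (T : L2Rd d →L[ℂ] L2Rd d) : lowerEdge T = - upperEdge (-T) := by
  rw [lowerEdge, upperEdge, ← spectrum.neg_eq, Real.sInf_def]
  congr 2
  ext x
  simp only [Set.mem_neg, Set.mem_image]
  constructor
  · rintro ⟨z, hz, hx⟩
    exact ⟨-z, by simpa using hz, by simp [hx]⟩
  · rintro ⟨z, hz, hx⟩
    exact ⟨-z, by simpa using hz, by simp [hx]⟩

/-- The transfer is used twice: from `a` along `F`, and from the perturbed symbol along `G`, which
returns exactly to `a`. -/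
theorem exists_abs_upperEdge_sub_le {a : Rd d × Rd d → ℝ}
    (ha : SymbolClass (fun (_ : Unit) _ => 1) (fun _ => a)) {F : Rd d → Rd d}
    (hF : BoundedDeriv (fun _ : Unit => F)) :
    ∃ C : ℝ, 0 < C ∧ ∃ δ₀ : ℝ, 0 < δ₀ ∧ δ₀ ≤ 1 ∧ ∀ δ : ℝ, 0 < δ → δ ≤ δ₀ →
      |upperEdge (weylOp (perturbedSymbol a F δ)) - upperEdge (weylOp a)| ≤ C * δ := by
  obtain ⟨δ₀, hδ₀, hδ₁, G, hG, hGF⟩ := exists_inverse_perturbation hF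
  have hpos : ∀ δ : {δ : ℝ // 0 < δ ∧ δ ≤ δ₀}, 0 < (δ : ℝ) := fun δ => δ.2.1
  have hle : ∀ δ : {δ : ℝ // 0 < δ ∧ δ ≤ δ₀}, (δ : ℝ) ≤ 1 := fun δ => δ.2.2.trans hδ₁
  have habs : ∀ δ : {δ : ℝ // 0 < δ ∧ δ ≤ δ₀}, |(δ : ℝ)| ≤ 1 := fun δ => by rw [abs_of_pos (hpos δ)]; exact hle δ
  have haI := ha.reindex (fun _ : {δ : ℝ // 0 < δ ∧ δ ≤ δ₀} => ())
  have hFI := hF.reindex (fun _ : {δ : ℝ // 0 < δ ∧ δ ≤ δ₀} => ())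
  have hb : SymbolClass (fun (_ : {δ : ℝ // 0 < δ ∧ δ ≤ δ₀}) _ => 1) (fun δ => perturbedSymbol a F δ) :=
    symbolClass_perturbed haI hFI habs
  obtain ⟨C₁, hC₁, h₁⟩ := exists_weylForm_perturbed_le haI hFI hpos hle
  obtain ⟨C₂, hC₂, h₂⟩ := exists_weylForm_perturbed_le hb hG hpos hle
  refine ⟨max C₁ C₂, lt_max_of_lt_left hC₁, δ₀, hδ₀, hδ₁, fun δ hδ hδl => ?_⟩
  let i : {δ : ℝ // 0 < δ ∧ δ ≤ δ₀} := ⟨δ, hδ, hδl⟩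
  have hbi := hb.reindex (fun _ : Unit => i)
  have e₁ : upperEdge (weylOp (perturbedSymbol a F δ)) ≤ upperEdge (weylOp a) + C₁ * δ :=
    (upperEdge_weylOp_le_iff hbi _).2 (h₁ i _ ((upperEdge_weylOp_le_iff ha _).1 le_rfl))
  have e₂ : upperEdge (weylOp a) ≤ upperEdge (weylOp (perturbedSymbol a F δ)) + C₂ * δ := by
    refine (upperEdge_weylOp_le_iff ha _).2 ?_
    have h := h₂ i _ ((upperEdge_weylOp_le_iff hbi _).1 le_rfl)
    have hinv : (fun z : Rd d × Rd d => perturbedSymbol a F i (z.1 + (i : ℝ) • G i z.1, z.2)) = a := by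
      ext z
      simp only [perturbedSymbol, hGF]
    rwa [hinv] at h
  have m₁ := mul_le_mul_of_nonneg_right (le_max_left C₁ C₂) hδ.le
  have m₂ := mul_le_mul_of_nonneg_right (le_max_right C₁ C₂) hδ.le
  rw [abs_le]
  constructor <;> linarith

theorem perturbedSymbol_neg_neg (a : Rd d × Rd d → ℝ) (F : Rd d → Rd d) (δ : ℝ) :
    perturbedSymbol a (fun x => -F x) (-δ) = perturbedSymbol a F δ := by
  ext z
  simp [perturbedSymbol]

theorem perturbedSymbol_zero (a : Rd d × Rd d → ℝ) (F : Rd d → Rd d) :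
    perturbedSymbol a F 0 = a := by
  ext z
  simp [perturbedSymbol]

theorem exists_abs_upperEdge_sub_le_abs {a : Rd d × Rd d → ℝ}
    (ha : SymbolClass (fun (_ : Unit) _ => 1) (fun _ => a)) {F : Rd d → Rd d}
    (hF : BoundedDeriv (fun _ : Unit => F)) :
    ∃ C : ℝ, 0 < C ∧ ∃ δ₀ : ℝ, 0 < δ₀ ∧ δ₀ ≤ 1 ∧ ∀ δ : ℝ, |δ| ≤ δ₀ →
      |upperEdge (weylOp (perturbedSymbol a F δ)) - upperEdge (weylOp a)| ≤ C * |δ| := by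
  obtain ⟨C₁, hC₁, δ₁, hδ₁, hl₁, h₁⟩ := exists_abs_upperEdge_sub_le ha hF
  obtain ⟨C₂, hC₂, δ₂, hδ₂, -, h₂⟩ := exists_abs_upperEdge_sub_le ha hF.neg
  refine ⟨max C₁ C₂, lt_max_of_lt_left hC₁, min δ₁ δ₂, lt_min hδ₁ hδ₂, (min_le_left _ _).trans hl₁,
    fun δ hδ => ?_⟩
  rcases lt_trichotomy δ 0 with h | rfl | h
  · rw [abs_of_neg h] at hδ ⊢
    have := h₂ (-δ) (neg_pos.2 h) (hδ.trans (min_le_right _ _))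
    rw [perturbedSymbol_neg_neg] at this
    exact this.trans (mul_le_mul_of_nonneg_right (le_max_right _ _) (neg_pos.2 h).le)
  · simp [perturbedSymbol_zero]
  · rw [abs_of_pos h] at hδ ⊢
    exact (h₁ δ h (hδ.trans (min_le_left _ _))).trans
      (mul_le_mul_of_nonneg_right (le_max_left _ _) h.le)

end WeylOperator

/-- The first conjunct certifies that `weylOp` is the true extension and not its default `0`, and
that the edges are those of a self-adjoint operator. -/
theorem theorem2 (d : ℕ) (a : Rd d × Rd d → ℝ) (ha : IsSymbolS000 a)
    (F : Rd d → Rd d) (hF : IsC1infty F) (μ : ℝ) (hμ : 0 < μ)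
    (hF2 : ∃ C : ℝ, 0 < C ∧ ∀ (j k : Fin d) (x : Rd d),
      ‖secondPartial F j k x‖ ≤ C * japaneseBracket x ^ (-(1 + μ))) :
    (∀ δ : ℝ, |δ| ≤ 1 →
      IsWeylExtension (perturbedSymbol a F δ) (weylOp (perturbedSymbol a F δ)) ∧
      IsSelfAdjoint (weylOp (perturbedSymbol a F δ))) ∧
    ∃ C : ℝ, 0 < C ∧ ∃ δ₀ : ℝ, 0 < δ₀ ∧ ∀ δ : ℝ, |δ| ≤ δ₀ →
      |upperEdge (weylOp (perturbedSymbol a F δ)) - upperEdge (weylOp (perturbedSymbol a F 0))|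
          ≤ C * |δ| ^ ((1 + μ) / (2 + μ)) ∧
      |lowerEdge (weylOp (perturbedSymbol a F δ)) - lowerEdge (weylOp (perturbedSymbol a F 0))|
          ≤ C * |δ| ^ ((1 + μ) / (2 + μ)) := by
  have hF' := hF.boundedDeriv
  have hp : ∀ δ : ℝ, SymbolClass (fun (_ : Unit) _ => 1) (fun _ => perturbedSymbol a F δ) :=
    fun δ => symbolClass_perturbed ha.symbolClass hF' (fun _ => le_rfl)
  refine ⟨fun δ _ => ⟨isWeylExtension_weylOp (hp δ), isSelfAdjoint_weylOp (hp δ)⟩, ?_⟩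
  obtain ⟨C₁, hC₁, δ₁, hδ₁, hl₁, h₁⟩ := exists_abs_upperEdge_sub_le_abs ha.symbolClass hF'
  obtain ⟨C₂, hC₂, δ₂, hδ₂, -, h₂⟩ := exists_abs_upperEdge_sub_le_abs ha.symbolClass.neg hF'
  refine ⟨max C₁ C₂, lt_max_of_lt_left hC₁, min δ₁ δ₂, lt_min hδ₁ hδ₂, fun δ hδ => ?_⟩
  -- The Lipschitz bound is weakened to the Hölder exponent, which is at most `1`, using `|δ| ≤ δ₁ ≤
  -- 1`.
  have hpow : |δ| ≤ |δ| ^ ((1 + μ) / (2 + μ)) := by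
    rcases (abs_nonneg δ).eq_or_lt with h | h
    · rw [← h]; positivity
    · have hθ : (1 + μ) / (2 + μ) ≤ 1 := (div_le_one (by linarith)).2 (by linarith)
      simpa using Real.rpow_le_rpow_of_exponent_ge h
        (hδ.trans ((min_le_left _ _).trans hl₁)) hθ
  have hup : ∀ C, 0 ≤ C → C ≤ max C₁ C₂ →
      C * |δ| ≤ max C₁ C₂ * |δ| ^ ((1 + μ) / (2 + μ)) := fun C h0 hC =>
    mul_le_mul hC hpow (abs_nonneg δ) (h0.trans hC)
  rw [perturbedSymbol_zero]
  refine ⟨(h₁ δ (hδ.trans (min_le_left _ _))).trans (hup _ hC₁.le (le_max_left _ _)), ?_⟩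
  have h := h₂ δ (hδ.trans (min_le_right _ _))
  -- The lower edge is minus the upper edge of the operator with symbol `-a`.
  rw [show perturbedSymbol (fun z => -a z) F δ = fun z => -perturbedSymbol a F δ z from rfl,
    weylOp_neg (hp δ), weylOp_neg ha.symbolClass] at h
  rw [lowerEdge_eq_neg_upperEdge, lowerEdge_eq_neg_upperEdge, neg_sub_neg, abs_sub_comm]
  exact h.trans (hup _ hC₂.le (le_max_right _ _))
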